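/- For $\gamma\in(0,1)$, $a<b$ and real functions $f,g$, define the one-sided fractional derivatives in Weyl form \[ (D^{\gamma}_{a+}f)(x)=\frac{1}{\Gamma(1-\gamma)}\Bigl(\frac{f(x)}{(x-a)^{\gamma}}+\gamma\int_a^x\frac{f(x)-f(u)}{(x-u)^{\gamma+1}}\,du\Bigr), \qquad (D^{\gamma}_{b-}g)(x)=\frac{e^{i\pi\gamma}}{\Gamma(1-\gamma)}\Bigl(\frac{g(x)}{(b-x)^{\gamma}}+\gamma\int_x^b\frac{g(x)-g(u)}{(u-x)^{\gamma+1}}\,du\Bigr), \] where the integrals are improper at $u=x$ (limits of $\int_a^{x-\varepsilon}$, $\int_{x+\varepsilon}^b$ as $\varepsilon\downarrow0$). Let $g_{b-}(x)=g(x)-g(b-)$, and set \[ \int_a^b f\,dg=e^{i\pi\alpha}\int_a^b (D^{\alpha}_{a+}f)(x)\,(D^{1-\alpha}_{b-}g_{b-})(x)\,dx . \] Let $\lambda\in(0,1)$, $\nu>0$, and let $g:[0,1]\to\mathbb R$ satisfy, for some constant $C$, \[ |g(x)-g(y)|\le C|x-y|^{\lambda}\,\bigl|\log|x-y|\bigr|^{\nu}\qquad\text{for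 all }x,y\in[0,1]\text{ with }|x-y|\le\tfrac12 . \] For $\alpha\in(1-\lambda,1)$ and $\mu>\nu$ let $\rho_{\alpha,\mu}(x)=(1-x)^{\lambda+\alpha-1}|\log(1-x)|^{\mu}$. For $a\in[0,1)$ and $f:[0,1]\to\mathbb R$ we write $D^{\alpha}_{a+}f\in L^1([a,1],\rho_{\alpha,\mu})$ if (i) for every $s\in(a,1)$ we have $f\in I^{\alpha}_{a+}(L^1[a,s])$, that is, there is $\varphi\in L^1[a,s]$ with $f(x)=\frac1{\Gamma(\alpha)}\int_a^x(x-y)^{\alpha-1}\varphi(y)\,dy$ for almost all $x\in[a,s]$, and (ii) $\int_a^1|(D^{\alpha}_{a+}f)(x)|\,\rho_{\alpha,\mu}(x)\,dx<\infty$. Then the following hold. 1. If $\alpha\in(1-\lambda,1)$, $\mu>\nu$ and $D^{\alpha}_{0+}f\in L^1([0,1],\rho_{\alpha,\mu})$, then the extended integral $\int_0^1f\,dg$ is well defined: $g(1-)$ exists, $(D^\alpha_{0+}f)(x)$ exists for almost all $x\in(0,1)$, $(D^{1-\alpha}_{1-}g_{1-})(x)$ exists for all $x\in[0,1)$, and their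 product is Lebesgue integrable on $(0,1)$. 2. If $\alpha_1,\alpha_2\in(1-\lambda,1)$, $\mu_1,\mu_2>\nu$ and $D^{\alpha_j}_{0+}f\in L^1([0,1],\rho_{\alpha_j,\mu_j})$ for $j=1,2$, then the values of $\int_0^1f\,dg$ computed with $\alpha_1$ and with $\alpha_2$ coincide. 3. Let $\alpha\in(1-\lambda,1)$, $\mu>\nu$, $D^{\alpha}_{0+}f\in L^1([0,1],\rho_{\alpha,\mu})$ and $t\in(0,1)$. Then $D^{\alpha}_{0+}f\in L^1[0,t]$, $D^{1-\alpha}_{t-}g_{t-}\in L^{\infty}[0,t]$, and $\int_0^tf\,dg$ is well defined. If moreover $D^{\alpha}_{t+}f\in L^1([t,1],\rho_{\alpha,\mu})$, then $\int_t^1f\,dg$ is well defined and \[ \int_0^1f\,dg=\int_0^tf\,dg+\int_t^1f\,dg , \] all three integrals being taken with the same $\alpha$ (and "well defined" on $[0,t]$ and $[t,1]$ having the same meaning as in 1). -/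

import Mathlib

open MeasureTheory Set Filter Topology

namespace FracInt

noncomputable section

/-- The condition `|g x - g y| ≤ C |x - y| ^ lam |log |x - y|| ^ ν` on `[0,1]`. It is required for
`|x - y| ≤ 1/2` only: the modulus of continuity matters for close points, and at `|x - y| = 1` the
right-hand side vanishes, so asking for it there would force `g 0 = g 1`. -/
def LogHolder (lam ν : ℝ) (g : ℝ → ℝ) : Prop :=
  ∃ C : ℝ, ∀ x ∈ Icc (0 : ℝ) 1, ∀ y ∈ Icc (0 : ℝ) 1, |x - y| ≤ 1 / 2 →
    |g x - g y| ≤ C * |x - y| ^ lam * |Real.log (|x - y|)| ^ ν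

/-- Left-sided Riemann-Liouville fractional integral `(I^α_{a+} φ)(x)`. -/
def rlIntegralLeft (α a : ℝ) (φ : ℝ → ℝ) (x : ℝ) : ℝ :=
  1 / Real.Gamma α * ∫ y in a..x, (x - y) ^ (α - 1) * φ y

/-- `f` belongs to `I^α_{a+}(L^1[a,b])`, i.e. `f` has on `[a,b]` a fractional derivative of
order `α` in `L^1`. -/
def MemRLLeft (α a b : ℝ) (f : ℝ → ℝ) : Prop :=
  ∃ φ : ℝ → ℝ, IntegrableOn φ (Ioo a b) ∧
    ∀ᵐ x ∂(volume.restrict (Ioo a b)), f x = rlIntegralLeft α a φ x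

/-- Weyl form of the left-sided derivative of order `α`, truncated at distance `ε` from the
singularity `u = x`. -/
def weylLeftTrunc (α a : ℝ) (f : ℝ → ℝ) (x ε : ℝ) : ℝ :=
  1 / Real.Gamma (1 - α) *
    (f x / (x - a) ^ α + α * ∫ u in a..(x - ε), (f x - f u) / (x - u) ^ (α + 1))

/-- The integral in the Weyl form of `(D^α_{a+} f)(x)` converges at its singularity. -/
def WeylLeftExists (α a : ℝ) (f : ℝ → ℝ) (x : ℝ) : Prop :=
  ∃ d : ℝ, Tendsto (weylLeftTrunc α a f x) (𝓝[>] 0) (𝓝 d)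

/-- `(D^α_{a+} f)(x)` in Weyl form. -/
def weylLeft (α a : ℝ) (f : ℝ → ℝ) (x : ℝ) : ℝ :=
  limUnder (𝓝[>] 0) (weylLeftTrunc α a f x)

/-- Weyl form of the right-sided derivative of order `β`, truncated at distance `ε` from the
singularity `u = x`; the factor `(-1) ^ β` is `exp (i π β)`. -/
def weylRightTrunc (β b : ℝ) (g : ℝ → ℝ) (x ε : ℝ) : ℂ :=
  Complex.exp (Complex.I * Real.pi * β) / (Real.Gamma (1 - β) : ℂ) *
    ((g x / (b - x) ^ β + β * ∫ u in (x + ε)..b, (g x - g u) / (u - x) ^ (β + 1) : ℝ) : ℂ)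

/-- The integral in the Weyl form of `(D^β_{b-} g)(x)` converges at its singularity. -/
def WeylRightExists (β b : ℝ) (g : ℝ → ℝ) (x : ℝ) : Prop :=
  ∃ d : ℂ, Tendsto (weylRightTrunc β b g x) (𝓝[>] 0) (𝓝 d)

/-- `(D^β_{b-} g)(x)` in Weyl form. -/
def weylRight (β b : ℝ) (g : ℝ → ℝ) (x : ℝ) : ℂ :=
  limUnder (𝓝[>] 0) (weylRightTrunc β b g x)

/-- `g_{b-}(x) = g(x) - g(b-)`. -/
def centered (g : ℝ → ℝ) (b x : ℝ) : ℝ := g x - Function.leftLim g b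

/-- The integrand `D^α_{a+} f · D^{1-α}_{b-} g_{b-}` of the fractional integral. -/
def integrand (α a b : ℝ) (f g : ℝ → ℝ) (x : ℝ) : ℂ :=
  (weylLeft α a f x : ℂ) * weylRight (1 - α) b (centered g b) x

/-- The fractional integral
`∫_a^b f dg = exp (i π α) ∫_a^b (D^α_{a+} f)(x) (D^{1-α}_{b-} g_{b-})(x) dx`. -/
def fracIntegral (α a b : ℝ) (f g : ℝ → ℝ) : ℂ :=
  Complex.exp (Complex.I * Real.pi * α) * ∫ x in a..b, integrand α a b f g x

/-- Everything that occurs in the definition of `fracIntegral α a b f g` exists: the one-sided limit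
`g(b-)`, the derivatives, and the integral of their product as a Lebesgue integral. -/
def IsWellDefined (α a b : ℝ) (f g : ℝ → ℝ) : Prop :=
  (∃ l : ℝ, Tendsto g (𝓝[<] b) (𝓝 l)) ∧
  (∀ᵐ x ∂(volume.restrict (Ioo a b)), WeylLeftExists α a f x) ∧
  (∀ x ∈ Ico a b, WeylRightExists (1 - α) b (centered g b) x) ∧
  IntegrableOn (integrand α a b f g) (Ioo a b)

/-- The weight `ρ(x) = (1 - x)^{lam + α - 1} |log (1 - x)|^μ`. -/
def weight (lam α μ x : ℝ) : ℝ :=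
  (1 - x) ^ (lam + α - 1) * |Real.log (1 - x)| ^ μ

/-- `D^α_{a+} f ∈ L^1([a,1], ρ)`: on every `[a,s]` with `s < 1` the function `f` has a fractional
derivative of order `α` in `L^1`, and `D^α_{a+} f` is integrable on `[a,1]` with the weight `ρ`.
The first part is what makes `D^α_{a+} f` the fractional derivative of `f` (the Weyl expression
alone vanishes, for example, for `f x = (x - a) ^ (α - 1)`), and it makes up for the zero of the
factor `|log (1 - x)|` at `x = 0`. -/
def DerivMemWeightedL1 (lam α μ a : ℝ) (f : ℝ → ℝ) : Prop :=
  (∀ s ∈ Ioo a 1, MemRLLeft α a s f) ∧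
  IntegrableOn (fun x => weylLeft α a f x * weight lam α μ x) (Ioo a 1)

end

end FracInt

namespace FracInt

/-! Reflection `x ↦ 1 - x` turns the right-sided derivative into a left-sided one, and `exp (iπα)
exp (iπ(1-α)) = -1`, so the fractional integral is minus the integral of a real product of
left-sided Weyl derivatives.

Existence. If `f = I^α φ` with `φ` in `L^1`, the truncated Weyl derivative of `f` is a convolution
of `φ` with a rescaled kernel `ε⁻¹ K(·/ε)`, normalised to mass one. `K` has a decreasing integrable
majorant, so the truncations tend to `φ` almost everywhere (`ae_tendsto_weylLeftTrunc`), and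
`weylLeft` recovers `φ`. On the side of `g`, the inequality `1 - α < lam` makes the Weyl integral
absolutely convergent, and the derivative of `g_{b-}` at `x` is `O((b-x)^(lam+α-1) (1 -
log(b-x))^ν)` (`LogModulus.exists_weylLeft_bound`). Near `1` this is dominated by the weight, as `μ
> ν`; away from `1` it is bounded and `D^α f` is integrable.

Independence. Let `α' < α` and `δ = α - α'`. Then `D^{α'} f = I^δ D^α f`, while the derivative of
`g` of order `1 - α` is the right-sided `I^δ` of the one of order `1 - α'`. Fubini on a triangle
moves `I^δ` from one factor to the other (`LogModulus.integral_eq_of_lt`). The identity for `g`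
rests on the fact that a function with logarithmic modulus vanishing at the base point is the
fractional integral of its Weyl derivative (`LogModulus.rlIntegralLeft_weylLeft`).

Additivity. Moving the base point of the `f`-derivative from `0` to `t`, or the end point of the
`g`-derivative from `1` to `t`, produces a correction that is an integral operator applied to the
original derivative. Both corrections have the kernel `((t-y)/(x-t))^α / (x-y)`, so Fubini on the
rectangle `x > t > y` makes them cancel (`LogModulus.integral_add_adjacent`). -/

/-! ### Elementary integrals -/

/-- The fundamental theorem of calculus for a nonnegative derivative, with integrability. -/
lemma integral_Ioo_of_hasDerivAt_of_nonneg {F F' : ℝ → ℝ} {a b : ℝ} (hab : a ≤ b)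
    (hF : ContinuousOn F (Icc a b)) (hd : ∀ x ∈ Ioo a b, HasDerivAt F (F' x) x)
    (h0 : ∀ x ∈ Ioo a b, 0 ≤ F' x) :
    IntegrableOn F' (Ioo a b) ∧ ∫ x in Ioo a b, F' x = F b - F a := by
  have hi : IntegrableOn F' (Ioc a b) :=
    intervalIntegral.integrableOn_deriv_of_nonneg hF hd h0
  refine ⟨hi.mono_set Ioo_subset_Ioc_self, ?_⟩
  rw [← integral_Ioc_eq_integral_Ioo, ← intervalIntegral.integral_of_le hab]
  exact intervalIntegral.integral_eq_sub_of_hasDerivAt_of_le hab hF hd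
    ((intervalIntegrable_iff_integrableOn_Ioc_of_le hab).2 hi)

lemma integral_sub_rpow_left {p a x : ℝ} (hp : 0 < p) (hax : a ≤ x) :
    IntegrableOn (fun u => (x - u) ^ (p - 1)) (Ioo a x) ∧
      ∫ u in Ioo a x, (x - u) ^ (p - 1) = (x - a) ^ p / p := by
  have h := integral_Ioo_of_hasDerivAt_of_nonneg (F := fun u => -((x - u) ^ p / p))
    (F' := fun u => (x - u) ^ (p - 1)) hax ?_ ?_ ?_
  · simpa [Real.zero_rpow hp.ne'] using h
  · refine ContinuousOn.neg (ContinuousOn.div_const (ContinuousOn.rpow_const (by fun_prop) ?_) _)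
    intro u _; right; exact hp.le
  · intro u hu
    have h1 : HasDerivAt (fun u => x - u) (-1) u := by
      simpa using (hasDerivAt_id u).const_sub x
    have h2 := ((h1.rpow_const (p := p) (Or.inl (by linarith [hu.2]))).div_const p).neg
    convert! h2 using 1
    field_simp
  · intro u hu
    have : 0 < x - u := by linarith [hu.2]
    positivity

lemma integral_sub_rpow_right {p y b : ℝ} (hp : 0 < p) (hyb : y ≤ b) :
    IntegrableOn (fun u => (u - y) ^ (p - 1)) (Ioo y b) ∧
      ∫ u in Ioo y b, (u - y) ^ (p - 1) = (b - y) ^ p / p := by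
  have h := integral_Ioo_of_hasDerivAt_of_nonneg (F := fun u => (u - y) ^ p / p)
    (F' := fun u => (u - y) ^ (p - 1)) hyb ?_ ?_ ?_
  · simpa [Real.zero_rpow hp.ne'] using h
  · refine ContinuousOn.div_const (ContinuousOn.rpow_const (by fun_prop) ?_) _
    intro u _; right; exact hp.le
  · intro u hu
    have h1 : HasDerivAt (fun u => u - y) 1 u := by
      simpa using (hasDerivAt_id u).sub_const y
    have h2 := ((h1.rpow_const (p := p) (Or.inl (by linarith [hu.1]))).div_const p)
    convert! h2 using 1
    field_simp
  · intro u hu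
    have : 0 < u - y := by linarith [hu.1]
    positivity

/-- The integral of `u ↦ (x - u) ^ (-α - 1)` away from its singularity. -/
lemma integral_one_div_sub_rpow {α a T x : ℝ} (hα : 0 < α) (haT : a ≤ T) (hTx : T < x) :
    IntegrableOn (fun u => 1 / (x - u) ^ (α + 1)) (Ioo a T) ∧
      α * ∫ u in Ioo a T, 1 / (x - u) ^ (α + 1) = 1 / (x - T) ^ α - 1 / (x - a) ^ α := by
  have h := integral_Ioo_of_hasDerivAt_of_nonneg (F := fun u => (x - u) ^ (-α) / α)
    (F' := fun u => 1 / (x - u) ^ (α + 1)) haT ?_ ?_ ?_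
  · refine ⟨h.1, ?_⟩
    rw [h.2, Real.rpow_neg (by linarith), Real.rpow_neg (by linarith)]
    field_simp
  · refine ContinuousOn.div_const (ContinuousOn.rpow_const (by fun_prop) ?_) _
    intro u hu; left; linarith [hu.2]
  · intro u hu
    have hxu : 0 < x - u := by linarith [hu.2]
    have h1 : HasDerivAt (fun u => x - u) (-1) u := by
      simpa using (hasDerivAt_id u).const_sub x
    have h2 := ((h1.rpow_const (p := -α) (Or.inl hxu.ne')).div_const α)
    convert! h2 using 1
    rw [show -α - 1 = -(α + 1) by ring, Real.rpow_neg hxu.le]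
    field_simp
  · intro u hu
    have : 0 < x - u := by linarith [hu.2]
    positivity

/-- The kernel of the composition of the truncated Weyl derivative with the fractional integral. -/
lemma integral_weyl_kernel {α y T x : ℝ} (hα : 0 < α) (hyT : y < T) (hTx : T < x) :
    IntegrableOn (fun u => (u - y) ^ (α - 1) / (x - u) ^ (α + 1)) (Ioo y T) ∧
      α * ∫ u in Ioo y T, (u - y) ^ (α - 1) / (x - u) ^ (α + 1) =
        ((T - y) / (x - T)) ^ α / (x - y) := by
  -- The derivative of `(u - y)/(x - u)` is `(x - y)/(x - u)^2`, so a power of this quotient is an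
  -- elementary antiderivative.
  have h := integral_Ioo_of_hasDerivAt_of_nonneg
    (F := fun u => ((u - y) / (x - u)) ^ α / (α * (x - y)))
    (F' := fun u => (u - y) ^ (α - 1) / (x - u) ^ (α + 1)) hyT.le ?_ ?_ ?_
  · refine ⟨h.1, ?_⟩
    have : x - y ≠ 0 := by linarith
    rw [h.2]
    simp only [sub_self, zero_div, Real.zero_rpow hα.ne', sub_zero]
    field_simp
  · refine ContinuousOn.div_const (ContinuousOn.rpow_const ?_ ?_) _
    · refine ContinuousOn.div (by fun_prop) (by fun_prop) ?_
      intro u hu; linarith [hu.2]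
    · intro u _; right; exact hα.le
  · intro u hu
    have hxu : 0 < x - u := by linarith [hu.2]
    have huy : 0 < u - y := by linarith [hu.1]
    have h1 : HasDerivAt (fun u => x - u) (-1) u := by
      simpa using (hasDerivAt_id u).const_sub x
    have h2 : HasDerivAt (fun u => u - y) 1 u := by
      simpa using (hasDerivAt_id u).sub_const y
    have h3 := (((h2.div h1 hxu.ne').rpow_const (p := α)
      (Or.inl (div_pos huy hxu).ne')).div_const (α * (x - y)))
    convert! h3 using 1
    have hxy : x - y ≠ 0 := by linarith
    simp only [Pi.div_apply]
    rw [Real.div_rpow huy.le hxu.le, show α + 1 = (α - 1) + 2 by ring,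
      Real.rpow_add hxu, Real.rpow_two]
    have := (Real.rpow_pos_of_pos hxu (α - 1)).ne'
    field_simp
    ring
  · intro u hu
    have hxu : 0 < x - u := by linarith [hu.2]
    have huy : 0 < u - y := by linarith [hu.1]
    positivity

/-- Euler's beta integral on an interval. -/
lemma integral_beta_kernel {α γ y x : ℝ} (hα : 0 < α) (hγ : 0 < γ) (hyx : y < x) :
    IntegrableOn (fun u => (x - u) ^ (α - 1) * (u - y) ^ (γ - 1)) (Ioo y x) ∧
      ∫ u in Ioo y x, (x - u) ^ (α - 1) * (u - y) ^ (γ - 1) =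
        Real.Gamma α * Real.Gamma γ / Real.Gamma (α + γ) * (x - y) ^ (α + γ - 1) := by
  have hval : ∫ u in Ioo y x, (x - u) ^ (α - 1) * (u - y) ^ (γ - 1) =
        Real.Gamma α * Real.Gamma γ / Real.Gamma (α + γ) * (x - y) ^ (α + γ - 1) := by
    have ha : 0 < x - y := by linarith
    have h1 := Complex.betaIntegral_scaled (γ : ℂ) (α : ℂ) ha
    have h2 : ∫ v in (0 : ℝ)..(x - y), (v : ℂ) ^ ((γ : ℂ) - 1) *
        (((x - y : ℝ) : ℂ) - v) ^ ((α : ℂ) - 1) =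
        ((∫ v in (0 : ℝ)..(x - y), v ^ (γ - 1) * ((x - y) - v) ^ (α - 1) : ℝ) : ℂ) := by
      rw [← intervalIntegral.integral_ofReal]
      refine intervalIntegral.integral_congr fun v hv => ?_
      rw [uIcc_of_le ha.le] at hv
      rw [Complex.ofReal_mul, Complex.ofReal_cpow hv.1,
        Complex.ofReal_cpow (by linarith [hv.2] : 0 ≤ x - y - v)]
      push_cast
      rfl
    rw [h2, Complex.betaIntegral_eq_Gamma_mul_div _ _ (by simpa) (by simpa),
      ← Complex.ofReal_add, Complex.Gamma_ofReal, Complex.Gamma_ofReal, Complex.Gamma_ofReal,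
      show ((γ + α : ℝ) : ℂ) - 1 = ((γ + α - 1 : ℝ) : ℂ) by push_cast; ring,
      ← Complex.ofReal_cpow ha.le] at h1
    have h3 : ∫ v in (0 : ℝ)..(x - y), v ^ (γ - 1) * ((x - y) - v) ^ (α - 1) =
        (x - y) ^ (γ + α - 1) * (Real.Gamma γ * Real.Gamma α / Real.Gamma (γ + α)) := by
      exact_mod_cast h1
    rw [← integral_Ioc_eq_integral_Ioo, ← intervalIntegral.integral_of_le hyx.le]
    have h4 := intervalIntegral.integral_comp_sub_right (a := y) (b := x)
      (fun v => v ^ (γ - 1) * ((x - y) - v) ^ (α - 1)) y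
    rw [sub_self, h3] at h4
    calc _ = ∫ u in y..x, (u - y) ^ (γ - 1) * (x - y - (u - y)) ^ (α - 1) := by
            refine intervalIntegral.integral_congr fun u _ => ?_
            simp only [sub_sub_sub_cancel_right]
            ring
      _ = _ := by rw [h4, add_comm γ α]; ring
  refine ⟨?_, hval⟩
  -- A non-integrable function has integral `0` by convention, whereas the computed value is
  -- positive.
  by_contra h
  rw [integral_undef h] at hval
  have : 0 < x - y := by linarith
  have := Real.Gamma_pos_of_pos hα
  have := Real.Gamma_pos_of_pos hγ
  have := Real.Gamma_pos_of_pos (add_pos hα hγ)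
  have : 0 < Real.Gamma α * Real.Gamma γ / Real.Gamma (α + γ) * (x - y) ^ (α + γ - 1) := by
    positivity
  linarith

/-! ### Fubini's theorem on a triangle -/

/-- Fubini's theorem on the triangle `a < y < u < b`. -/
lemma triangle_fubini {a b : ℝ} {k : ℝ → ℝ → ℝ} {φ W : ℝ → ℝ}
    (hkm : AEStronglyMeasurable (Function.uncurry k)
      ((volume.restrict (Ioo a b)).prod (volume.restrict (Ioo a b))))
    (hφ : AEStronglyMeasurable φ (volume.restrict (Ioo a b)))
    (hk : ∀ y ∈ Ioo a b, IntegrableOn (fun u => k u y) (Ioo y b))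
    (hW : ∀ y ∈ Ioo a b, ∫ u in Ioo y b, |k u y| ≤ W y)
    (hI : IntegrableOn (fun y => W y * φ y) (Ioo a b)) :
    (∀ᵐ u ∂(volume.restrict (Ioo a b)), IntegrableOn (fun y => k u y * φ y) (Ioo a u)) ∧
    IntegrableOn (fun u => ∫ y in Ioo a u, k u y * φ y) (Ioo a b) ∧
    IntegrableOn (fun y => (∫ u in Ioo y b, k u y) * φ y) (Ioo a b) ∧
    ∫ u in Ioo a b, ∫ y in Ioo a u, k u y * φ y =
      ∫ y in Ioo a b, (∫ u in Ioo y b, k u y) * φ y := by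
  set μ := volume.restrict (Ioo a b) with hμ
  let D : Set (ℝ × ℝ) := {p | p.2 < p.1}
  have hD : MeasurableSet D := measurableSet_lt measurable_snd measurable_fst
  let F : ℝ × ℝ → ℝ := D.indicator (fun p => k p.1 p.2 * φ p.2)
  have hFm : AEStronglyMeasurable F (μ.prod μ) := (hkm.mul hφ.comp_snd).indicator hD
  have e1 : ∀ u ∈ Ioo a b, ∀ q : ℝ → ℝ,
      ∫ y, (Iio u).indicator q y ∂μ = ∫ y in Ioo a u, q y := by
    intro u hu q
    rw [integral_indicator measurableSet_Iio, hμ, Measure.restrict_restrict measurableSet_Iio]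
    congr 2
    ext y; simp only [mem_inter_iff, mem_Iio, mem_Ioo]
    exact ⟨fun h => ⟨h.2.1, h.1⟩, fun h => ⟨h.2, h.1, h.2.trans hu.2⟩⟩
  have e2 : ∀ y ∈ Ioo a b, μ.restrict (Ioi y) = volume.restrict (Ioo y b) := by
    intro y hy
    rw [hμ, Measure.restrict_restrict measurableSet_Ioi]
    congr 1
    ext u; simp only [mem_inter_iff, mem_Ioi, mem_Ioo]
    exact ⟨fun h => ⟨h.1, h.2.2⟩, fun h => ⟨h.1, hy.1.trans h.1, h.2⟩⟩
  have f1 : ∀ u y, F (u, y) = (Iio u).indicator (fun y => k u y * φ y) y := by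
    intro u y; simp only [F, D, indicator, mem_ofPred_eq, mem_Iio]
  have f2 : ∀ u y, F (u, y) = (Ioi y).indicator (fun u => k u y * φ y) u := by
    intro u y; simp only [F, D, indicator, mem_ofPred_eq, mem_Ioi]
  have hmem : ∀ᵐ y ∂μ, y ∈ Ioo a b := ae_restrict_mem measurableSet_Ioo
  -- Tonelli: the sections in `u` are integrable, and the mass of the section at `y` is at most `|W
  -- y * φ y|`.
  have hF : Integrable F (μ.prod μ) := by
    rw [integrable_prod_iff' hFm]
    constructor
    · filter_upwards [hmem] with y hy
      simp only [f2]
      rw [integrable_indicator_iff measurableSet_Ioi, IntegrableOn, e2 y hy]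
      exact (hk y hy).mul_const _
    · refine hI.norm.mono' hFm.norm.prod_swap.integral_prod_right' ?_
      filter_upwards [hmem] with y hy
      have h0 : ∫ u, ‖F (u, y)‖ ∂μ = (∫ u in Ioo y b, |k u y|) * |φ y| := by
        simp only [f2, norm_indicator_eq_indicator_norm]
        rw [integral_indicator measurableSet_Ioi, e2 y hy, ← integral_mul_const]
        simp only [norm_mul, Real.norm_eq_abs]
      have h1 : 0 ≤ ∫ u in Ioo y b, |k u y| := integral_nonneg fun _ => abs_nonneg _
      rw [h0, Real.norm_of_nonneg (by positivity), norm_mul, Real.norm_eq_abs, Real.norm_eq_abs]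
      gcongr
      exact (hW y hy).trans (le_abs_self _)
  have g1 : (fun u => ∫ y, F (u, y) ∂μ) =ᵐ[μ] fun u => ∫ y in Ioo a u, k u y * φ y := by
    filter_upwards [hmem] with u hu
    simp only [f1]
    exact e1 u hu _
  have g2 : (fun y => ∫ u, F (u, y) ∂μ) =ᵐ[μ] fun y => (∫ u in Ioo y b, k u y) * φ y := by
    filter_upwards [hmem] with y hy
    simp only [f2]
    rw [integral_indicator measurableSet_Ioi, e2 y hy, integral_mul_const]
  refine ⟨?_, hF.integral_prod_left.congr g1, hF.integral_prod_right.congr g2, ?_⟩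
  · filter_upwards [hF.prod_right_ae, hmem] with u hu hu'
    simp only [f1] at hu
    rw [integrable_indicator_iff measurableSet_Iio, IntegrableOn, hμ,
      Measure.restrict_restrict measurableSet_Iio] at hu
    refine hu.mono_measure (Measure.restrict_mono (fun y hy => ?_) le_rfl)
    exact ⟨hy.2, hy.1, hy.2.trans hu'.2⟩
  · rw [← integral_congr_ae g1, ← integral_congr_ae g2, ← integral_prod _ hF,
      ← integral_prod_symm _ hF]

/-! ### Fractional integrals -/

lemma rlIntegralLeft_eq (α : ℝ) {a x : ℝ} (φ : ℝ → ℝ) (hax : a ≤ x) :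
    rlIntegralLeft α a φ x =
      1 / Real.Gamma α * ∫ y in Ioo a x, (x - y) ^ (α - 1) * φ y := by
  rw [rlIntegralLeft, intervalIntegral.integral_of_le hax, integral_Ioc_eq_integral_Ioo]

lemma rlIntegralLeft_congr_ae {α a b : ℝ} {φ χ : ℝ → ℝ}
    (h : φ =ᵐ[volume.restrict (Ioo a b)] χ) {x : ℝ} (hx : x ∈ Ioo a b) :
    rlIntegralLeft α a φ x = rlIntegralLeft α a χ x := by
  rw [rlIntegralLeft_eq _ _ hx.1.le, rlIntegralLeft_eq _ _ hx.1.le]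
  congr 1
  refine integral_congr_ae ?_
  filter_upwards [ae_restrict_of_ae_restrict_of_subset (Ioo_subset_Ioo_right hx.2.le) h] with y hy
  rw [hy]

/-- The fractional integral of an integrable function converges absolutely almost everywhere and
is integrable. -/
lemma rlIntegralLeft_integrable {α a b : ℝ} {φ : ℝ → ℝ} (hα : 0 < α)
    (hφ : IntegrableOn φ (Ioo a b)) :
    (∀ᵐ x ∂(volume.restrict (Ioo a b)),
      IntegrableOn (fun y => (x - y) ^ (α - 1) * φ y) (Ioo a x)) ∧
    IntegrableOn (rlIntegralLeft α a φ) (Ioo a b) := by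
  have h := triangle_fubini (a := a) (b := b) (k := fun u y => (u - y) ^ (α - 1)) (φ := φ)
    (W := fun _ => (b - a) ^ α / α) ?_ hφ.aestronglyMeasurable ?_ ?_ (hφ.const_mul _)
  · refine ⟨h.1, (h.2.1.const_mul (1 / Real.Gamma α)).congr ?_⟩
    filter_upwards [ae_restrict_mem measurableSet_Ioo] with x hx
    rw [rlIntegralLeft_eq _ _ hx.1.le]
  · apply Measurable.aestronglyMeasurable
    simp only [Function.uncurry_def]
    fun_prop
  · intro y hy
    exact (integral_sub_rpow_right hα hy.2.le).1
  · intro y hy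
    have : ∫ u in Ioo y b, |(u - y) ^ (α - 1)| = ∫ u in Ioo y b, (u - y) ^ (α - 1) := by
      refine setIntegral_congr_fun measurableSet_Ioo fun u hu => ?_
      have : 0 < u - y := by linarith [hu.1]
      exact abs_of_nonneg (by positivity)
    rw [this, (integral_sub_rpow_right hα hy.2.le).2]
    have : 0 ≤ b - y := by linarith [hy.2]
    gcongr
    exact hy.1.le

/-- The semigroup property of fractional integrals, at a point of absolute convergence. -/
lemma rlIntegralLeft_rlIntegralLeft {α γ a x : ℝ} {φ : ℝ → ℝ} (hα : 0 < α) (hγ : 0 < γ)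
    (hax : a < x) (hφ : AEStronglyMeasurable φ (volume.restrict (Ioo a x)))
    (hI : IntegrableOn (fun y => (x - y) ^ (α + γ - 1) * φ y) (Ioo a x)) :
    rlIntegralLeft α a (rlIntegralLeft γ a φ) x = rlIntegralLeft (α + γ) a φ x := by
  have hGα := Real.Gamma_pos_of_pos hα
  have hGγ := Real.Gamma_pos_of_pos hγ
  have hGs := Real.Gamma_pos_of_pos (add_pos hα hγ)
  set B := Real.Gamma α * Real.Gamma γ / Real.Gamma (α + γ) with hB
  have h := triangle_fubini (a := a) (b := x)
    (k := fun u y => (x - u) ^ (α - 1) * (u - y) ^ (γ - 1)) (φ := φ)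
    (W := fun y => B * (x - y) ^ (α + γ - 1)) ?_ hφ ?_ ?_ ?_
  · have h1 := h.2.2.2
    rw [rlIntegralLeft_eq _ _ hax.le, rlIntegralLeft_eq _ _ hax.le]
    calc _ = 1 / Real.Gamma α * ∫ u in Ioo a x, (1 / Real.Gamma γ) *
              ∫ y in Ioo a u, (x - u) ^ (α - 1) * (u - y) ^ (γ - 1) * φ y := by
            congr 1
            refine setIntegral_congr_fun measurableSet_Ioo fun u hu => ?_
            rw [rlIntegralLeft_eq _ _ hu.1.le]
            simp only [mul_assoc]
            rw [integral_const_mul]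
            ring
      _ = 1 / Real.Gamma α * (1 / Real.Gamma γ *
            ∫ y in Ioo a x, B * ((x - y) ^ (α + γ - 1) * φ y)) := by
            rw [integral_const_mul, h1]
            congr 2
            refine setIntegral_congr_fun measurableSet_Ioo fun y hy => ?_
            rw [(integral_beta_kernel hα hγ hy.2).2]
            ring
      _ = _ := by
            rw [integral_const_mul, hB]
            field_simp
  · apply Measurable.aestronglyMeasurable
    simp only [Function.uncurry_def]
    fun_prop
  · intro y hy
    exact (integral_beta_kernel hα hγ hy.2).1
  · intro y hy
    rw [← (integral_beta_kernel hα hγ hy.2).2]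
    refine le_of_eq (setIntegral_congr_fun measurableSet_Ioo fun u hu => ?_)
    have : 0 < u - y := by linarith [hu.1]
    have : 0 < x - u := by linarith [hu.2]
    exact abs_of_nonneg (by positivity)
  · simp only [mul_assoc]
    exact hI.const_mul _

/-- Pairing of a fractional integral of order `α` with the kernel of the Weyl derivative of the
same order. -/
lemma integral_rlIntegralLeft_div {α a T x : ℝ} {φ : ℝ → ℝ} (hα : 0 < α) (haT : a ≤ T)
    (hTx : T < x) (hφ : IntegrableOn φ (Ioo a T)) :
    IntegrableOn (fun y => ((T - y) / (x - T)) ^ α / (x - y) * φ y) (Ioo a T) ∧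
    α * ∫ u in Ioo a T, rlIntegralLeft α a φ u / (x - u) ^ (α + 1) =
      1 / Real.Gamma α * ∫ y in Ioo a T, ((T - y) / (x - T)) ^ α / (x - y) * φ y := by
  have h := triangle_fubini (a := a) (b := T)
    (k := fun u y => (u - y) ^ (α - 1) / (x - u) ^ (α + 1)) (φ := φ)
    -- The exact mass of the kernel at `y`, made uniform in `y` by `T - y ≤ T - a` and `x - T ≤ x -
    -- y`.
    (W := fun y => ((T - a) / (x - T)) ^ α / (x - T) / α) ?_ hφ.aestronglyMeasurable
      ?_ ?_ (hφ.const_mul _)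
  · have hk : ∀ y ∈ Ioo a T, (∫ u in Ioo y T, (u - y) ^ (α - 1) / (x - u) ^ (α + 1)) * φ y =
        1 / α * (((T - y) / (x - T)) ^ α / (x - y) * φ y) := by
      intro y hy
      rw [← (integral_weyl_kernel hα hy.2 hTx).2]
      field_simp
    have h2 := (integrableOn_congr_fun hk measurableSet_Ioo).1 h.2.2.1
    refine ⟨?_, ?_⟩
    · refine (integrableOn_congr_fun (fun y _ => ?_) measurableSet_Ioo).1 (h2.const_mul α)
      field_simp
    · calc _ = α * ∫ u in Ioo a T, (1 / Real.Gamma α) *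
              ∫ y in Ioo a u, (u - y) ^ (α - 1) / (x - u) ^ (α + 1) * φ y := by
            congr 1
            refine setIntegral_congr_fun measurableSet_Ioo fun u hu => ?_
            rw [rlIntegralLeft_eq _ _ hu.1.le, mul_div_assoc, ← integral_div]
            congr 2
            ext y
            ring
        _ = _ := by
            rw [integral_const_mul, h.2.2.2, setIntegral_congr_fun measurableSet_Ioo hk,
              integral_const_mul]
            field_simp
  · apply Measurable.aestronglyMeasurable
    simp only [Function.uncurry_def]
    fun_prop
  · intro y hy
    exact (integral_weyl_kernel hα hy.2 hTx).1
  · intro y hy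
    have hxy : x - T < x - y := by linarith [hy.2]
    have hxT : 0 < x - T := by linarith
    have hTy : 0 < T - y := by linarith [hy.2]
    have hya : a < y := hy.1
    have : ∫ u in Ioo y T, |(u - y) ^ (α - 1) / (x - u) ^ (α + 1)| =
        ∫ u in Ioo y T, (u - y) ^ (α - 1) / (x - u) ^ (α + 1) := by
      refine setIntegral_congr_fun measurableSet_Ioo fun u hu => ?_
      have : 0 < u - y := by linarith [hu.1]
      have : 0 < x - u := by linarith [hu.2]
      exact abs_of_nonneg (by positivity)
    rw [this, le_div_iff₀' hα, (integral_weyl_kernel hα hy.2 hTx).2]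
    gcongr

/-- The truncated Weyl derivative, with the singular part integrated out. -/
lemma weylLeftTrunc_eq {α a x ε : ℝ} {f : ℝ → ℝ} (hα : 0 < α) (hε : 0 < ε) (hεx : ε ≤ x - a)
    (hf : IntegrableOn f (Ioo a (x - ε))) :
    IntegrableOn (fun u => f u / (x - u) ^ (α + 1)) (Ioo a (x - ε)) ∧
    weylLeftTrunc α a f x ε = 1 / Real.Gamma (1 - α) *
      (f x / ε ^ α - α * ∫ u in Ioo a (x - ε), f u / (x - u) ^ (α + 1)) := by
  have h1 := integral_one_div_sub_rpow hα (show a ≤ x - ε by linarith) (show x - ε < x by linarith)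
  rw [sub_sub_cancel] at h1
  have h2 : IntegrableOn (fun u => f u / (x - u) ^ (α + 1)) (Ioo a (x - ε)) := by
    refine (hf.norm.const_mul (1 / ε ^ (α + 1))).mono' ?_ ?_
    · refine (hf.aestronglyMeasurable.mul (f := f) (g := fun u => ((x - u) ^ (α + 1))⁻¹) ?_).congr
        (ae_of_all _ fun u => (div_eq_mul_inv _ _).symm)
      apply Measurable.aestronglyMeasurable
      fun_prop
    · filter_upwards [ae_restrict_mem measurableSet_Ioo] with u hu
      have h3 : ε < x - u := by linarith [hu.2]
      have h4 : 0 < x - u := hε.trans h3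
      rw [norm_div, Real.norm_of_nonneg (show 0 ≤ (x - u) ^ (α + 1) by positivity),
        div_eq_mul_one_div, mul_comm]
      gcongr
  refine ⟨h2, ?_⟩
  rw [weylLeftTrunc, intervalIntegral.integral_of_le (by linarith), integral_Ioc_eq_integral_Ioo]
  have h3 : ∫ u in Ioo a (x - ε), (f x - f u) / (x - u) ^ (α + 1) =
      f x * (∫ u in Ioo a (x - ε), 1 / (x - u) ^ (α + 1)) -
        ∫ u in Ioo a (x - ε), f u / (x - u) ^ (α + 1) := by
    rw [← integral_const_mul, ← integral_sub (h1.1.const_mul _) h2]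
    congr 1
    ext u
    ring
  -- The factor of `f x` is `1/(x-a)^α + (1/ε^α - 1/(x-a)^α)`: the boundary term cancels.
  rw [h3, mul_sub, mul_left_comm, h1.2]
  ring

/-! ### Approximate identities with an integrable decreasing majorant -/

/-- Since `m` decreases, `ε⁻¹ m(t/ε)` is at most the integral of `ε⁻¹ (2/v) m(v)` over `t/(2ε) < v <
t/ε`. Interchanging the integrations leaves `ψ` to be integrated over `t < 2εv`, which produces its
averages over `(0, 2εv)`; no integration by parts against `dm` is needed. -/
lemma lintegral_scaled_mul_le {m ψ : ℝ → ℝ} (hm : AntitoneOn m (Ioi 0)) (hm0 : ∀ t > 0, 0 ≤ m t)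
    (hmi : IntegrableOn m (Ioi 0)) (hψ0 : ∀ t, 0 ≤ ψ t)
    (hψi : ∀ r > 0, IntegrableOn ψ (Ioo 0 r))
    (hψm : AEMeasurable ψ (volume.restrict (Ioi 0))) {ε : ℝ} (hε : 0 < ε) :
    ∫⁻ t in Ioi 0, ENNReal.ofReal (ε⁻¹ * m (t / ε) * ψ t) ≤
      ∫⁻ v in Ioi 0,
        ENNReal.ofReal (4 * m v * ((∫ t in Ioo 0 (2 * ε * v), ψ t) / (2 * ε * v))) := by
  set μ := volume.restrict (Ioi (0 : ℝ)) with hμ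
  let D : Set (ℝ × ℝ) := {p | p.1 < 2 * ε * p.2}
  have hD : MeasurableSet D := measurableSet_lt measurable_fst (by fun_prop)
  let F : ℝ × ℝ → ENNReal := D.indicator
    (fun p => ENNReal.ofReal (ε⁻¹ * (2 / p.2 * m p.2)) * ENNReal.ofReal (ψ p.1))
  have hFm : AEMeasurable F (μ.prod μ) := by
    have h1 : AEMeasurable (fun v => ENNReal.ofReal (ε⁻¹ * (2 / v * m v))) μ := by
      refine (AEMeasurable.const_mul (AEMeasurable.mul ?_ hmi.aemeasurable) _).ennreal_ofReal
      exact (measurable_const.div measurable_id).aemeasurable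
    have h2 : AEMeasurable (fun t => ENNReal.ofReal (ψ t)) μ := hψm.ennreal_ofReal
    exact (AEMeasurable.mul h1.comp_snd h2.comp_fst).indicator hD
  have hmem : ∀ᵐ t ∂μ, t ∈ Ioi (0 : ℝ) := ae_restrict_mem measurableSet_Ioi
  calc ∫⁻ t, ENNReal.ofReal (ε⁻¹ * m (t / ε) * ψ t) ∂μ
      ≤ ∫⁻ t, ∫⁻ v, F (t, v) ∂μ ∂μ := by
        refine lintegral_mono_ae ?_
        filter_upwards [hmem] with t (ht : 0 < t)
        have h1 : ∀ v, F (t, v) = (Ioi (t / (2 * ε))).indicator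
            (fun v => ENNReal.ofReal (ε⁻¹ * (2 / v * m v)) * ENNReal.ofReal (ψ t)) v := by
          intro v
          have : t < 2 * ε * v ↔ t / (2 * ε) < v := by rw [div_lt_iff₀' (by positivity)]
          simp only [F, D, indicator, mem_ofPred_eq, mem_Ioi, this]
        simp only [h1]
        rw [lintegral_indicator measurableSet_Ioi, hμ,
          Measure.restrict_restrict measurableSet_Ioi, mul_assoc,
          ENNReal.ofReal_mul (by positivity), ENNReal.ofReal_mul (hm0 _ (by positivity)),
          ← mul_assoc, ← ENNReal.ofReal_mul (by positivity), lintegral_mul_const' _ _ (by simp)]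
        gcongr
        have hlt : t / (2 * ε) < t / ε := by
          apply div_lt_div_of_pos_left ht hε; linarith
        -- The interval has length `t/(2ε)`, hence the constant `2/t`; on it `εv ≤ t` gives `2/t ≤
        -- ε⁻¹ (2/v)`.
        calc ENNReal.ofReal (ε⁻¹ * m (t / ε))
            = ∫⁻ _ in Ioo (t / (2 * ε)) (t / ε), ENNReal.ofReal (2 / t * m (t / ε)) := by
              rw [setLIntegral_const, Real.volume_Ioo, ← ENNReal.ofReal_mul' (by linarith)]
              congr 1
              field_simp
              ring
          _ ≤ ∫⁻ v in Ioo (t / (2 * ε)) (t / ε), ENNReal.ofReal (ε⁻¹ * (2 / v * m v)) := by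
              refine setLIntegral_mono' measurableSet_Ioo fun v hv => ?_
              have hv0 : 0 < v := lt_trans (by positivity) hv.1
              have hmv : m (t / ε) ≤ m v := hm hv0 (show 0 < t / ε by positivity) hv.2.le
              have := hm0 (t / ε) (by positivity)
              refine ENNReal.ofReal_le_ofReal ?_
              rw [← mul_assoc]
              refine mul_le_mul ?_ hmv this (by positivity)
              rw [inv_mul_eq_div, div_div]
              gcongr
              exact ((lt_div_iff₀ hε).1 hv.2).le
          _ ≤ _ := by
              refine lintegral_mono_set fun v hv => ⟨hv.1, ?_⟩
              exact show 0 < v from lt_trans (by positivity) hv.1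
    _ = ∫⁻ v, ∫⁻ t, F (t, v) ∂μ ∂μ := lintegral_lintegral_swap hFm
    _ ≤ _ := by
        refine lintegral_mono_ae ?_
        filter_upwards [hmem] with v (hv : 0 < v)
        have h1 : ∀ t, F (t, v) = (Iio (2 * ε * v)).indicator
            (fun t => ENNReal.ofReal (ε⁻¹ * (2 / v * m v)) * ENNReal.ofReal (ψ t)) t := by
          intro t
          simp only [F, D, indicator, mem_ofPred_eq, mem_Iio]
        simp only [h1]
        rw [lintegral_indicator measurableSet_Iio, hμ,
          Measure.restrict_restrict measurableSet_Iio, lintegral_const_mul' _ _ (by simp),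
          inter_comm, Ioi_inter_Iio, ← ofReal_integral_eq_lintegral_ofReal
            (hψi _ (by positivity)) (ae_of_all _ hψ0),
          ← ENNReal.ofReal_mul (by have := hm0 v hv; positivity)]
        refine ENNReal.ofReal_le_ofReal (le_of_eq ?_)
        field_simp
        ring

/-- The integral of `ε⁻¹ m(t/ε) ψ(t)` tends to `0` as `ε ↓ 0`, if `m` is decreasing and integrable
and the averages of `ψ` over `(0,r)` are bounded and tend to `0` as `r ↓ 0`. -/
lemma tendsto_integral_scaled_mul {m ψ : ℝ → ℝ} (hm : AntitoneOn m (Ioi 0))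
    (hm0 : ∀ t > 0, 0 ≤ m t) (hmi : IntegrableOn m (Ioi 0)) (hψ0 : ∀ t, 0 ≤ ψ t)
    (hψi : ∀ r > 0, IntegrableOn ψ (Ioo 0 r))
    (hψm : AEMeasurable ψ (volume.restrict (Ioi 0))) {C : ℝ}
    (hC : ∀ r > 0, ∫ t in Ioo 0 r, ψ t ≤ C * r)
    (h0 : Tendsto (fun r => (∫ t in Ioo 0 r, ψ t) / r) (𝓝[>] 0) (𝓝 0)) :
    (∀ ε > 0, IntegrableOn (fun t => ε⁻¹ * m (t / ε) * ψ t) (Ioi 0)) ∧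
    Tendsto (fun ε => ∫ t in Ioi 0, ε⁻¹ * m (t / ε) * ψ t) (𝓝[>] 0) (𝓝 0) := by
  set μ := volume.restrict (Ioi (0 : ℝ)) with hμ
  set Ψ : ℝ → ℝ := fun r => ∫ t in Ioo 0 r, ψ t with hΨ
  have hmem : ∀ᵐ t ∂μ, t ∈ Ioi (0 : ℝ) := ae_restrict_mem measurableSet_Ioi
  -- Monotonicity supplies the measurability of `Ψ`.
  have hΨmono : Monotone Ψ := by
    intro r s hrs
    rcases le_or_gt s 0 with hs | hs
    · simp [hΨ, Ioo_eq_empty (not_lt.2 hs), Ioo_eq_empty (not_lt.2 (hrs.trans hs))]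
    · exact setIntegral_mono_set (hψi s hs) (ae_of_all _ hψ0)
        (Ioo_subset_Ioo_right hrs).eventuallyLE
  have hle := fun ε hε => lintegral_scaled_mul_le hm hm0 hmi hψ0 hψi hψm (ε := ε) hε
  have hbd : ∀ ε > 0, ∀ᵐ v ∂μ,
      ENNReal.ofReal (4 * m v * (Ψ (2 * ε * v) / (2 * ε * v))) ≤ ENNReal.ofReal (4 * C * m v) := by
    intro ε hε
    filter_upwards [hmem] with v (hv : 0 < v)
    refine ENNReal.ofReal_le_ofReal ?_
    have h1 : Ψ (2 * ε * v) / (2 * ε * v) ≤ C := by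
      rw [div_le_iff₀ (by positivity)]
      exact hC _ (by positivity)
    have := hm0 v hv
    calc 4 * m v * (Ψ (2 * ε * v) / (2 * ε * v)) ≤ 4 * m v * C := by gcongr
      _ = _ := by ring
  have hfin : ∫⁻ v, ENNReal.ofReal (4 * C * m v) ∂μ ≠ ⊤ :=
    (hmi.const_mul (4 * C)).lintegral_lt_top.ne
  have hlim : Tendsto (fun ε => ∫⁻ v, ENNReal.ofReal
      (4 * m v * (Ψ (2 * ε * v) / (2 * ε * v))) ∂μ) (𝓝[>] 0) (𝓝 0) := by
    have : (0 : ENNReal) = ∫⁻ _, 0 ∂μ := by simp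
    rw [this]
    -- Dominated convergence along sequences, with majorant `4 C m`; the shift by `N` makes all
    -- terms positive, as the bound `hbd` requires.
    refine tendsto_of_seq_tendsto fun e he => ?_
    obtain ⟨he0, hepos⟩ := tendsto_nhdsWithin_iff.1 he
    obtain ⟨N, hN⟩ := eventually_atTop.1 hepos
    rw [← tendsto_add_atTop_iff_nat N]
    have hp : ∀ n, 0 < e (n + N) := fun n => hN _ (Nat.le_add_left _ _)
    refine tendsto_lintegral_of_dominated_convergence' _ (fun n => ?_) (fun n => hbd _ (hp n))
      hfin ?_
    · refine AEMeasurable.ennreal_ofReal ?_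
      refine AEMeasurable.mul (hmi.aemeasurable.const_mul 4) ?_
      refine Measurable.aemeasurable (Measurable.div ?_ (by fun_prop))
      exact hΨmono.measurable.comp (by fun_prop)
    · filter_upwards [hmem] with v (hv : 0 < v)
      have h1 : Tendsto (fun ε : ℝ => 2 * ε * v) (𝓝[>] 0) (𝓝[>] 0) := by
        refine tendsto_nhdsWithin_iff.2 ⟨?_, ?_⟩
        · have : Continuous fun ε : ℝ => 2 * ε * v := by fun_prop
          simpa using (this.tendsto 0).mono_left nhdsWithin_le_nhds
        · filter_upwards [self_mem_nhdsWithin] with ε (hε : 0 < ε)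
          exact show 0 < 2 * ε * v by positivity
      have h2 := ENNReal.tendsto_ofReal ((h0.comp h1).const_mul (4 * m v))
      rw [mul_zero, ENNReal.ofReal_zero] at h2
      exact (h2.comp he).comp (tendsto_add_atTop_nat N)
  have hmeas : ∀ ε > 0, AEStronglyMeasurable (fun t => ε⁻¹ * m (t / ε) * ψ t) μ := by
    intro ε hε
    refine AEStronglyMeasurable.mul (AEStronglyMeasurable.const_mul ?_ _)
      hψm.aestronglyMeasurable
    have h1 : AEMeasurable (fun t => m (t / ε)) μ := by
      refine aemeasurable_restrict_of_antitoneOn measurableSet_Ioi fun s hs t ht hst => ?_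
      have hs' : 0 < s := hs
      have ht' : 0 < t := ht
      exact hm (show 0 < s / ε by positivity) (show 0 < t / ε by positivity) (by gcongr)
    exact h1.aestronglyMeasurable
  have hnn : ∀ ε > 0, ∀ᵐ t ∂μ, 0 ≤ ε⁻¹ * m (t / ε) * ψ t := by
    intro ε hε
    filter_upwards [hmem] with t (ht : 0 < t)
    have := hm0 (t / ε) (by positivity)
    have := hψ0 t
    positivity
  refine ⟨fun ε hε => ⟨hmeas ε hε, ?_⟩, ?_⟩
  · rw [hasFiniteIntegral_iff_ofReal (hnn ε hε)]
    exact ((hle ε hε).trans (lintegral_mono_ae (hbd ε hε))).trans_lt hfin.lt_top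
  · have h1 : Tendsto (fun ε => ∫⁻ t, ENNReal.ofReal (ε⁻¹ * m (t / ε) * ψ t) ∂μ)
        (𝓝[>] 0) (𝓝 0) := by
      refine tendsto_of_tendsto_of_tendsto_of_le_of_le' tendsto_const_nhds hlim ?_ ?_
      · exact Eventually.of_forall fun _ => zero_le
      · filter_upwards [self_mem_nhdsWithin] with ε hε using hle ε hε
    have h2 := (ENNReal.tendsto_toReal ENNReal.zero_ne_top).comp h1
    simp only [ENNReal.toReal_zero] at h2
    refine h2.congr' ?_
    filter_upwards [self_mem_nhdsWithin] with ε hε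
    rw [integral_eq_lintegral_of_nonneg_ae (hnn ε hε) (hmeas ε hε)]
    rfl

/-! ### The kernel of the truncated Weyl derivative of a fractional integral -/

/-- The kernel `K` with `(truncated D^α I^α φ)(x) = c ∫ ε⁻¹ K(t/ε) φ(x - t) dt`. -/
noncomputable def weylKernel (α t : ℝ) : ℝ := (t ^ α - (max (t - 1) 0) ^ α) / t

/-- A decreasing integrable majorant of `weylKernel`. -/
noncomputable def weylMajorant (α t : ℝ) : ℝ := t ^ (α - 1) * min 1 (1 / t)

lemma weylMajorant_nonneg {α t : ℝ} (ht : 0 < t) : 0 ≤ weylMajorant α t := by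
  unfold weylMajorant; positivity

lemma weylMajorant_antitoneOn {α : ℝ} (hα : α < 1) : AntitoneOn (weylMajorant α) (Ioi 0) := by
  intro s hs t ht hst
  have hs' : 0 < s := hs
  have ht' : 0 < t := ht
  unfold weylMajorant
  refine mul_le_mul ?_ ?_ (by positivity) (by positivity)
  · exact Real.rpow_le_rpow_of_nonpos hs' hst (by linarith)
  · gcongr

lemma weylMajorant_integrableOn {α : ℝ} (h0 : 0 < α) (h1 : α < 1) :
    IntegrableOn (weylMajorant α) (Ioi 0) := by
  rw [← Ioc_union_Ioi_eq_Ioi zero_le_one]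
  refine IntegrableOn.union ?_ ?_
  · have := (intervalIntegral.intervalIntegrable_rpow' (a := 0) (b := 1)
      (show -1 < α - 1 by linarith))
    rw [intervalIntegrable_iff_integrableOn_Ioc_of_le zero_le_one] at this
    refine this.congr_fun (fun t ht => ?_) measurableSet_Ioc
    have ht0 : 0 < t := ht.1
    rw [weylMajorant, min_eq_left, mul_one]
    rw [le_div_iff₀ ht0]; linarith [ht.2]
  · refine (integrableOn_Ioi_rpow_of_lt (show α - 2 < -1 by linarith) zero_lt_one).congr_fun
      (fun t ht => ?_) measurableSet_Ioi
    have ht1 : 1 < t := ht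
    have ht0 : 0 < t := by linarith
    have h2 : 1 / t ≤ 1 := by rw [div_le_iff₀ ht0]; linarith
    simp only [weylMajorant]
    rw [min_eq_right h2, show α - 2 = (α - 1) - 1 by ring, Real.rpow_sub_one ht0.ne' (α - 1),
      div_eq_mul_one_div]

lemma weylKernel_nonneg {α t : ℝ} (h0 : 0 < α) (ht : 0 < t) : 0 ≤ weylKernel α t := by
  unfold weylKernel
  refine div_nonneg (sub_nonneg.2 ?_) ht.le
  refine Real.rpow_le_rpow (le_max_right _ _) (max_le (by linarith) ht.le) h0.le

/-- For `t ≤ 1` there is equality. For `t > 1`, `(1 - 1/t)^α ≥ 1 - 1/t` because `α < 1`, whence `t^α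
- (t-1)^α ≤ t^α / t`. -/
lemma weylKernel_le {α t : ℝ} (h0 : 0 < α) (h1 : α < 1) (ht : 0 < t) :
    weylKernel α t ≤ weylMajorant α t := by
  unfold weylKernel weylMajorant
  rw [Real.rpow_sub_one ht.ne', div_mul_eq_mul_div]
  gcongr
  rcases le_or_gt t 1 with h | h
  · rw [max_eq_right (by linarith), Real.zero_rpow h0.ne', min_eq_left, sub_zero, mul_one]
    rw [le_div_iff₀ ht]; linarith
  · rw [max_eq_left (by linarith), min_eq_right]
    · have h2 : 1 - 1 / t ≤ (1 - 1 / t) ^ α := by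
        have : 0 ≤ 1 - 1 / t := by
          rw [sub_nonneg, div_le_iff₀ ht]; linarith
        refine Real.self_le_rpow_of_le_one this ?_ h1.le
        have : 0 < 1 / t := by positivity
        linarith
      have h3 : (t - 1) ^ α = t ^ α * (1 - 1 / t) ^ α := by
        rw [← Real.mul_rpow ht.le]
        · congr 1; field_simp
        · rw [sub_nonneg, div_le_iff₀ ht]; linarith
      have : 0 < t ^ α := by positivity
      rw [h3]
      nlinarith
    · rw [div_le_iff₀ ht]; linarith

lemma measurable_weylKernel (α : ℝ) : Measurable (weylKernel α) := by
  unfold weylKernel; fun_prop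

lemma weylKernel_integrableOn {α : ℝ} (h0 : 0 < α) (h1 : α < 1) :
    IntegrableOn (weylKernel α) (Ioi 0) := by
  refine (weylMajorant_integrableOn h0 h1).mono' (measurable_weylKernel α).aestronglyMeasurable ?_
  filter_upwards [ae_restrict_mem measurableSet_Ioi] with t ht
  rw [Real.norm_of_nonneg (weylKernel_nonneg h0 ht)]
  exact weylKernel_le h0 h1 ht

/-- This constant normalises the approximate identity. The part over `(0,1)` is `1/α`. Beyond `1`
the substitution `u = 1 - 1/t` suggests an antiderivative consisting of an elementary term and an
incomplete beta integral. It has the value `1/α` at `1` and tends to the full beta integral `B(α,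
1-α)`. -/
lemma integral_weylKernel {α : ℝ} (h0 : 0 < α) (h1 : α < 1) :
    ∫ t in Ioi 0, weylKernel α t = Real.Gamma α * Real.Gamma (1 - α) := by
  set q : ℝ → ℝ := fun u => (1 - u) ^ ((1 - α) - 1) * (u - 0) ^ (α - 1) with hq
  obtain ⟨hqi, hqv⟩ := integral_beta_kernel (α := 1 - α) (γ := α) (by linarith) h0
    (zero_lt_one : (0 : ℝ) < 1)
  have hqI : IntervalIntegrable q volume 0 1 := by
    rw [intervalIntegrable_iff_integrableOn_Ioo_of_le zero_le_one]
    exact hqi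
  have hint := weylKernel_integrableOn h0 h1
  have hsplit : ∫ t in Ioi 0, weylKernel α t =
      (∫ t in Ioo 0 1, weylKernel α t) + ∫ t in Ioi 1, weylKernel α t := by
    rw [← Ioc_union_Ioi_eq_Ioi (zero_le_one' ℝ), setIntegral_union
      (Ioc_disjoint_Ioi le_rfl) measurableSet_Ioi
      (hint.mono_set Ioc_subset_Ioi_self) (hint.mono_set (Ioi_subset_Ioi zero_le_one)),
      integral_Ioc_eq_integral_Ioo]
  have hfirst : ∫ t in Ioo 0 1, weylKernel α t = 1 / α := by
    have h := (integral_sub_rpow_right (p := α) (y := 0) (b := 1) h0 zero_le_one).2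
    rw [sub_zero, Real.one_rpow] at h
    rw [← h]
    refine setIntegral_congr_fun measurableSet_Ioo fun t ht => ?_
    simp only [weylKernel, sub_zero]
    rw [max_eq_right (by linarith [ht.2]), Real.zero_rpow h0.ne', sub_zero,
      Real.rpow_sub_one ht.1.ne']
  set P : ℝ → ℝ := fun z => ∫ u in (0 : ℝ)..z, q u with hP
  have hPc : ContinuousOn P (Icc 0 1) := by
    have := intervalIntegral.continuousOn_primitive_interval (f := q) (μ := volume)
      (a := 0) (b := 1) (by rw [← intervalIntegrable_iff'] ; exact hqI)
    rwa [uIcc_of_le zero_le_one] at this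
  have hPd : ∀ z ∈ Ioo (0 : ℝ) 1, HasDerivAt P (q z) z := by
    intro z hz
    have hc : ContinuousOn q (Ioo 0 1) := by
      refine ContinuousOn.mul (ContinuousOn.rpow_const (by fun_prop) ?_)
        (ContinuousOn.rpow_const (by fun_prop) ?_)
      · intro u hu; left; linarith [hu.2]
      · intro u hu; left; linarith [hu.1]
    refine intervalIntegral.integral_hasDerivAt_right ?_ ?_ (hc.continuousAt (Ioo_mem_nhds hz.1 hz.2))
    · refine hqI.mono_set ?_
      rw [uIcc_of_le hz.1.le, uIcc_of_le zero_le_one]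
      exact Icc_subset_Icc_right hz.2.le
    · exact hc.stronglyMeasurableAtFilter isOpen_Ioo z hz
  -- By the chain rule the `P` term contributes `(R-1)^(α-1)/R`, which turns `-(R-1)^(α-1)` into
  -- `-(R-1)^α/R`.
  set F : ℝ → ℝ := fun R => (R ^ α - (R - 1) ^ α) / α + P (1 - 1 / R) with hF
  have hinv1 : ∀ R : ℝ, 1 ≤ R → 1 - 1 / R ∈ Icc (0 : ℝ) 1 := by
    intro R hR
    have hR0 : 0 < R := by linarith
    refine ⟨?_, ?_⟩
    · rw [sub_nonneg, div_le_iff₀ hR0]; linarith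
    · have : 0 < 1 / R := by positivity
      linarith
  have hsecond : ∫ t in Ioi 1, weylKernel α t =
      Real.Gamma α * Real.Gamma (1 - α) - 1 / α := by
    have hF1 : F 1 = 1 / α := by
      simp [hF, hP, Real.zero_rpow h0.ne']
    rw [← hF1]
    refine integral_Ioi_of_hasDerivAt_of_tendsto ?_ ?_
      (hint.mono_set (Ioi_subset_Ioi zero_le_one)) ?_
    · refine ContinuousWithinAt.add (ContinuousWithinAt.div_const (ContinuousWithinAt.sub ?_ ?_) _) ?_
      · exact (Real.continuous_rpow_const h0.le).continuousWithinAt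
      · exact ((Real.continuous_rpow_const h0.le).comp
          (continuous_id.sub continuous_const)).continuousWithinAt
      · refine ContinuousWithinAt.comp (f := fun R : ℝ => 1 - 1 / R) (g := P) (t := Icc 0 1)
          (hPc _ (hinv1 1 le_rfl)) ?_ (fun R hR => hinv1 R hR)
        refine ContinuousWithinAt.sub continuousWithinAt_const ?_
        exact ContinuousWithinAt.div continuousWithinAt_const continuousWithinAt_id one_ne_zero
    · intro R hR
      have hR1 : 1 < R := hR
      have hR0 : 0 < R := by linarith
      have hz : 1 - 1 / R ∈ Ioo (0 : ℝ) 1 := by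
        refine ⟨?_, ?_⟩
        · rw [sub_pos, div_lt_iff₀ hR0]; linarith
        · have : 0 < 1 / R := by positivity
          linarith
      have d1 : HasDerivAt (fun R : ℝ => R ^ α) (α * R ^ (α - 1)) R :=
        Real.hasDerivAt_rpow_const (Or.inl hR0.ne')
      have d2 : HasDerivAt (fun R : ℝ => (R - 1) ^ α) (α * (R - 1) ^ (α - 1)) R := by
        have := ((hasDerivAt_id R).sub_const 1).rpow_const (p := α)
          (Or.inl (show id R - 1 ≠ 0 by simp only [id]; linarith))
        simpa using this
      have d3 : HasDerivAt (fun R : ℝ => 1 - 1 / R) (1 / R ^ 2) R := by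
        have := (hasDerivAt_inv hR0.ne').const_sub 1
        simpa [one_div] using this
      have d4 := ((d1.sub d2).div_const α).add ((hPd _ hz).comp R d3)
      refine d4.congr_deriv ?_
      simp only [hq, weylKernel, sub_zero]
      rw [max_eq_left (by linarith), sub_sub_cancel, show 1 - 1 / R = (R - 1) / R by field_simp,
        show 1 - α - 1 = -α by ring, Real.rpow_neg (by positivity), Real.div_rpow zero_le_one hR0.le,
        Real.one_rpow, Real.div_rpow (by linarith) hR0.le, Real.rpow_sub_one hR0.ne',
        Real.rpow_sub_one (by linarith)]
      have h3 : R - 1 ≠ 0 := by linarith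
      have h4 : R ^ α ≠ 0 := by positivity
      field_simp
      ring
    · have t1 : Tendsto (fun R : ℝ => (R ^ α - (R - 1) ^ α) / α) atTop (𝓝 0) := by
        have b1 : Tendsto (fun R : ℝ => R ^ (α - 1) / α) atTop (𝓝 0) := by
          have := (tendsto_rpow_neg_atTop (show 0 < 1 - α by linarith)).div_const α
          simpa using this
        refine squeeze_zero' ?_ ?_ b1
        · filter_upwards [eventually_gt_atTop 1] with R hR
          refine div_nonneg (sub_nonneg.2 ?_) h0.le
          exact Real.rpow_le_rpow (by linarith) (by linarith) h0.le
        · filter_upwards [eventually_gt_atTop 1] with R hR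
          have hR0 : 0 < R := by linarith
          gcongr
          have h2 := weylKernel_le h0 h1 hR0
          rw [weylKernel, weylMajorant, max_eq_left (by linarith), div_le_iff₀ hR0] at h2
          refine h2.trans ?_
          rw [mul_assoc]
          refine mul_le_of_le_one_right (by positivity) ?_
          calc min 1 (1 / R) * R ≤ 1 / R * R := by gcongr; exact min_le_right _ _
            _ = 1 := by field_simp
      have t2 : Tendsto (fun R : ℝ => P (1 - 1 / R)) atTop (𝓝 (P 1)) := by
        have h2 : Tendsto (fun R : ℝ => 1 - 1 / R) atTop (𝓝[Icc 0 1] 1) := by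
          refine tendsto_nhdsWithin_iff.2 ⟨?_, ?_⟩
          · have := (tendsto_inv_atTop_zero (𝕜 := ℝ)).const_sub 1
            simpa [one_div] using this
          · filter_upwards [eventually_ge_atTop 1] with R hR using hinv1 R hR
        exact Tendsto.comp (hPc 1 ⟨zero_le_one, le_rfl⟩) h2
      have hP1 : P 1 = Real.Gamma α * Real.Gamma (1 - α) := by
        simp only [hP]
        rw [intervalIntegral.integral_of_le zero_le_one, integral_Ioc_eq_integral_Ioo, hqv]
        simp [mul_comm]
      have := t1.add t2
      rwa [zero_add, hP1] at this
  rw [hsplit, hfirst, hsecond]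
  ring

/-! ### The Weyl derivative inverts the fractional integral -/

/-- With `T = x - ε`, the term `f x / ε^α` contributes `(x-y)^(α-1)/ε^α` for `y < x`, and the
singular integral contributes `((T-y)/ε)^α/(x-y)` for `y < T` only. Their difference is `ε⁻¹
K((x-y)/ε)`; the positive part in `K` encodes the restriction `y < T`. -/
lemma weylLeftTrunc_rlIntegralLeft {α a s x ε : ℝ} {φ f : ℝ → ℝ} (h0 : 0 < α) (hx : x ∈ Ioo a s)
    (hε : 0 < ε) (hεx : ε < x - a)
    (hf : f =ᵐ[volume.restrict (Ioo a s)] rlIntegralLeft α a φ)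
    (hfx : f x = rlIntegralLeft α a φ x) (hφ : IntegrableOn φ (Ioo a s))
    (hI : IntegrableOn (fun y => (x - y) ^ (α - 1) * φ y) (Ioo a x)) :
    weylLeftTrunc α a f x ε = 1 / (Real.Gamma α * Real.Gamma (1 - α)) *
      ∫ y in Ioo a x, ε⁻¹ * weylKernel α ((x - y) / ε) * φ y := by
  set T := x - ε with hT
  have hTs : Ioo a T ⊆ Ioo a s := Ioo_subset_Ioo_right (by linarith [hx.2])
  have hTx : Ioo a T ⊆ Ioo a x := Ioo_subset_Ioo_right (by linarith)
  have hfT := ae_restrict_of_ae_restrict_of_subset hTs hf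
  have hfi : IntegrableOn f (Ioo a T) :=
    ((rlIntegralLeft_integrable h0 hφ).2.mono_set hTs).congr
      (hfT.mono fun _ h => h.symm)
  obtain ⟨k1, k2⟩ := integral_rlIntegralLeft_div (x := x) h0 (show a ≤ T by linarith)
    (show T < x by linarith) (hφ.mono_set hTs)
  have e1 : ∫ u in Ioo a T, f u / (x - u) ^ (α + 1) =
      ∫ u in Ioo a T, rlIntegralLeft α a φ u / (x - u) ^ (α + 1) := by
    refine integral_congr_ae ?_
    filter_upwards [hfT] with u hu
    rw [hu]
  rw [(weylLeftTrunc_eq h0 hε hεx.le hfi).2, e1, k2, hfx, rlIntegralLeft_eq _ _ hx.1.le,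
    show x - T = ε by rw [hT]; ring]
  rw [show x - T = ε by rw [hT]; ring] at k1
  have hsub : ∫ y in Ioo a x, ε⁻¹ * weylKernel α ((x - y) / ε) * φ y =
      (∫ y in Ioo a x, 1 / ε ^ α * ((x - y) ^ (α - 1) * φ y)) -
        ∫ y in Ioo a T, ((T - y) / ε) ^ α / (x - y) * φ y := by
    have e2 : ∫ y in Ioo a T, ((T - y) / ε) ^ α / (x - y) * φ y =
        ∫ y in Ioo a x, (Ioo a T).indicator (fun y => ((T - y) / ε) ^ α / (x - y) * φ y) y := by
      rw [integral_indicator measurableSet_Ioo, Measure.restrict_restrict measurableSet_Ioo,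
        inter_eq_left.2 hTx]
    rw [e2, ← integral_sub (hI.const_mul _)]
    · refine setIntegral_congr_fun measurableSet_Ioo fun y hy => ?_
      have hxy : 0 < x - y := by linarith [hy.2]
      have hK : ε⁻¹ * weylKernel α ((x - y) / ε) =
          ((x - y) ^ α / ε ^ α - (max ((x - y) / ε - 1) 0) ^ α) / (x - y) := by
        rw [weylKernel, Real.div_rpow hxy.le hε.le]
        field_simp
      rw [hK, Real.rpow_sub_one hxy.ne']
      by_cases hyT : y < T
      · rw [indicator_of_mem (show y ∈ Ioo a T from ⟨hy.1, hyT⟩), max_eq_left,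
          show (T - y) / ε = (x - y) / ε - 1 by rw [hT]; field_simp; ring]
        · field_simp
        · rw [sub_nonneg, le_div_iff₀ hε]; linarith
      · rw [indicator_of_notMem (fun h => hyT h.2), max_eq_right, Real.zero_rpow h0.ne']
        · field_simp
          ring
        · rw [sub_nonpos, div_le_iff₀ hε]; linarith
    · rw [integrable_indicator_iff measurableSet_Ioo, IntegrableOn,
        Measure.restrict_restrict measurableSet_Ioo, inter_eq_left.2 hTx]
      exact k1
  rw [hsub, integral_const_mul]
  field_simp

lemma integral_Ioo_comp_sub_left (h : ℝ → ℝ) (x : ℝ) {r : ℝ} (hr : 0 ≤ r) :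
    ∫ t in Ioo 0 r, h (x - t) = ∫ y in Ioo (x - r) x, h y := by
  rw [← integral_Ioc_eq_integral_Ioo, ← integral_Ioc_eq_integral_Ioo,
    ← intervalIntegral.integral_of_le hr, ← intervalIntegral.integral_of_le (by linarith),
    intervalIntegral.integral_comp_sub_left, sub_zero]

/-- The truncated Weyl derivatives of `I^α φ` converge to `φ` almost everywhere. -/
lemma ae_tendsto_weylLeftTrunc {α a s : ℝ} {φ f : ℝ → ℝ} (h0 : 0 < α) (h1 : α < 1)
    (hφ : IntegrableOn φ (Ioo a s))
    (hf : f =ᵐ[volume.restrict (Ioo a s)] rlIntegralLeft α a φ) :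
    ∀ᵐ x ∂(volume.restrict (Ioo a s)),
      Tendsto (weylLeftTrunc α a f x) (𝓝[>] 0) (𝓝 (φ x)) := by
  -- Extension by zero lets the convolution run over all `t > 0`.
  set χ : ℝ → ℝ := (Ioo a s).indicator φ with hχ
  have hχi : Integrable χ := (integrable_indicator_iff measurableSet_Ioo).2 hφ
  have hLDT := ae_restrict_of_ae (s := Ioo a s)
    ((IsUnifLocDoublingMeasure.vitaliFamily volume 1).ae_tendsto_average_norm_sub
      hχi.locallyIntegrable)
  filter_upwards [hLDT, hf, (rlIntegralLeft_integrable h0 hφ).1, ae_restrict_mem measurableSet_Ioo]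
    with x hL hfx hI hx
  have hχx : χ x = φ x := indicator_of_mem hx _
  set ψ : ℝ → ℝ := fun t => |χ (x - t) - χ x| with hψ
  have hψ0 : ∀ t, 0 ≤ ψ t := fun t => abs_nonneg _
  have hχs : Integrable (fun t => χ (x - t)) := hχi.comp_sub_left x
  have hψi : ∀ r > 0, IntegrableOn ψ (Ioo 0 r) := fun r _ =>
    (hχs.integrableOn.sub (integrableOn_const (by simp))).abs
  have hψm : AEMeasurable ψ (volume.restrict (Ioi 0)) := by
    have : AEMeasurable ψ volume :=
      (hχs.aestronglyMeasurable.sub aestronglyMeasurable_const).norm.aemeasurable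
    exact this.restrict
  -- Lebesgue's differentiation theorem for the one-sided intervals `[x - r, x]`, which belong to
  -- the Vitali family.
  have havg : Tendsto (fun r => (∫ t in Ioo 0 r, ψ t) / r) (𝓝[>] 0) (𝓝 0) := by
    have hr : Tendsto (fun r : ℝ => x - r) (𝓝[>] 0) (𝓝[<] x) := by
      refine tendsto_nhdsWithin_iff.2 ⟨?_, ?_⟩
      · have : Continuous fun r : ℝ => x - r := by fun_prop
        simpa using (this.tendsto 0).mono_left nhdsWithin_le_nhds
      · filter_upwards [self_mem_nhdsWithin] with r (hr : 0 < r)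
        exact show x - r < x by linarith
    have h2 := (hL.comp x.tendsto_Icc_vitaliFamily_left).comp hr
    refine h2.congr' ?_
    filter_upwards [self_mem_nhdsWithin] with r (hr : 0 < r)
    simp only [Function.comp_apply, hψ]
    rw [integral_Ioo_comp_sub_left (fun y => |χ y - χ x|) x hr.le, setAverage_eq,
      integral_Icc_eq_integral_Ioc, integral_Ioc_eq_integral_Ioo, Measure.real, Real.volume_Icc,
      sub_sub_cancel, ENNReal.toReal_ofReal hr.le, smul_eq_mul, inv_mul_eq_div]
    rfl
  -- For small `r` the average is below `1`; for `r ≥ δ` the total mass `N` of `χ` is at most `(N/δ)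
  -- r`, and the constant `χ x` adds `|χ x| r`.
  obtain ⟨C, hC⟩ : ∃ C, ∀ r > 0, ∫ t in Ioo 0 r, ψ t ≤ C * r := by
    obtain ⟨δ, hδ, hδ'⟩ : ∃ δ > 0, ∀ r ∈ Ioo 0 δ, (∫ t in Ioo 0 r, ψ t) / r < 1 := by
      have := havg.eventually (gt_mem_nhds zero_lt_one)
      rw [Filter.Eventually, mem_nhdsGT_iff_exists_Ioo_subset] at this
      obtain ⟨δ, hδ, h⟩ := this
      exact ⟨δ, hδ, fun r hr => h hr⟩
    set N := ∫ t, |χ (x - t)| with hN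
    have hN0 : 0 ≤ N := integral_nonneg fun _ => abs_nonneg _
    refine ⟨1 + N / δ + |χ x|, fun r hr => ?_⟩
    have hrx : 0 ≤ |χ x| * r := by positivity
    have hNr : 0 ≤ N / δ * r := by positivity
    rcases lt_or_ge r δ with h | h
    · have := hδ' r ⟨hr, h⟩
      rw [div_lt_iff₀ hr] at this
      linarith
    · have i1 : ∫ t in Ioo 0 r, ψ t ≤ ∫ t in Ioo 0 r, (|χ (x - t)| + |χ x|) := by
        refine setIntegral_mono (hψi r hr) ?_ fun t => abs_sub _ _
        exact hχs.abs.integrableOn.add (integrableOn_const (by simp))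
      have i2 : ∫ t in Ioo 0 r, (|χ (x - t)| + |χ x|) =
          (∫ t in Ioo 0 r, |χ (x - t)|) + r * |χ x| := by
        rw [integral_add hχs.abs.integrableOn (integrableOn_const (by simp))]
        simp [hr.le]
      have i3 : ∫ t in Ioo 0 r, |χ (x - t)| ≤ N :=
        setIntegral_le_integral hχs.abs (ae_of_all _ fun _ => abs_nonneg _)
      have i4 : N ≤ N / δ * r := by
        rw [div_mul_eq_mul_div, le_div_iff₀ hδ]
        gcongr
      linarith
  obtain ⟨hmi, hmt⟩ := tendsto_integral_scaled_mul (weylMajorant_antitoneOn h1)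
    (fun t ht => weylMajorant_nonneg ht) (weylMajorant_integrableOn h0 h1) hψ0 hψi hψm hC havg
  set c := 1 / (Real.Gamma α * Real.Gamma (1 - α)) with hc
  have hG1 := Real.Gamma_pos_of_pos h0
  have hG2 := Real.Gamma_pos_of_pos (show 0 < 1 - α by linarith)
  have hc0 : 0 < c := by positivity
  -- The factor `c` gives the kernel mass one, so `φ x` can be taken under the integral and the
  -- kernel replaced by its majorant.
  have hkey : ∀ ε, 0 < ε → ε < x - a → ‖weylLeftTrunc α a f x ε - φ x‖ ≤
      c * ∫ t in Ioi 0, ε⁻¹ * weylMajorant α (t / ε) * ψ t := by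
    intro ε hε hεx
    have hK0 : ∀ t > 0, 0 ≤ ε⁻¹ * weylKernel α (t / ε) := fun t ht => by
      have := weylKernel_nonneg h0 (div_pos ht hε)
      positivity
    have hKm : Measurable (fun t => ε⁻¹ * weylKernel α (t / ε)) :=
      ((measurable_weylKernel α).comp (measurable_id.div_const ε)).const_mul _
    have e1 : ∫ y in Ioo a x, ε⁻¹ * weylKernel α ((x - y) / ε) * φ y =
        ∫ t in Ioi 0, ε⁻¹ * weylKernel α (t / ε) * χ (x - t) := by
      rw [← integral_indicator measurableSet_Ioo, ← integral_indicator measurableSet_Ioi,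
        ← integral_sub_left_eq_self _ volume x]
      congr 1
      ext t
      by_cases ht : 0 < t
      · rw [indicator_of_mem (show t ∈ Ioi 0 from ht)]
        by_cases hta : a < x - t
        · rw [indicator_of_mem (show x - t ∈ Ioo a x from ⟨hta, by linarith⟩), hχ,
            indicator_of_mem (show x - t ∈ Ioo a s from ⟨hta, by linarith [hx.2]⟩), sub_sub_cancel]
        · rw [indicator_of_notMem fun h => hta h.1, hχ, indicator_of_notMem fun h => hta h.1,
            mul_zero]
      · rw [indicator_of_notMem (show t ∉ Ioi 0 from ht), indicator_of_notMem]
        intro h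
        linarith [h.2]
    have i1 : IntegrableOn (fun t => ε⁻¹ * weylKernel α (t / ε) * (χ (x - t) - χ x)) (Ioi 0) := by
      refine (hmi ε hε).mono' ?_ ?_
      · exact hKm.aestronglyMeasurable.mul
          (hχs.aestronglyMeasurable.sub aestronglyMeasurable_const).restrict
      · filter_upwards [ae_restrict_mem measurableSet_Ioi] with t (ht : 0 < t)
        rw [norm_mul, Real.norm_of_nonneg (hK0 t ht), Real.norm_eq_abs]
        gcongr
        exact weylKernel_le h0 h1 (div_pos ht hε)
    have i2 : IntegrableOn (fun t => ε⁻¹ * weylKernel α (t / ε)) (Ioi 0) := by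
      refine Integrable.const_mul ?_ _
      have := (integrableOn_Ioi_comp_mul_right_iff (weylKernel α) 0 (inv_pos.2 hε)).2
        (by rw [zero_mul]; exact weylKernel_integrableOn h0 h1)
      exact this
    have e2 : ∫ t in Ioi 0, ε⁻¹ * weylKernel α (t / ε) =
        Real.Gamma α * Real.Gamma (1 - α) := by
      rw [integral_const_mul, ← integral_weylKernel h0 h1]
      have := integral_comp_mul_right_Ioi (weylKernel α) 0 (inv_pos.2 hε)
      simp only [zero_mul, inv_inv, smul_eq_mul] at this
      simp only [div_eq_mul_inv]
      rw [this]
      field_simp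
    have e3 : weylLeftTrunc α a f x ε - φ x =
        c * ∫ t in Ioi 0, ε⁻¹ * weylKernel α (t / ε) * (χ (x - t) - χ x) := by
      rw [weylLeftTrunc_rlIntegralLeft h0 hx hε hεx hf hfx hφ hI, e1]
      have : ∫ t in Ioi 0, ε⁻¹ * weylKernel α (t / ε) * χ (x - t) =
          (∫ t in Ioi 0, ε⁻¹ * weylKernel α (t / ε) * (χ (x - t) - χ x)) +
            ∫ t in Ioi 0, ε⁻¹ * weylKernel α (t / ε) * χ x := by
        rw [← integral_add i1 (i2.mul_const _)]
        congr 1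
        ext t
        ring
      rw [this, integral_mul_const, e2, hχx, hc]
      field_simp
      ring
    rw [e3, norm_mul, Real.norm_of_nonneg hc0.le]
    gcongr
    refine norm_integral_le_of_norm_le (hmi ε hε) ?_
    filter_upwards [ae_restrict_mem measurableSet_Ioi] with t (ht : 0 < t)
    rw [norm_mul, Real.norm_of_nonneg (hK0 t ht), Real.norm_eq_abs]
    gcongr
    exact weylKernel_le h0 h1 (div_pos ht hε)
  rw [tendsto_iff_norm_sub_tendsto_zero]
  refine squeeze_zero' (Eventually.of_forall fun _ => norm_nonneg _) ?_
    (by simpa using hmt.const_mul c)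
  filter_upwards [Ioo_mem_nhdsGT (show 0 < x - a by linarith [hx.1])] with ε hε
  exact hkey ε hε.1 hε.2

/-- The density `φ` in `MemRLLeft` is almost everywhere the limit of the truncations, so the
`limUnder` defining `weylLeft` agrees with it there and may take its place. -/
lemma MemRLLeft.weylLeft_spec {α a s : ℝ} {f : ℝ → ℝ} (h0 : 0 < α) (h1 : α < 1)
    (h : MemRLLeft α a s f) :
    (∀ᵐ x ∂(volume.restrict (Ioo a s)),
      Tendsto (weylLeftTrunc α a f x) (𝓝[>] 0) (𝓝 (weylLeft α a f x))) ∧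
    IntegrableOn (weylLeft α a f) (Ioo a s) ∧
    f =ᵐ[volume.restrict (Ioo a s)] rlIntegralLeft α a (weylLeft α a f) := by
  obtain ⟨φ, hφ, hf⟩ := h
  have ht := ae_tendsto_weylLeftTrunc h0 h1 hφ hf
  have he : φ =ᵐ[volume.restrict (Ioo a s)] weylLeft α a f := by
    filter_upwards [ht] with x hx using hx.limUnder_eq.symm
  refine ⟨?_, hφ.congr he, ?_⟩
  · filter_upwards [ht, he] with x hx hx'
    rwa [← hx']
  · filter_upwards [hf, ae_restrict_mem measurableSet_Ioo] with x hx hx'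
    rw [hx, rlIntegralLeft_congr_ae he hx']

lemma MemRLLeft.integrableOn {α a s : ℝ} {f : ℝ → ℝ} (h0 : 0 < α) (h : MemRLLeft α a s f) :
    IntegrableOn f (Ioo a s) := by
  obtain ⟨φ, hφ, hf⟩ := h
  exact (rlIntegralLeft_integrable h0 hφ).2.congr (hf.mono fun _ hx => hx.symm)

/-! ### Moduli of continuity with a logarithmic factor -/

/-- The function `h ↦ h ^ κ (1 - log h) ^ ν`. -/
noncomputable def logPow (κ ν h : ℝ) : ℝ := h ^ κ * (1 - Real.log h) ^ ν

/-- `h ↦ C h ^ lam (1 - log h) ^ ν` is a modulus of continuity of `k` on `[0,1]`. -/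
def LogModulus (lam ν C : ℝ) (k : ℝ → ℝ) : Prop :=
  ∀ x ∈ Icc (0 : ℝ) 1, ∀ y ∈ Icc (0 : ℝ) 1, |k x - k y| ≤ C * logPow lam ν |x - y|

lemma one_le_one_sub_log {h : ℝ} (h0 : 0 ≤ h) (h1 : h ≤ 1) : 1 ≤ 1 - Real.log h := by
  have := Real.log_nonpos h0 h1
  linarith

lemma logPow_nonneg {κ ν h : ℝ} (h0 : 0 ≤ h) (h1 : h ≤ 1) : 0 ≤ logPow κ ν h := by
  have := one_le_one_sub_log h0 h1
  unfold logPow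
  positivity

lemma logPow_add {κ δ ν h : ℝ} (h0 : 0 < h) : logPow (κ + δ) ν h = h ^ δ * logPow κ ν h := by
  unfold logPow
  rw [Real.rpow_add h0]
  ring

lemma logPow_one (κ ν : ℝ) : logPow κ ν 1 = 1 := by simp [logPow]

/-- The function `logPow κ ν` is increasing up to a constant. -/
lemma logPow_le {κ ν t h : ℝ} (hκ : 0 < κ) (hν : 0 < ν) (ht : 0 < t) (hth : t ≤ h) (h1 : h ≤ 1) :
    logPow κ ν t ≤ (1 + ν / κ) ^ ν * logPow κ ν h := by
  have hh : 0 < h := ht.trans_le hth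
  set s := t / h with hs
  have hs0 : 0 < s := by positivity
  have hs1 : s ≤ 1 := by rw [hs, div_le_one hh]; exact hth
  have hts : t = s * h := by rw [hs]; field_simp
  have l1 := one_le_one_sub_log hs0.le hs1
  have l2 := one_le_one_sub_log hh.le h1
  -- Both logarithms are nonpositive, so `1 - log` is submultiplicative for `t = s * h`.
  have l3 : 1 - Real.log t ≤ (1 - Real.log s) * (1 - Real.log h) := by
    rw [hts, Real.log_mul hs0.ne' hh.ne']
    nlinarith
  have l3' : 0 ≤ 1 - Real.log t := by
    have := one_le_one_sub_log ht.le (hth.trans h1)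
    linarith
  -- The exponent `κ/ν` is chosen so that the `ν`-th power is `s ^ (-κ)`, which cancels the factor
  -- `s ^ κ`.
  have l4 : 1 - Real.log s ≤ (1 + ν / κ) * s ^ (-(κ / ν)) := by
    have e1 := Real.log_le_rpow_div (x := s⁻¹) (by positivity) (show 0 < κ / ν by positivity)
    rw [Real.log_inv, Real.inv_rpow hs0.le, ← Real.rpow_neg hs0.le] at e1
    have e2 : 1 ≤ s ^ (-(κ / ν)) :=
      Real.one_le_rpow_of_pos_of_le_one_of_nonpos hs0 hs1 (by
        have : 0 < κ / ν := by positivity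
        linarith)
    have e3 : s ^ (-(κ / ν)) / (κ / ν) = ν / κ * s ^ (-(κ / ν)) := by field_simp
    linarith
  have l5 : (1 - Real.log s) ^ ν ≤ (1 + ν / κ) ^ ν * s ^ (-κ) := by
    calc (1 - Real.log s) ^ ν ≤ ((1 + ν / κ) * s ^ (-(κ / ν))) ^ ν :=
          Real.rpow_le_rpow (by linarith) l4 hν.le
      _ = _ := by
          rw [Real.mul_rpow (by positivity) (by positivity), ← Real.rpow_mul hs0.le]
          congr 2
          field_simp
  calc logPow κ ν t ≤ t ^ κ * ((1 - Real.log s) * (1 - Real.log h)) ^ ν := by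
        unfold logPow
        gcongr
    _ = s ^ κ * (1 - Real.log s) ^ ν * logPow κ ν h := by
        unfold logPow
        rw [Real.mul_rpow (by linarith) (by linarith)]
        nth_rewrite 1 [hts]
        rw [Real.mul_rpow hs0.le hh.le]
        ring
    _ ≤ s ^ κ * ((1 + ν / κ) ^ ν * s ^ (-κ)) * logPow κ ν h := by
        have := logPow_nonneg (κ := κ) (ν := ν) hh.le h1
        gcongr
    _ = _ := by
        rw [Real.rpow_neg hs0.le]
        field_simp

lemma logPow_le_const {κ ν t : ℝ} (hκ : 0 < κ) (hν : 0 < ν) (ht : 0 < t) (h1 : t ≤ 1) :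
    logPow κ ν t ≤ (1 + ν / κ) ^ ν := by
  simpa [logPow_one] using logPow_le hκ hν ht h1 le_rfl

/-- Up to distance `1/2` the bound follows from `|log h| ≤ 1 - log h`. For larger distances the
midpoint is inserted: both halves are short, and `logPow` is increasing up to the constant `M`.
Using `1 - log` in place of `|log|` removes the zero at `h = 1`, so that the modulus holds on all of
`[0,1]`. -/
lemma LogHolder.exists_logModulus {lam ν : ℝ} (hlam : 0 < lam) (hν : 0 < ν) {g : ℝ → ℝ}
    (hg : LogHolder lam ν g) : ∃ C, 0 ≤ C ∧ LogModulus lam ν C g := by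
  obtain ⟨C, hC⟩ := hg
  set M := (1 + ν / lam) ^ ν with hM
  have hM1 : 1 ≤ M := Real.one_le_rpow (by
    have : 0 < ν / lam := by positivity
    linarith) hν.le
  have hsmall : ∀ x ∈ Icc (0 : ℝ) 1, ∀ y ∈ Icc (0 : ℝ) 1, |x - y| ≤ 1 / 2 →
      |g x - g y| ≤ |C| * logPow lam ν |x - y| := by
    intro x hx y hy hxy
    refine (hC x hx y hy hxy).trans ?_
    rw [mul_assoc]
    have hl : |Real.log (|x - y|)| ≤ 1 - Real.log (|x - y|) := by
      have := Real.log_nonpos (abs_nonneg (x - y)) (by linarith)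
      rw [abs_of_nonpos this]
      linarith
    unfold logPow
    gcongr
    exact le_abs_self C
  refine ⟨2 * |C| * M, by positivity, fun x hx y hy => ?_⟩
  have hd1 : |x - y| ≤ 1 := abs_le.2 ⟨by linarith [hx.1, hy.2], by linarith [hx.2, hy.1]⟩
  have hL := logPow_nonneg (κ := lam) (ν := ν) (abs_nonneg (x - y)) hd1
  rcases le_or_gt |x - y| (1 / 2) with h | h
  · refine (hsmall x hx y hy h).trans ?_
    have : |C| ≤ 2 * |C| * M := by nlinarith [abs_nonneg C]
    gcongr
  · set z := (x + y) / 2 with hz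
    have hzm : z ∈ Icc (0 : ℝ) 1 := ⟨by linarith [hx.1, hy.1], by linarith [hx.2, hy.2]⟩
    have e1 : |x - z| = |x - y| / 2 := by
      rw [show x - z = (x - y) / 2 by rw [hz]; ring, abs_div, abs_two]
    have e2 : |z - y| = |x - y| / 2 := by
      rw [show z - y = (x - y) / 2 by rw [hz]; ring, abs_div, abs_two]
    have b1 := hsmall x hx z hzm (by rw [e1]; linarith)
    have b2 := hsmall z hzm y hy (by rw [e2]; linarith)
    rw [e1] at b1
    rw [e2] at b2
    have b3 := logPow_le (t := |x - y| / 2) (h := |x - y|) hlam hν (by linarith) (by linarith) hd1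
    have b4 := abs_sub_le (g x) (g z) (g y)
    have b5 := mul_le_mul_of_nonneg_left b3 (abs_nonneg C)
    rw [← hM] at b5
    nlinarith

lemma continuousOn_of_abs_sub_le {F : ℝ → ℝ} {S : Set ℝ} {c p : ℝ} (hp : 0 < p)
    (h : ∀ x ∈ S, ∀ y ∈ S, |F x - F y| ≤ c * |x - y| ^ p) : ContinuousOn F S := by
  intro y hy
  rw [ContinuousWithinAt, tendsto_iff_norm_sub_tendsto_zero]
  have h1 : Tendsto (fun x => c * |x - y| ^ p) (𝓝[S] y) (𝓝 0) := by
    have : Continuous fun x => c * |x - y| ^ p :=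
      continuous_const.mul ((Real.continuous_rpow_const hp.le).comp (by fun_prop))
    have h2 := (this.tendsto y).mono_left (nhdsWithin_le_nhds (s := S))
    simpa [Real.zero_rpow hp.ne'] using h2
  refine squeeze_zero' (Eventually.of_forall fun _ => norm_nonneg _) ?_ h1
  filter_upwards [self_mem_nhdsWithin] with x hx
  exact h x hx y hy

/-! ### Weyl derivatives of functions with a logarithmic modulus -/

section Modulus

variable {lam ν C β T : ℝ} {k : ℝ → ℝ}

/-- Half of the exponent absorbs the logarithm and the other half is left as a Hölder exponent. -/
lemma LogModulus.continuousOn (hlam : 0 < lam) (hν : 0 < ν) (hC : 0 ≤ C)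
    (hk : LogModulus lam ν C k) : ContinuousOn k (Icc 0 1) := by
  refine continuousOn_of_abs_sub_le (c := C * (1 + ν / (lam / 2)) ^ ν) (p := lam / 2)
    (by positivity) fun x hx y hy => ?_
  rcases eq_or_ne x y with rfl | hxy
  · simp only [sub_self, abs_zero]
    positivity
  have hd : 0 < |x - y| := abs_pos.2 (sub_ne_zero.2 hxy)
  have hd1 : |x - y| ≤ 1 := abs_le.2 ⟨by linarith [hx.1, hy.2], by linarith [hx.2, hy.1]⟩
  refine (hk x hx y hy).trans ?_
  rw [show lam = lam / 2 + lam / 2 by ring, logPow_add hd,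
    show lam / 2 + lam / 2 = lam by ring]
  have := logPow_le_const (κ := lam / 2) (by positivity) hν hd hd1
  calc C * (|x - y| ^ (lam / 2) * logPow (lam / 2) ν |x - y|)
      ≤ C * (|x - y| ^ (lam / 2) * (1 + ν / (lam / 2)) ^ ν) := by gcongr
    _ = _ := by ring

lemma LogModulus.exists_bound (hlam : 0 < lam) (hν : 0 < ν) (hC : 0 ≤ C)
    (hk : LogModulus lam ν C k) : ∃ B, 0 ≤ B ∧ ∀ x ∈ Icc (0 : ℝ) 1, |k x| ≤ B := by
  obtain ⟨B, hB⟩ := isCompact_Icc.exists_bound_of_continuousOn (hk.continuousOn hlam hν hC)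
  exact ⟨B, (norm_nonneg _).trans (hB 0 ⟨le_rfl, zero_le_one⟩), hB⟩

/-- The Weyl integral of a function with logarithmic modulus of continuity converges absolutely. -/
lemma LogModulus.weyl_integrable (hν : 0 < ν) (hC : 0 ≤ C) (hk : LogModulus lam ν C k)
    (hβ : 0 < β) (hβl : β < lam) (hT : 0 ≤ T) {z : ℝ} (hz : z ∈ Ioc T 1) :
    IntegrableOn (fun u => (k z - k u) / (z - u) ^ (β + 1)) (Ioo T z) ∧
    ∫ u in Ioo T z, |(k z - k u) / (z - u) ^ (β + 1)| ≤
      2 * C * (1 + ν / ((lam - β) / 2)) ^ ν / (lam - β) * logPow (lam - β) ν (z - T) := by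
  set κ := lam - β with hκ
  have hκ0 : 0 < κ := by linarith
  set M := (1 + ν / (κ / 2)) ^ ν with hM
  have hh : 0 < z - T := by linarith [hz.1]
  have hh1 : z - T ≤ 1 := by linarith [hz.2]
  -- The surplus exponent `κ` is halved: one half carries the logarithm and is bounded by its value
  -- at `z - T`, the other leaves the integrable power `(z - u)^(κ/2 - 1)`. Integration restores the
  -- full exponent `κ`.
  have hpt : ∀ u ∈ Ioo T z, |(k z - k u) / (z - u) ^ (β + 1)| ≤
      C * M * logPow (κ / 2) ν (z - T) * (z - u) ^ (κ / 2 - 1) := by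
    intro u hu
    have ht : 0 < z - u := by linarith [hu.2]
    have ht1 : z - u ≤ z - T := by linarith [hu.1]
    have h1 := hk z ⟨by linarith [hz.1], hz.2⟩ u ⟨by linarith [hu.1], by linarith [hu.2, hz.2]⟩
    rw [abs_of_pos ht] at h1
    have h2 := logPow_le (κ := κ / 2) (by positivity) hν ht ht1 hh1
    rw [abs_div, abs_of_pos (show 0 < (z - u) ^ (β + 1) by positivity), div_le_iff₀ (by positivity)]
    have h3 : (z - u) ^ (κ / 2 - 1) * (z - u) ^ (β + 1) = (z - u) ^ (κ / 2 + β) := by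
      rw [← Real.rpow_add ht]; congr 1; ring
    have h4 : logPow lam ν (z - u) = (z - u) ^ (κ / 2 + β) * logPow (κ / 2) ν (z - u) := by
      rw [← logPow_add ht]; congr 1; rw [hκ]; ring
    calc |k z - k u| ≤ C * logPow lam ν (z - u) := h1
      _ ≤ C * ((z - u) ^ (κ / 2 + β) * (M * logPow (κ / 2) ν (z - T))) := by
          rw [h4]; gcongr
      _ = _ := by rw [← h3]; ring
  obtain ⟨i1, i2⟩ := integral_sub_rpow_left (p := κ / 2) (by positivity) hz.1.le
  have hcont := hk.continuousOn (by linarith) hν hC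
  have hmeas : AEStronglyMeasurable (fun u => (k z - k u) / (z - u) ^ (β + 1))
      (volume.restrict (Ioo T z)) := by
    refine ContinuousOn.aestronglyMeasurable (ContinuousOn.div ?_ ?_ ?_) measurableSet_Ioo
    · refine continuousOn_const.sub (hcont.mono fun u hu => ?_)
      exact ⟨by linarith [hu.1], by linarith [hu.2, hz.2]⟩
    · refine ContinuousOn.rpow_const (by fun_prop) fun u hu => Or.inl ?_
      linarith [hu.2]
    · intro u hu
      have : 0 < z - u := by linarith [hu.2]
      positivity
  have hint : IntegrableOn (fun u => (k z - k u) / (z - u) ^ (β + 1)) (Ioo T z) := by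
    refine (i1.const_mul (C * M * logPow (κ / 2) ν (z - T))).mono' hmeas ?_
    filter_upwards [ae_restrict_mem measurableSet_Ioo] with u hu using hpt u hu
  refine ⟨hint, (setIntegral_mono_on hint.abs (i1.const_mul _) measurableSet_Ioo hpt).trans ?_⟩
  rw [integral_const_mul, i2]
  have h5 : logPow κ ν (z - T) = (z - T) ^ (κ / 2) * logPow (κ / 2) ν (z - T) := by
    rw [← logPow_add hh]; congr 1; ring
  rw [h5]
  refine le_of_eq ?_
  field_simp

/-- The Weyl derivative of a function with logarithmic modulus of continuity. -/
lemma LogModulus.tendsto_weylLeftTrunc (hν : 0 < ν) (hC : 0 ≤ C) (hk : LogModulus lam ν C k)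
    (hβ : 0 < β) (hβl : β < lam) (hT : 0 ≤ T) {z : ℝ} (hz : z ∈ Ioc T 1) :
    Tendsto (weylLeftTrunc β T k z) (𝓝[>] 0) (𝓝 (1 / Real.Gamma (1 - β) *
      (k z / (z - T) ^ β + β * ∫ u in Ioo T z, (k z - k u) / (z - u) ^ (β + 1)))) := by
  have hint := (hk.weyl_integrable hν hC hβ hβl hT hz).1
  unfold weylLeftTrunc
  refine Tendsto.const_mul _ (Tendsto.const_add _ (Tendsto.const_mul _ ?_))
  rw [← integral_Ioc_eq_integral_Ioo, ← intervalIntegral.integral_of_le hz.1.le]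
  have hc := intervalIntegral.continuousOn_primitive_interval (μ := volume)
    (f := fun u => (k z - k u) / (z - u) ^ (β + 1)) (a := T) (b := z) (by
      rw [uIcc_of_le hz.1.le, integrableOn_Icc_iff_integrableOn_Ioo]; exact hint)
  rw [uIcc_of_le hz.1.le] at hc
  have h2 : Tendsto (fun ε : ℝ => z - ε) (𝓝[>] 0) (𝓝[Icc T z] z) := by
    refine tendsto_nhdsWithin_iff.2 ⟨?_, ?_⟩
    · have : Continuous fun ε : ℝ => z - ε := by fun_prop
      simpa using (this.tendsto 0).mono_left nhdsWithin_le_nhds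
    · filter_upwards [Ioo_mem_nhdsGT (show 0 < z - T by linarith [hz.1])] with ε hε
      exact ⟨by linarith [hε.2], by linarith [hε.1]⟩
  exact Tendsto.comp (hc z ⟨hz.1.le, le_rfl⟩) h2

lemma LogModulus.weylLeft_eq (hν : 0 < ν) (hC : 0 ≤ C) (hk : LogModulus lam ν C k)
    (hβ : 0 < β) (hβl : β < lam) (hT : 0 ≤ T) {z : ℝ} (hz : z ∈ Ioc T 1) :
    weylLeft β T k z = 1 / Real.Gamma (1 - β) *
      (k z / (z - T) ^ β + β * ∫ u in Ioo T z, (k z - k u) / (z - u) ^ (β + 1)) :=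
  (hk.tendsto_weylLeftTrunc hν hC hβ hβl hT hz).limUnder_eq

lemma LogModulus.tendsto_weylLeft (hν : 0 < ν) (hC : 0 ≤ C) (hk : LogModulus lam ν C k)
    (hβ : 0 < β) (hβl : β < lam) (hT : 0 ≤ T) {z : ℝ} (hz : z ∈ Ioc T 1) :
    Tendsto (weylLeftTrunc β T k z) (𝓝[>] 0) (𝓝 (weylLeft β T k z)) := by
  rw [hk.weylLeft_eq hν hC hβ hβl hT hz]
  exact hk.tendsto_weylLeftTrunc hν hC hβ hβl hT hz

/-- Bound for the truncated Weyl derivatives and the Weyl derivative. -/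
lemma LogModulus.exists_weylLeft_bound (hν : 0 < ν) (hC : 0 ≤ C) (hk : LogModulus lam ν C k)
    (hβ : 0 < β) (hβl : β < lam) (hl1 : lam < 1) (hT : 0 ≤ T) (hkT : k T = 0) :
    ∃ D, 0 ≤ D ∧ ∀ z ∈ Ioc T 1,
      (∀ ε ∈ Ioc 0 (z - T), |weylLeftTrunc β T k z ε| ≤ D * logPow (lam - β) ν (z - T)) ∧
      |weylLeft β T k z| ≤ D * logPow (lam - β) ν (z - T) := by
  have hG := Real.Gamma_pos_of_pos (show 0 < 1 - β by linarith)
  set A := 2 * C * (1 + ν / ((lam - β) / 2)) ^ ν / (lam - β) with hA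
  have hκ0 : 0 < lam - β := by linarith
  have hA0 : 0 ≤ A := by positivity
  refine ⟨1 / Real.Gamma (1 - β) * (C + β * A), by positivity, fun z hz => ?_⟩
  have hh : 0 < z - T := by linarith [hz.1]
  have htr : ∀ ε ∈ Ioc 0 (z - T), |weylLeftTrunc β T k z ε| ≤
      1 / Real.Gamma (1 - β) * (C + β * A) * logPow (lam - β) ν (z - T) := by
    intro ε hε
    obtain ⟨i1, i2⟩ := hk.weyl_integrable hν hC hβ hβl hT hz
    -- Here `k T = 0` is essential: it makes `k z` small enough to compensate the singular factor.
    have h1 : |k z / (z - T) ^ β| ≤ C * logPow (lam - β) ν (z - T) := by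
      have := hk z ⟨by linarith [hz.1], hz.2⟩ T ⟨hT, by linarith [hz.1, hz.2]⟩
      rw [hkT, sub_zero, abs_of_pos hh] at this
      rw [abs_div, abs_of_pos (show 0 < (z - T) ^ β by positivity), div_le_iff₀ (by positivity)]
      rw [show lam = (lam - β) + β by ring, logPow_add hh] at this
      linarith
    have h2 : |∫ u in T..(z - ε), (k z - k u) / (z - u) ^ (β + 1)| ≤
        A * logPow (lam - β) ν (z - T) := by
      refine le_trans ?_ i2
      rw [intervalIntegral.integral_of_le (by linarith [hε.2]), integral_Ioc_eq_integral_Ioo]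
      refine (abs_integral_le_integral_abs).trans ?_
      exact setIntegral_mono_set i1.abs (ae_of_all _ fun _ => abs_nonneg _)
        (Ioo_subset_Ioo_right (by linarith [hε.1])).eventuallyLE
    unfold weylLeftTrunc
    rw [abs_mul, abs_of_pos (show 0 < 1 / Real.Gamma (1 - β) by positivity), mul_assoc]
    gcongr
    refine (abs_add_le _ _).trans ?_
    rw [abs_mul, abs_of_pos hβ]
    have := mul_le_mul_of_nonneg_left h2 hβ.le
    linarith
  refine ⟨htr, le_of_tendsto (hk.tendsto_weylLeft hν hC hβ hβl hT hz).abs ?_⟩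
  filter_upwards [Ioo_mem_nhdsGT hh] with ε hε using htr ε ⟨hε.1, hε.2.le⟩

/-- The Weyl derivative equals a parameter integral over the triangle `u < z`, which is measurable
in `z` by Fubini's theorem. -/
lemma LogModulus.aestronglyMeasurable_weylLeft (hν : 0 < ν) (hC : 0 ≤ C)
    (hk : LogModulus lam ν C k) (hβ : 0 < β) (hβl : β < lam) (hT : 0 ≤ T) :
    AEStronglyMeasurable (weylLeft β T k) (volume.restrict (Ioo T 1)) := by
  set μ := volume.restrict (Ioo T (1 : ℝ)) with hμ
  have hkm : AEStronglyMeasurable k μ :=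
    ((hk.continuousOn (by linarith) hν hC).mono fun u hu => ⟨by linarith [hu.1], hu.2.le⟩
      ).aestronglyMeasurable measurableSet_Ioo
  have hD : MeasurableSet {p : ℝ × ℝ | p.2 < p.1} := measurableSet_lt measurable_snd measurable_fst
  have hF : AEStronglyMeasurable ({p : ℝ × ℝ | p.2 < p.1}.indicator
      fun p => (k p.1 - k p.2) * ((p.1 - p.2) ^ (β + 1))⁻¹) (μ.prod μ) := by
    refine AEStronglyMeasurable.indicator ?_ hD
    refine AEStronglyMeasurable.mul (hkm.comp_fst.sub hkm.comp_snd) ?_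
    apply Measurable.aestronglyMeasurable
    fun_prop
  have h1 := hF.integral_prod_right'
  have h2 : AEStronglyMeasurable (fun z => 1 / Real.Gamma (1 - β) *
      (k z * ((z - T) ^ β)⁻¹ + β * ∫ u, ({p : ℝ × ℝ | p.2 < p.1}.indicator
        fun p => (k p.1 - k p.2) * ((p.1 - p.2) ^ (β + 1))⁻¹) (z, u) ∂μ)) μ := by
    refine AEStronglyMeasurable.const_mul (AEStronglyMeasurable.add ?_ (h1.const_mul _)) _
    refine hkm.mul ?_
    apply Measurable.aestronglyMeasurable
    fun_prop
  refine h2.congr ?_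
  filter_upwards [ae_restrict_mem measurableSet_Ioo] with z hz
  rw [hk.weylLeft_eq hν hC hβ hβl hT ⟨hz.1, hz.2.le⟩]
  congr 2
  congr 1
  have h3 : ∀ u, ({p : ℝ × ℝ | p.2 < p.1}.indicator
      fun p => (k p.1 - k p.2) * ((p.1 - p.2) ^ (β + 1))⁻¹) (z, u) =
      (Iio z).indicator (fun u => (k z - k u) / (z - u) ^ (β + 1)) u := by
    intro u
    simp only [indicator, mem_ofPred_eq, mem_Iio, div_eq_mul_inv]
  simp only [h3]
  rw [integral_indicator measurableSet_Iio, hμ, Measure.restrict_restrict measurableSet_Iio]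
  congr 2
  ext u; simp only [mem_inter_iff, mem_Iio, mem_Ioo]
  exact ⟨fun h => ⟨h.2.1, h.1⟩, fun h => ⟨h.2, h.1, h.2.trans hz.2⟩⟩

end Modulus

/-! ### Inversion of the Weyl derivative for functions with a logarithmic modulus -/

lemma integral_one_div_add_rpow {β ε u b : ℝ} (hβ : 0 < β) (hε : 0 < ε) (hub : u ≤ b) :
    IntegrableOn (fun w => 1 / (w + ε - u) ^ (β + 1)) (Ioo u b) ∧
      ∫ w in Ioo u b, 1 / (w + ε - u) ^ (β + 1) = (1 / ε ^ β - 1 / (b + ε - u) ^ β) / β := by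
  have h := integral_Ioo_of_hasDerivAt_of_nonneg (F := fun w => -((w + ε - u) ^ (-β) / β))
    (F' := fun w => 1 / (w + ε - u) ^ (β + 1)) hub ?_ ?_ ?_
  · refine ⟨h.1, ?_⟩
    rw [h.2, Real.rpow_neg (by linarith), Real.rpow_neg (by linarith), add_sub_cancel_left]
    field_simp
    ring
  · refine ContinuousOn.neg (ContinuousOn.div_const (ContinuousOn.rpow_const (by fun_prop) ?_) _)
    intro w hw; left; linarith [hw.1]
  · intro w hw
    have hwu : 0 < w + ε - u := by linarith [hw.1]
    have h1 : HasDerivAt (fun w => w + ε - u) 1 w := by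
      simpa using ((hasDerivAt_id w).add_const ε).sub_const u
    have h2 := ((h1.rpow_const (p := -β) (Or.inl hwu.ne')).div_const β).neg
    convert! h2 using 1
    rw [show -β - 1 = -(β + 1) by ring, Real.rpow_neg hwu.le]
    field_simp
  · intro w hw
    have : 0 < w + ε - u := by linarith [hw.1]
    positivity

section Modulus

variable {lam ν C β : ℝ} {k : ℝ → ℝ}

/-- The integral of the truncated Weyl derivatives of a continuous function. -/
lemma integral_weylLeftTrunc (hβ : 0 < β) (hk : ContinuousOn k (Icc 0 1)) {X ε : ℝ} (hX : X ≤ 1)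
    (hε : 0 < ε) (hεX : ε < X) :
    IntegrableOn (fun z => weylLeftTrunc β 0 k z ε) (Ioo ε X) ∧
    ∫ z in Ioo ε X, weylLeftTrunc β 0 k z ε = 1 / Real.Gamma (1 - β) *
      (((∫ u in (X - ε)..X, k u) - ∫ u in (0 : ℝ)..ε, k u) / ε ^ β +
        ∫ u in Ioo 0 (X - ε), k u / (X - u) ^ β) := by
  set b := X - ε with hb
  have hb0 : 0 < b := by linarith
  have hkI : ∀ c ∈ Icc (0 : ℝ) 1, ∀ d ∈ Icc (0 : ℝ) 1, IntervalIntegrable k volume c d := by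
    intro c hc d hd
    exact (hk.mono (by rw [← uIcc_of_le (zero_le_one' ℝ)] at *; exact uIcc_subset_uIcc hc hd)
      ).intervalIntegrable
  have m0 : (0 : ℝ) ∈ Icc (0 : ℝ) 1 := ⟨le_rfl, zero_le_one⟩
  have mb : b ∈ Icc (0 : ℝ) 1 := ⟨hb0.le, by linarith⟩
  have mε : ε ∈ Icc (0 : ℝ) 1 := ⟨hε.le, by linarith⟩
  have mX : X ∈ Icc (0 : ℝ) 1 := ⟨by linarith, hX⟩
  have hkb : IntegrableOn k (Ioo 0 b) :=
    (intervalIntegrable_iff_integrableOn_Ioo_of_le hb0.le).1 (hkI 0 m0 b mb)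
  have hfub := triangle_fubini (a := 0) (b := b) (k := fun w u => 1 / (w + ε - u) ^ (β + 1))
    (φ := k) (W := fun _ => 1 / ε ^ β / β) ?_ hkb.aestronglyMeasurable ?_ ?_ (hkb.const_mul _)
  rotate_left
  · apply Measurable.aestronglyMeasurable
    simp only [Function.uncurry_def]
    fun_prop
  · intro u hu
    exact (integral_one_div_add_rpow hβ hε hu.2.le).1
  · intro u hu
    have e : ∫ w in Ioo u b, |1 / (w + ε - u) ^ (β + 1)| =
        ∫ w in Ioo u b, 1 / (w + ε - u) ^ (β + 1) := by
      refine setIntegral_congr_fun measurableSet_Ioo fun w hw => ?_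
      have : 0 < w + ε - u := by linarith [hw.1]
      exact abs_of_nonneg (by positivity)
    rw [e, (integral_one_div_add_rpow hβ hε hu.2.le).2]
    have : 0 < b + ε - u := by linarith [hu.2]
    have : 0 ≤ 1 / (b + ε - u) ^ β := by positivity
    gcongr
    linarith
  set J : ℝ → ℝ := fun w => ∫ u in Ioo 0 w, 1 / (w + ε - u) ^ (β + 1) * k u with hJ
  have hJi : IntegrableOn J (Ioo 0 b) := hfub.2.1
  have hki' : IntegrableOn (fun w => k (w + ε)) (Ioo 0 b) := by
    have h1 := (hkI ε mε X mX).comp_add_right ε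
    rw [sub_self, ← hb, intervalIntegrable_iff_integrableOn_Ioo_of_le hb0.le] at h1
    exact h1
  -- In the variable `w = z - ε` the truncated derivatives live on the triangle `0 < u < w < b`,
  -- with the bounded kernel `(w + ε - u)^(-β-1)`.
  set H : ℝ → ℝ := fun w => 1 / Real.Gamma (1 - β) * (k (w + ε) / ε ^ β - β * J w) with hH
  have hHi : IntegrableOn H (Ioo 0 b) :=
    ((hki'.div_const _).sub (hJi.const_mul β)).const_mul _
  have htr : ∀ z ∈ Ioo ε X, weylLeftTrunc β 0 k z ε = H (z - ε) := by
    intro z hz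
    have hs : IntegrableOn k (Ioo 0 (z - ε)) :=
      hkb.mono_set (Ioo_subset_Ioo_right (by linarith [hz.2]))
    rw [(weylLeftTrunc_eq hβ hε (by linarith [hz.1]) hs).2]
    simp only [hH, hJ, sub_add_cancel]
    congr 4
    ext u
    ring
  have hshift : IntegrableOn (fun z => H (z - ε)) (Ioo ε X) := by
    have h1 := ((intervalIntegrable_iff_integrableOn_Ioo_of_le hb0.le).2 hHi).comp_sub_right ε
    rw [zero_add, hb, sub_add_cancel] at h1
    exact (intervalIntegrable_iff_integrableOn_Ioo_of_le hεX.le).1 h1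
  refine ⟨(integrableOn_congr_fun htr measurableSet_Ioo).2 hshift, ?_⟩
  have hval : ∫ z in Ioo ε X, weylLeftTrunc β 0 k z ε = ∫ w in Ioo 0 b, H w := by
    rw [setIntegral_congr_fun measurableSet_Ioo htr, ← integral_Ioc_eq_integral_Ioo,
      ← intervalIntegral.integral_of_le hεX.le, intervalIntegral.integral_comp_sub_right H,
      sub_self, intervalIntegral.integral_of_le hb0.le, integral_Ioc_eq_integral_Ioo]
  have hinner : ∀ u ∈ Ioo 0 b, (∫ w in Ioo u b, 1 / (w + ε - u) ^ (β + 1)) * k u =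
      1 / β * (k u / ε ^ β - k u / (X - u) ^ β) := by
    intro u hu
    rw [(integral_one_div_add_rpow hβ hε hu.2.le).2, hb, sub_add_cancel]
    field_simp
  have hlast : IntegrableOn (fun u => k u / (X - u) ^ β) (Ioo 0 b) := by
    have h1 := (integrableOn_congr_fun hinner measurableSet_Ioo).1 hfub.2.2.1
    refine (integrableOn_congr_fun (fun u _ => ?_) measurableSet_Ioo).1
      ((hkb.div_const (ε ^ β)).sub (h1.const_mul β))
    simp only [Pi.sub_apply]
    field_simp
    ring
  have e1 : ∫ w in Ioo 0 b, H w = 1 / Real.Gamma (1 - β) *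
      ((∫ w in Ioo 0 b, k (w + ε)) / ε ^ β - β * ∫ w in Ioo 0 b, J w) := by
    rw [hH, integral_const_mul, integral_sub (hki'.div_const _) (hJi.const_mul β), integral_div,
      integral_const_mul]
  have e2 : β * ∫ w in Ioo 0 b, J w =
      (∫ u in Ioo 0 b, k u) / ε ^ β - ∫ u in Ioo 0 b, k u / (X - u) ^ β := by
    rw [hJ, hfub.2.2.2, setIntegral_congr_fun measurableSet_Ioo hinner, integral_const_mul,
      integral_sub (hkb.div_const _) hlast, integral_div]
    field_simp
  have e3 : ∫ w in Ioo 0 b, k (w + ε) = ∫ u in ε..X, k u := by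
    rw [← integral_Ioc_eq_integral_Ioo, ← intervalIntegral.integral_of_le hb0.le,
      intervalIntegral.integral_comp_add_right, zero_add, hb, sub_add_cancel]
  have e4 : ∫ u in Ioo 0 b, k u = ∫ u in (0 : ℝ)..b, k u := by
    rw [← integral_Ioc_eq_integral_Ioo, ← intervalIntegral.integral_of_le hb0.le]
  -- The common part cancels. What remains lives on two intervals of length `ε`, so after division
  -- by `ε^β` it is `O(ε^(1-β))` for bounded `k`.
  have e5 : (∫ u in ε..X, k u) - ∫ u in (0 : ℝ)..b, k u =
      (∫ u in b..X, k u) - ∫ u in (0 : ℝ)..ε, k u := by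
    rw [← intervalIntegral.integral_add_adjacent_intervals (hkI 0 m0 ε mε) (hkI ε mε b mb),
      ← intervalIntegral.integral_add_adjacent_intervals (hkI ε mε b mb) (hkI b mb X mX)]
    ring
  rw [hval, e1, e2, e3, e4, ← e5]
  ring

/-- The integral of the Weyl derivative of order `β` is the fractional integral of order `1 - β`. -/
lemma LogModulus.integral_weylLeft (hν : 0 < ν) (hC : 0 ≤ C) (hk : LogModulus lam ν C k)
    (hβ : 0 < β) (hβl : β < lam) (hl1 : lam < 1) (hk0 : k 0 = 0) {X : ℝ} (hX : X ∈ Ioc (0 : ℝ) 1) :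
    ∫ z in Ioo 0 X, weylLeft β 0 k z = rlIntegralLeft (1 - β) 0 k X := by
  obtain ⟨D, hD0, hD⟩ := hk.exists_weylLeft_bound hν hC hβ hβl hl1 le_rfl hk0
  have hcont := hk.continuousOn (by linarith) hν hC
  obtain ⟨B, hB0, hB⟩ := hk.exists_bound (by linarith) hν hC
  have hκ : 0 < lam - β := by linarith
  -- For `z ≤ ε` the truncation reaches the base point or passes it, so those `z` are discarded; the
  -- rest is bounded uniformly in `ε`.
  set F : ℝ → ℝ → ℝ := fun ε => (Ioi ε).indicator fun z => weylLeftTrunc β 0 k z ε with hF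
  have hlim1 : Tendsto (fun ε => ∫ z in Ioo 0 X, F ε z) (𝓝[>] 0)
      (𝓝 (∫ z in Ioo 0 X, weylLeft β 0 k z)) := by
    refine tendsto_integral_filter_of_dominated_convergence
      (fun _ => D * (1 + ν / (lam - β)) ^ ν) ?_ ?_ (integrableOn_const (by simp)) ?_
    · filter_upwards [Ioo_mem_nhdsGT hX.1] with ε hε
      have h1 := (integral_weylLeftTrunc hβ hcont hX.2 hε.1 hε.2).1
      refine (aestronglyMeasurable_indicator_iff measurableSet_Ioi).2 ?_
      rw [Measure.restrict_restrict measurableSet_Ioi]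
      refine h1.aestronglyMeasurable.mono_measure (Measure.restrict_mono (fun z hz => ?_) le_rfl)
      exact ⟨hz.1, hz.2.2⟩
    · filter_upwards [self_mem_nhdsWithin] with ε (hε : 0 < ε)
      filter_upwards [ae_restrict_mem measurableSet_Ioo] with z hz
      have hz1 : z ≤ 1 := hz.2.le.trans hX.2
      have h2 := logPow_le_const hκ hν hz.1 hz1
      by_cases hzε : ε < z
      · simp only [hF]
        rw [indicator_of_mem (show z ∈ Ioi ε from hzε), Real.norm_eq_abs]
        have h1 := (hD z ⟨hz.1, hz1⟩).1 ε ⟨hε, by linarith⟩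
        rw [sub_zero] at h1
        refine h1.trans ?_
        gcongr
      · simp only [hF]
        rw [indicator_of_notMem (show z ∉ Ioi ε from hzε), norm_zero]
        positivity
    · filter_upwards [ae_restrict_mem measurableSet_Ioo] with z hz
      refine (hk.tendsto_weylLeft hν hC hβ hβl le_rfl ⟨hz.1, hz.2.le.trans hX.2⟩).congr' ?_
      filter_upwards [Ioo_mem_nhdsGT hz.1] with ε hε
      simp only [hF]
      rw [indicator_of_mem (show z ∈ Ioi ε from hε.2)]
  have hval : ∀ ε ∈ Ioo 0 X, ∫ z in Ioo 0 X, F ε z = 1 / Real.Gamma (1 - β) *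
      (((∫ u in (X - ε)..X, k u) - ∫ u in (0 : ℝ)..ε, k u) / ε ^ β +
        ∫ u in Ioo 0 (X - ε), k u / (X - u) ^ β) := by
    intro ε hε
    rw [← (integral_weylLeftTrunc hβ hcont hX.2 hε.1 hε.2).2, hF,
      integral_indicator measurableSet_Ioi, Measure.restrict_restrict measurableSet_Ioi]
    congr 2
    ext z; simp only [mem_inter_iff, mem_Ioi, mem_Ioo]
    exact ⟨fun h => ⟨h.1, h.2.2⟩, fun h => ⟨h.1, hε.1.trans h.1, h.2⟩⟩
  have hlast : IntegrableOn (fun u => k u / (X - u) ^ β) (Ioo 0 X) := by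
    have h1 := (integral_sub_rpow_left (p := 1 - β) (by linarith) hX.1.le).1
    refine (h1.const_mul B).mono' ?_ ?_
    · refine ContinuousOn.aestronglyMeasurable (ContinuousOn.div ?_ ?_ ?_) measurableSet_Ioo
      · exact hcont.mono fun u hu => ⟨hu.1.le, hu.2.le.trans hX.2⟩
      · refine ContinuousOn.rpow_const (by fun_prop) fun u hu => Or.inl ?_
        linarith [hu.2]
      · intro u hu
        have : 0 < X - u := by linarith [hu.2]
        positivity
    · filter_upwards [ae_restrict_mem measurableSet_Ioo] with u hu
      have hXu : 0 < X - u := by linarith [hu.2]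
      rw [norm_div, Real.norm_of_nonneg (show 0 ≤ (X - u) ^ β by positivity),
        show 1 - β - 1 = -β by ring, Real.rpow_neg hXu.le, div_eq_mul_inv]
      gcongr
      exact hB u ⟨hu.1.le, hu.2.le.trans hX.2⟩
  have hlim2 : Tendsto (fun ε => 1 / Real.Gamma (1 - β) *
      (((∫ u in (X - ε)..X, k u) - ∫ u in (0 : ℝ)..ε, k u) / ε ^ β +
        ∫ u in Ioo 0 (X - ε), k u / (X - u) ^ β)) (𝓝[>] 0)
      (𝓝 (1 / Real.Gamma (1 - β) * (0 + ∫ u in Ioo 0 X, k u / (X - u) ^ β))) := by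
    refine Tendsto.const_mul _ (Tendsto.add ?_ ?_)
    · have h1 : Tendsto (fun ε : ℝ => 2 * B * ε ^ (1 - β)) (𝓝[>] 0) (𝓝 0) := by
        have : Continuous fun ε : ℝ => 2 * B * ε ^ (1 - β) :=
          continuous_const.mul (Real.continuous_rpow_const (by linarith))
        have h2 := (this.tendsto 0).mono_left (nhdsWithin_le_nhds (s := Ioi 0))
        rwa [Real.zero_rpow (by linarith), mul_zero] at h2
      refine squeeze_zero_norm' ?_ h1
      filter_upwards [Ioo_mem_nhdsGT hX.1] with ε hε
      have b1 : ‖∫ u in (X - ε)..X, k u‖ ≤ B * |X - (X - ε)| := by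
        refine intervalIntegral.norm_integral_le_of_norm_le_const fun u hu => ?_
        rw [uIoc_of_le (by linarith [hε.1])] at hu
        exact hB u ⟨by linarith [hu.1, hε.2], hu.2.trans hX.2⟩
      have b2 : ‖∫ u in (0 : ℝ)..ε, k u‖ ≤ B * |ε - 0| := by
        refine intervalIntegral.norm_integral_le_of_norm_le_const fun u hu => ?_
        rw [uIoc_of_le hε.1.le] at hu
        exact hB u ⟨hu.1.le, by linarith [hu.2, hε.2, hX.2]⟩
      rw [sub_sub_cancel, abs_of_pos hε.1] at b1
      rw [sub_zero, abs_of_pos hε.1] at b2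
      have hεβ : 0 < ε ^ β := Real.rpow_pos_of_pos hε.1 _
      rw [norm_div, Real.norm_of_nonneg hεβ.le, div_le_iff₀ hεβ, mul_assoc,
        ← Real.rpow_add hε.1, sub_add_cancel, Real.rpow_one]
      refine (norm_sub_le _ _).trans ?_
      linarith
    · rw [← integral_Ioc_eq_integral_Ioo, ← intervalIntegral.integral_of_le hX.1.le]
      have hc := intervalIntegral.continuousOn_primitive_interval (μ := volume)
        (f := fun u => k u / (X - u) ^ β) (a := 0) (b := X) (by
          rw [uIcc_of_le hX.1.le, integrableOn_Icc_iff_integrableOn_Ioo]; exact hlast)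
      rw [uIcc_of_le hX.1.le] at hc
      have h2 : Tendsto (fun ε : ℝ => X - ε) (𝓝[>] 0) (𝓝[Icc 0 X] X) := by
        refine tendsto_nhdsWithin_iff.2 ⟨?_, ?_⟩
        · have : Continuous fun ε : ℝ => X - ε := by fun_prop
          simpa using (this.tendsto 0).mono_left nhdsWithin_le_nhds
        · filter_upwards [Ioo_mem_nhdsGT hX.1] with ε hε
          exact ⟨by linarith [hε.2], by linarith [hε.1]⟩
      refine (Tendsto.comp (hc X ⟨hX.1.le, le_rfl⟩) h2).congr' ?_
      filter_upwards [Ioo_mem_nhdsGT hX.1] with ε hε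
      simp only [Function.comp_apply]
      rw [intervalIntegral.integral_of_le (by linarith [hε.2]), integral_Ioc_eq_integral_Ioo]
  have hlim3 := hlim2.congr' (f₂ := fun ε => ∫ z in Ioo 0 X, F ε z) (by
    filter_upwards [Ioo_mem_nhdsGT hX.1] with ε hε using (hval ε hε).symm)
  rw [tendsto_nhds_unique hlim1 hlim3, rlIntegralLeft_eq _ _ hX.1.le, zero_add]
  congr 1
  refine setIntegral_congr_fun measurableSet_Ioo fun u hu => ?_
  have hXu : 0 < X - u := by linarith [hu.2]
  rw [show 1 - β - 1 = -β by ring, Real.rpow_neg hXu.le]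
  ring

lemma integrableOn_sub_rpow_mul {p a x B : ℝ} {φ : ℝ → ℝ} (hp : 0 < p) (hax : a ≤ x)
    (hφ : AEStronglyMeasurable φ (volume.restrict (Ioo a x))) (hB : ∀ y ∈ Ioo a x, |φ y| ≤ B) :
    IntegrableOn (fun y => (x - y) ^ (p - 1) * φ y) (Ioo a x) := by
  have h1 := (integral_sub_rpow_left hp hax).1
  refine (h1.mul_const B).mono' (h1.aestronglyMeasurable.mul hφ) ?_
  filter_upwards [ae_restrict_mem measurableSet_Ioo] with y hy
  have : 0 < x - y := by linarith [hy.2]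
  rw [norm_mul, Real.norm_of_nonneg (by positivity)]
  gcongr
  exact hB y hy

/-- Fractional integrals of bounded functions are continuous. -/
lemma continuousOn_rlIntegralLeft {p a b B : ℝ} {φ : ℝ → ℝ} (hp : 0 < p) (hp1 : p < 1)
    (hφ : AEStronglyMeasurable φ (volume.restrict (Ioo a b))) (hB : ∀ y ∈ Ioo a b, |φ y| ≤ B) :
    ContinuousOn (rlIntegralLeft p a φ) (Ioo a b) := by
  have hG := Real.Gamma_pos_of_pos hp
  -- As `p < 1`, the kernel decreases with distance, so `(x-u)^(p-1) - (y-u)^(p-1)` is nonnegative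
  -- and its integral is explicit; this gives Hölder continuity of order `p`.
  have key : ∀ x ∈ Ioo a b, ∀ y ∈ Ioo a b, x < y →
      |rlIntegralLeft p a φ x - rlIntegralLeft p a φ y| ≤
        1 / Real.Gamma p * (2 * B / p) * |x - y| ^ p := by
    intro x hx y hy hxy
    have hB0 : 0 ≤ B := (abs_nonneg _).trans (hB x hx)
    have hmx := hφ.mono_measure (Measure.restrict_mono (Ioo_subset_Ioo_right hx.2.le) le_rfl)
    have hmy := hφ.mono_measure (Measure.restrict_mono (Ioo_subset_Ioo_right hy.2.le) le_rfl)
    have ix := integrableOn_sub_rpow_mul hp hx.1.le hmx fun u hu => hB u ⟨hu.1, hu.2.trans hx.2⟩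
    have iy := integrableOn_sub_rpow_mul hp hy.1.le hmy fun u hu => hB u ⟨hu.1, hu.2.trans hy.2⟩
    have iyx := iy.mono_set (Ioo_subset_Ioo_right hxy.le)
    have iyr := iy.mono_set (Ioo_subset_Ioo_left hx.1.le)
    obtain ⟨p1, p2⟩ := integral_sub_rpow_left hp hx.1.le
    obtain ⟨q1, q2⟩ := integral_sub_rpow_left hp hy.1.le
    obtain ⟨r1, r2⟩ := integral_sub_rpow_left hp hxy.le
    have q1x := q1.mono_set (Ioo_subset_Ioo_right hxy.le)
    have split : ∀ {h : ℝ → ℝ}, IntegrableOn h (Ioo a y) →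
        ∫ u in Ioo a y, h u = (∫ u in Ioo a x, h u) + ∫ u in Ioo x y, h u := by
      intro h hh
      have h1 := (intervalIntegrable_iff_integrableOn_Ioo_of_le hx.1.le).2
        (hh.mono_set (Ioo_subset_Ioo_right hxy.le))
      have h2 := (intervalIntegrable_iff_integrableOn_Ioo_of_le hxy.le).2
        (hh.mono_set (Ioo_subset_Ioo_left hx.1.le))
      have h3 := intervalIntegral.integral_add_adjacent_intervals h1 h2
      rw [intervalIntegral.integral_of_le hx.1.le, intervalIntegral.integral_of_le hxy.le,
        intervalIntegral.integral_of_le hy.1.le] at h3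
      simp only [integral_Ioc_eq_integral_Ioo] at h3
      exact h3.symm
    have e1 := split iy
    have e2 := split q1
    have hbd1 : ‖∫ u in Ioo a x, ((x - u) ^ (p - 1) * φ u - (y - u) ^ (p - 1) * φ u)‖ ≤
        ∫ u in Ioo a x, B * ((x - u) ^ (p - 1) - (y - u) ^ (p - 1)) := by
      refine norm_integral_le_of_norm_le ((p1.sub q1x).const_mul B) ?_
      filter_upwards [ae_restrict_mem measurableSet_Ioo] with u hu
      have hxu : 0 < x - u := by linarith [hu.2]
      have : (y - u) ^ (p - 1) ≤ (x - u) ^ (p - 1) :=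
        Real.rpow_le_rpow_of_nonpos hxu (by linarith) (by linarith)
      rw [← sub_mul, norm_mul, Real.norm_of_nonneg (by linarith), mul_comm]
      exact mul_le_mul_of_nonneg_right (hB u ⟨hu.1, hu.2.trans hx.2⟩) (by linarith)
    have hbd2 : ‖∫ u in Ioo x y, (y - u) ^ (p - 1) * φ u‖ ≤
        ∫ u in Ioo x y, B * (y - u) ^ (p - 1) := by
      refine norm_integral_le_of_norm_le (r1.const_mul B) ?_
      filter_upwards [ae_restrict_mem measurableSet_Ioo] with u hu
      have hyu : 0 < y - u := by linarith [hu.2]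
      rw [norm_mul, Real.norm_of_nonneg (by positivity), mul_comm]
      exact mul_le_mul_of_nonneg_right (hB u ⟨hx.1.trans hu.1, hu.2.trans hy.2⟩) (by positivity)
    rw [integral_const_mul, integral_sub p1 q1x, Real.norm_eq_abs] at hbd1
    rw [integral_const_mul, Real.norm_eq_abs] at hbd2
    rw [integral_sub ix iyx] at hbd1
    have hmono : (x - a) ^ p ≤ (y - a) ^ p :=
      Real.rpow_le_rpow (by linarith [hx.1]) (by linarith) hp.le
    rw [rlIntegralLeft_eq _ _ hx.1.le, rlIntegralLeft_eq _ _ hy.1.le, ← mul_sub, abs_mul,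
      abs_of_pos (show 0 < 1 / Real.Gamma p by positivity), mul_assoc]
    gcongr
    rw [abs_sub_comm x y, abs_of_pos (show 0 < y - x by linarith), e1, ← sub_sub]
    refine (abs_sub _ _).trans ((add_le_add hbd1 hbd2).trans ?_)
    have hcalc : ((∫ u in Ioo a x, (x - u) ^ (p - 1)) - ∫ u in Ioo a x, (y - u) ^ (p - 1)) +
        (∫ u in Ioo x y, (y - u) ^ (p - 1)) ≤ 2 * (y - x) ^ p / p := by
      have : ∫ u in Ioo a x, (y - u) ^ (p - 1) = (y - a) ^ p / p - (y - x) ^ p / p := by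
        rw [← q2, ← r2, e2]; ring
      rw [this, p2, r2]
      have h3 : (x - a) ^ p / p ≤ (y - a) ^ p / p := by gcongr
      have h4 : 2 * (y - x) ^ p / p = (y - x) ^ p / p + (y - x) ^ p / p := by ring
      linarith
    calc _ = B * (((∫ u in Ioo a x, (x - u) ^ (p - 1)) - ∫ u in Ioo a x, (y - u) ^ (p - 1)) +
          (∫ u in Ioo x y, (y - u) ^ (p - 1))) := by ring
      _ ≤ B * (2 * (y - x) ^ p / p) := by gcongr
      _ = _ := by ring
  refine continuousOn_of_abs_sub_le (c := 1 / Real.Gamma p * (2 * B / p)) hp fun x hx y hy => ?_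
  rcases lt_trichotomy x y with h | h | h
  · exact key x hx y hy h
  · subst h
    simp [Real.zero_rpow hp.ne']
  · rw [abs_sub_comm, abs_sub_comm x y]
    exact key y hy x hx h

/-- A function with logarithmic modulus of continuity that vanishes at `0` is the fractional
integral of its Weyl derivative. -/
lemma LogModulus.rlIntegralLeft_weylLeft (hν : 0 < ν) (hC : 0 ≤ C) (hk : LogModulus lam ν C k)
    (hβ : 0 < β) (hβl : β < lam) (hl1 : lam < 1) (hk0 : k 0 = 0) {x : ℝ} (hx : x ∈ Ioo (0 : ℝ) 1) :
    k x = rlIntegralLeft β 0 (weylLeft β 0 k) x := by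
  set ψ := weylLeft β 0 k with hψ
  obtain ⟨D, hD0, hD⟩ := hk.exists_weylLeft_bound hν hC hβ hβl hl1 le_rfl hk0
  have hcont := hk.continuousOn (by linarith) hν hC
  obtain ⟨B, hB0, hB⟩ := hk.exists_bound (by linarith) hν hC
  have hκ : 0 < lam - β := by linarith
  have hψm : AEStronglyMeasurable ψ (volume.restrict (Ioo 0 1)) :=
    hk.aestronglyMeasurable_weylLeft hν hC hβ hβl le_rfl
  have hψB : ∀ y ∈ Ioo (0 : ℝ) 1, |ψ y| ≤ D * (1 + ν / (lam - β)) ^ ν := by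
    intro y hy
    have h1 := (hD y ⟨hy.1, hy.2.le⟩).2
    rw [sub_zero] at h1
    exact h1.trans (by gcongr; exact logPow_le_const hκ hν hy.1 hy.2.le)
  have hrc := continuousOn_rlIntegralLeft hβ (hβl.trans hl1) hψm hψB
  have hone : ∀ (φ : ℝ → ℝ) (z : ℝ), 0 ≤ z → rlIntegralLeft 1 0 φ z = ∫ u in (0 : ℝ)..z, φ u := by
    intro φ z hz
    simp [rlIntegralLeft]
  -- With `I^{1-β} k = I^1 ψ` the semigroup law gives `I^1 k = I^β I^{1-β} k = I^β I^1 ψ = I^1 I^β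
  -- ψ`.
  have hint : ∀ z ∈ Ioo (0 : ℝ) 1, ∫ u in (0 : ℝ)..z, k u = ∫ u in (0 : ℝ)..z,
      rlIntegralLeft β 0 ψ u := by
    intro z hz
    have hsub : Ioo 0 z ⊆ Ioo (0 : ℝ) 1 := Ioo_subset_Ioo_right hz.2.le
    have hkm : AEStronglyMeasurable k (volume.restrict (Ioo 0 z)) :=
      (hcont.mono fun u hu => ⟨hu.1.le, (hu.2.trans hz.2).le⟩).aestronglyMeasurable
        measurableSet_Ioo
    have hψz := hψm.mono_measure (Measure.restrict_mono hsub le_rfl)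
    have s1 := rlIntegralLeft_rlIntegralLeft hβ (show 0 < 1 - β by linarith) hz.1 hkm
      (integrableOn_sub_rpow_mul (by linarith) hz.1.le hkm fun u hu =>
        hB u ⟨hu.1.le, (hu.2.trans hz.2).le⟩)
    have s2 := rlIntegralLeft_rlIntegralLeft hβ zero_lt_one hz.1 hψz
      (integrableOn_sub_rpow_mul (by linarith) hz.1.le hψz fun u hu => hψB u (hsub hu))
    have s3 := rlIntegralLeft_rlIntegralLeft zero_lt_one hβ hz.1 hψz
      (integrableOn_sub_rpow_mul (by linarith) hz.1.le hψz fun u hu => hψB u (hsub hu))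
    rw [add_sub_cancel, hone k z hz.1.le] at s1
    rw [add_comm 1 β, hone _ z hz.1.le] at s3
    rw [← s1, s3, ← s2, rlIntegralLeft_eq _ _ hz.1.le, rlIntegralLeft_eq _ _ hz.1.le]
    congr 1
    refine setIntegral_congr_fun measurableSet_Ioo fun u hu => ?_
    have hu1 := hsub hu
    rw [hone ψ u hu.1.le, ← hk.integral_weylLeft hν hC hβ hβl hl1 hk0 ⟨hu1.1, hu1.2.le⟩,
      intervalIntegral.integral_of_le hu.1.le, integral_Ioc_eq_integral_Ioo]
  have hnhds : Ioo (0 : ℝ) 1 ∈ 𝓝 x := Ioo_mem_nhds hx.1 hx.2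
  have hψint : IntegrableOn ψ (Ioo 0 1) := by
    refine (integrableOn_const (C := D * (1 + ν / (lam - β)) ^ ν) (by simp)).mono' hψm ?_
    filter_upwards [ae_restrict_mem measurableSet_Ioo] with u hu using hψB u hu
  have hsub : Ioo 0 x ⊆ Ioo (0 : ℝ) 1 := Ioo_subset_Ioo_right hx.2.le
  have d1 : HasDerivAt (fun z => ∫ u in (0 : ℝ)..z, k u) (k x) x := by
    have hc1 : ContinuousOn k (Ioo 0 1) := hcont.mono Ioo_subset_Icc_self
    refine intervalIntegral.integral_hasDerivAt_right ?_
      (hc1.stronglyMeasurableAtFilter isOpen_Ioo x hx) (hc1.continuousAt hnhds)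
    refine (hcont.mono ?_).intervalIntegrable
    rw [uIcc_of_le hx.1.le]
    exact Icc_subset_Icc_right hx.2.le
  have d2 : HasDerivAt (fun z => ∫ u in (0 : ℝ)..z, rlIntegralLeft β 0 ψ u)
      (rlIntegralLeft β 0 ψ x) x := by
    refine intervalIntegral.integral_hasDerivAt_right ?_
      (hrc.stronglyMeasurableAtFilter isOpen_Ioo x hx) (hrc.continuousAt hnhds)
    rw [intervalIntegrable_iff_integrableOn_Ioo_of_le hx.1.le]
    exact (rlIntegralLeft_integrable hβ hψint).2.mono_set hsub
  -- Both integrands are continuous, so differentiation gives equality at every point, not merely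
  -- almost everywhere.
  refine d1.unique (d2.congr_of_eventuallyEq ?_)
  filter_upwards [hnhds] with z hz using hint z hz

/-- The Weyl derivative of smaller order is a fractional integral of the Weyl derivative of
larger order. -/
lemma LogModulus.weylLeft_ae_eq (hν : 0 < ν) (hC : 0 ≤ C) (hk : LogModulus lam ν C k) {β' : ℝ}
    (hβ' : 0 < β') (hβ : β' < β) (hβl : β < lam) (hl1 : lam < 1) (hk0 : k 0 = 0) :
    weylLeft β' 0 k =ᵐ[volume.restrict (Ioo 0 1)]
      rlIntegralLeft (β - β') 0 (weylLeft β 0 k) := by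
  have hβ0 : 0 < β := hβ'.trans hβ
  have hδ : 0 < β - β' := by linarith
  set ψ := weylLeft β 0 k with hψ
  obtain ⟨D, hD0, hD⟩ := hk.exists_weylLeft_bound hν hC hβ0 hβl hl1 le_rfl hk0
  have hκ : 0 < lam - β := by linarith
  have hψm : AEStronglyMeasurable ψ (volume.restrict (Ioo 0 1)) :=
    hk.aestronglyMeasurable_weylLeft hν hC hβ0 hβl le_rfl
  have hψB : ∀ y ∈ Ioo (0 : ℝ) 1, |ψ y| ≤ D * (1 + ν / (lam - β)) ^ ν := by
    intro y hy
    have h1 := (hD y ⟨hy.1, hy.2.le⟩).2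
    rw [sub_zero] at h1
    exact h1.trans (by gcongr; exact logPow_le_const hκ hν hy.1 hy.2.le)
  have hψint : IntegrableOn ψ (Ioo 0 1) := by
    refine (integrableOn_const (C := D * (1 + ν / (lam - β)) ^ ν) (by simp)).mono' hψm ?_
    filter_upwards [ae_restrict_mem measurableSet_Ioo] with u hu using hψB u hu
  -- The semigroup law writes `k` as `I^{β'}` of the function `I^{β-β'} ψ`, which the inversion
  -- theorem then recovers.
  have h := ae_tendsto_weylLeftTrunc (f := k) hβ' (by linarith)
    (rlIntegralLeft_integrable hδ hψint).2 (by
      filter_upwards [ae_restrict_mem measurableSet_Ioo] with x hx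
      have hψz := hψm.mono_measure
        (Measure.restrict_mono (Ioo_subset_Ioo_right hx.2.le : Ioo 0 x ⊆ Ioo (0 : ℝ) 1) le_rfl)
      rw [rlIntegralLeft_rlIntegralLeft hβ' hδ hx.1 hψz, add_sub_cancel]
      · exact hk.rlIntegralLeft_weylLeft hν hC hβ0 hβl hl1 hk0 hx
      · exact integrableOn_sub_rpow_mul (by linarith) hx.1.le hψz fun u hu =>
          hψB u ⟨hu.1, hu.2.trans hx.2⟩)
  filter_upwards [h] with x hx using hx.limUnder_eq

end Modulus

/-! ### Reflection -/

lemma measurePreserving_one_sub (a b : ℝ) : MeasurePreserving (fun x : ℝ => 1 - x)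
    (volume.restrict (Ioo a b)) (volume.restrict (Ioo (1 - b) (1 - a))) := by
  have h := (Measure.measurePreserving_sub_left (volume : Measure ℝ) 1).restrict_preimage
    (measurableSet_Ioo (a := 1 - b) (b := 1 - a))
  rwa [preimage_const_sub_Ioo, sub_sub_cancel, sub_sub_cancel] at h

/-- The truncated right-sided Weyl derivative is a reflected left-sided one. -/
lemma weylRightTrunc_eq (β b : ℝ) (h : ℝ → ℝ) (x ε : ℝ) :
    weylRightTrunc β b h x ε = Complex.exp (Complex.I * Real.pi * β) *
      (weylLeftTrunc β (1 - b) (fun z => h (1 - z)) (1 - x) ε : ℂ) := by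
  have h1 := intervalIntegral.integral_comp_sub_left (a := 1 - b) (b := 1 - x - ε)
    (fun v => (h x - h v) / (v - x) ^ (β + 1)) 1
  rw [sub_sub_cancel, show 1 - (1 - x - ε) = x + ε by ring] at h1
  unfold weylRightTrunc weylLeftTrunc
  rw [← h1]
  simp only [sub_sub_cancel, sub_sub_sub_cancel_left, sub_right_comm (1 : ℝ) _ x]
  push_cast
  ring

/-! ### Exhaustion of `(a,1)` -/

/-- `MemRLLeft` is given on `[a,s]` with `s < 1` only, so statements on `(a,1)` pass through a
countable exhaustion. The denominator `n + 2` keeps the right end point strictly above `a` for `n =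
0` too. -/
lemma iUnion_Ioo_eq {a : ℝ} (ha : a < 1) :
    ⋃ n : ℕ, Ioo a (1 - (1 - a) / (n + 2)) = Ioo a 1 := by
  have h1a : 0 < 1 - a := by linarith
  ext x
  simp only [mem_iUnion, mem_Ioo]
  constructor
  · rintro ⟨n, h1, h2⟩
    have : 0 < (1 - a) / ((n : ℝ) + 2) := by positivity
    exact ⟨h1, by linarith⟩
  · rintro ⟨h1, h2⟩
    have hx : 0 < 1 - x := by linarith
    obtain ⟨n, hn⟩ := exists_nat_gt ((1 - a) / (1 - x))
    refine ⟨n, h1, ?_⟩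
    have h3 : (1 - a) / ((n : ℝ) + 2) < 1 - x := by
      rw [div_lt_iff₀ (by positivity)]
      rw [div_lt_iff₀ hx] at hn
      nlinarith
    linarith

lemma sub_div_mem_Ioo {a : ℝ} (ha : a < 1) (n : ℕ) :
    1 - (1 - a) / ((n : ℝ) + 2) ∈ Ioo a 1 := by
  have h1a : 0 < 1 - a := by linarith
  have h1 : 0 < (1 - a) / ((n : ℝ) + 2) := by positivity
  have h2 : (1 - a) / ((n : ℝ) + 2) < 1 - a := by
    rw [div_lt_iff₀ (by positivity)]
    have : (0 : ℝ) ≤ n := n.cast_nonneg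
    nlinarith
  exact ⟨by linarith, by linarith⟩

lemma ae_restrict_Ioo_of_forall {a : ℝ} (ha : a < 1) {p : ℝ → Prop}
    (h : ∀ s ∈ Ioo a 1, ∀ᵐ x ∂(volume.restrict (Ioo a s)), p x) :
    ∀ᵐ x ∂(volume.restrict (Ioo a 1)), p x := by
  rw [← iUnion_Ioo_eq ha, ae_restrict_iUnion_iff]
  exact fun n => h _ (sub_div_mem_Ioo ha n)

lemma aestronglyMeasurable_Ioo_of_forall {a : ℝ} (ha : a < 1) {φ : ℝ → ℝ}
    (h : ∀ s ∈ Ioo a 1, AEStronglyMeasurable φ (volume.restrict (Ioo a s))) :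
    AEStronglyMeasurable φ (volume.restrict (Ioo a 1)) := by
  rw [← iUnion_Ioo_eq ha, aestronglyMeasurable_iUnion_iff]
  exact fun n => h _ (sub_div_mem_Ioo ha n)

/-! ### The weighted class -/

/-- For `1 - x ≤ e⁻¹` the modulus of the logarithm is at least `1`, so `1 - log ≤ 2 |log|`, and
raising the exponent from `ν` to `μ` only increases the power. -/
lemma logPow_le_weight {lam α ν μ x : ℝ} (hν : 0 < ν) (hμ : ν < μ) (h0 : 0 < 1 - x)
    (h1 : 1 - x ≤ Real.exp (-1)) :
    logPow (lam + α - 1) ν (1 - x) ≤ 2 ^ ν * weight lam α μ x := by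
  have hl : Real.log (1 - x) ≤ -1 := by
    rw [← Real.log_exp (-1)]
    exact Real.log_le_log h0 h1
  have ha : |Real.log (1 - x)| = -Real.log (1 - x) := abs_of_neg (by linarith)
  unfold logPow weight
  have h2 : (1 - Real.log (1 - x)) ^ ν ≤ 2 ^ ν * |Real.log (1 - x)| ^ μ := by
    calc (1 - Real.log (1 - x)) ^ ν ≤ (2 * |Real.log (1 - x)|) ^ ν :=
          Real.rpow_le_rpow (by linarith) (by rw [ha]; linarith) hν.le
      _ = 2 ^ ν * |Real.log (1 - x)| ^ ν := Real.mul_rpow (by norm_num) (abs_nonneg _)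
      _ ≤ _ := by
          gcongr
          rw [ha]; linarith
  calc (1 - x) ^ (lam + α - 1) * (1 - Real.log (1 - x)) ^ ν
      ≤ (1 - x) ^ (lam + α - 1) * (2 ^ ν * |Real.log (1 - x)| ^ μ) := by gcongr
    _ = _ := by ring

lemma DerivMemWeightedL1.aestronglyMeasurable {lam α μ a : ℝ} {f : ℝ → ℝ} (h0 : 0 < α) (h1 : α < 1)
    (ha : a < 1) (h : DerivMemWeightedL1 lam α μ a f) :
    AEStronglyMeasurable (weylLeft α a f) (volume.restrict (Ioo a 1)) :=
  aestronglyMeasurable_Ioo_of_forall ha fun s hs =>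
    ((h.1 s hs).weylLeft_spec h0 h1).2.1.aestronglyMeasurable

lemma DerivMemWeightedL1.ae_tendsto {lam α μ a : ℝ} {f : ℝ → ℝ} (h0 : 0 < α) (h1 : α < 1)
    (ha : a < 1) (h : DerivMemWeightedL1 lam α μ a f) :
    ∀ᵐ x ∂(volume.restrict (Ioo a 1)),
      Tendsto (weylLeftTrunc α a f x) (𝓝[>] 0) (𝓝 (weylLeft α a f x)) :=
  ae_restrict_Ioo_of_forall ha fun s hs => ((h.1 s hs).weylLeft_spec h0 h1).1

lemma measurable_logPow (κ ν : ℝ) : Measurable (logPow κ ν) := by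
  unfold logPow
  fun_prop

/-- The weight may be replaced by the modulus of continuity. -/
lemma DerivMemWeightedL1.integrableOn_logPow {lam α μ ν a : ℝ} {f : ℝ → ℝ} (hν : 0 < ν)
    (hμ : ν < μ) (h0 : 0 < α) (h1 : α < 1) (hκ : 0 < lam + α - 1) (ha0 : 0 ≤ a) (ha : a < 1)
    (h : DerivMemWeightedL1 lam α μ a f) :
    IntegrableOn (fun x => logPow (lam + α - 1) ν (1 - x) * weylLeft α a f x) (Ioo a 1) := by
  have hm := h.aestronglyMeasurable h0 h1 ha
  have hLm : Measurable fun x : ℝ => logPow (lam + α - 1) ν (1 - x) :=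
    (measurable_logPow _ _).comp (measurable_const.sub measurable_id)
  have hmm : AEStronglyMeasurable
      (fun x => logPow (lam + α - 1) ν (1 - x) * weylLeft α a f x)
      (volume.restrict (Ioo a 1)) := hLm.aestronglyMeasurable.mul hm
  -- Beyond `c` the weight dominates. On `(a,d)`, with `d > c` for overlap, the unweighted
  -- integrability of the derivative is used, since the weight vanishes at `0`.
  set c := max ((a + 1) / 2) (1 - Real.exp (-1)) with hc
  have hc1 : c < 1 := max_lt (by linarith) (by linarith [Real.exp_pos (-1)])
  have hca : a < c := lt_of_lt_of_le (by linarith) (le_max_left _ _)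
  have hce : 1 - c ≤ Real.exp (-1) := by linarith [le_max_right ((a + 1) / 2) (1 - Real.exp (-1))]
  set d := (c + 1) / 2 with hd
  have hcd : c < d := by linarith
  have hd1 : d < 1 := by linarith
  have hsub : Ioo a 1 ⊆ Ioo a d ∪ Ioo c 1 := by
    intro x hx
    rcases lt_or_ge x d with hxd | hxd
    · exact Or.inl ⟨hx.1, hxd⟩
    · exact Or.inr ⟨by linarith, hx.2⟩
  refine IntegrableOn.mono_set (IntegrableOn.union ?_ ?_) hsub
  · have hi := ((h.1 d ⟨by linarith, hd1⟩).weylLeft_spec h0 h1).2.1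
    refine (hi.norm.const_mul ((1 + ν / (lam + α - 1)) ^ ν)).mono' ?_ ?_
    · exact hmm.mono_measure (Measure.restrict_mono (Ioo_subset_Ioo_right hd1.le) le_rfl)
    · filter_upwards [ae_restrict_mem measurableSet_Ioo] with x hx
      have hx0 : 0 < 1 - x := by linarith [hx.2]
      have hx1 : 1 - x ≤ 1 := by linarith [hx.1]
      rw [norm_mul, Real.norm_of_nonneg (logPow_nonneg hx0.le hx1)]
      gcongr
      exact logPow_le_const hκ hν hx0 hx1
  · have hi := h.2.mono_set (Ioo_subset_Ioo_left hca.le)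
    refine (hi.norm.const_mul (2 ^ ν)).mono' ?_ ?_
    · exact hmm.mono_measure (Measure.restrict_mono (Ioo_subset_Ioo_left hca.le) le_rfl)
    · filter_upwards [ae_restrict_mem measurableSet_Ioo] with x hx
      have hx0 : 0 < 1 - x := by linarith [hx.2]
      have hx1 : 1 - x ≤ 1 := by linarith [hx.1]
      have hw := logPow_le_weight (lam := lam) (α := α) hν hμ hx0 (by linarith [hx.1])
      rw [norm_mul, norm_mul, Real.norm_of_nonneg (logPow_nonneg hx0.le hx1), ← mul_assoc,
        mul_right_comm]
      gcongr
      exact hw.trans (by gcongr; exact le_abs_self _)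

/-! ### The integrator -/

section Integrator

variable {lam ν C : ℝ} {g : ℝ → ℝ}

lemma LogModulus.tendsto_left (hlam : 0 < lam) (hν : 0 < ν) (hC : 0 ≤ C)
    (hg : LogModulus lam ν C g) {b : ℝ} (hb : b ∈ Ioc (0 : ℝ) 1) :
    Tendsto g (𝓝[<] b) (𝓝 (g b)) := by
  have h := hg.continuousOn hlam hν hC b ⟨hb.1.le, hb.2⟩
  refine h.mono_left ?_
  rw [← nhdsWithin_Ioo_eq_nhdsLT hb.1]
  exact nhdsWithin_mono _ fun x hx => ⟨hx.1.le, hx.2.le.trans hb.2⟩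

lemma LogModulus.centered_eq (hlam : 0 < lam) (hν : 0 < ν) (hC : 0 ≤ C)
    (hg : LogModulus lam ν C g) {b : ℝ} (hb : b ∈ Ioc (0 : ℝ) 1) (x : ℝ) :
    centered g b x = g x - g b := by
  rw [centered, leftLim_eq_of_tendsto (hg.tendsto_left hlam hν hC hb)]

lemma LogModulus.reflect_centered (hg : LogModulus lam ν C g) (b : ℝ) :
    LogModulus lam ν C (fun z => centered g b (1 - z)) := by
  intro x hx y hy
  have := hg (1 - x) ⟨by linarith [hx.2], by linarith [hx.1]⟩ (1 - y)
    ⟨by linarith [hy.2], by linarith [hy.1]⟩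
  rw [sub_sub_sub_cancel_left, abs_sub_comm y x] at this
  simpa only [centered, sub_sub_sub_cancel_right] using this

variable {α b : ℝ}

/-- This is the reason for centring `g`: the bound for the Weyl derivative requires vanishing at the
base point. -/
lemma LogModulus.reflect_centered_zero (hlam : 0 < lam) (hν : 0 < ν) (hC : 0 ≤ C)
    (hg : LogModulus lam ν C g) (hb : b ∈ Ioc (0 : ℝ) 1) :
    (fun z => centered g b (1 - z)) (1 - b) = 0 := by
  simp only [sub_sub_cancel]
  rw [hg.centered_eq hlam hν hC hb, sub_self]

/-- The right-sided Weyl derivative of `g_{b-}`, without its complex factor. -/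
noncomputable def realWeylRight (α b : ℝ) (g : ℝ → ℝ) (x : ℝ) : ℝ :=
  weylLeft (1 - α) (1 - b) (fun z => centered g b (1 - z)) (1 - x)

lemma LogModulus.tendsto_weylRightTrunc (hν : 0 < ν) (hC : 0 ≤ C) (hg : LogModulus lam ν C g)
    (hα : α ∈ Ioo (1 - lam) 1) (hb : b ∈ Ioc (0 : ℝ) 1) {x : ℝ} (hx : x ∈ Ico 0 b) :
    Tendsto (weylRightTrunc (1 - α) b (centered g b) x) (𝓝[>] 0)
      (𝓝 (Complex.exp (Complex.I * Real.pi * ((1 - α : ℝ) : ℂ)) * (realWeylRight α b g x : ℂ))) := by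
  have h := (hg.reflect_centered b).tendsto_weylLeft (β := 1 - α) (T := 1 - b) (z := 1 - x) hν hC
    (by linarith [hα.2]) (by linarith [hα.1]) (by linarith [hb.2])
    ⟨by linarith [hx.2], by linarith [hx.1]⟩
  have h2 := ((Complex.continuous_ofReal.tendsto _).comp h).const_mul
    (Complex.exp (Complex.I * Real.pi * ((1 - α : ℝ) : ℂ)))
  refine h2.congr fun ε => ?_
  rw [weylRightTrunc_eq]
  rfl

lemma LogModulus.weylRight_eq (hν : 0 < ν) (hC : 0 ≤ C) (hg : LogModulus lam ν C g)
    (hα : α ∈ Ioo (1 - lam) 1) (hb : b ∈ Ioc (0 : ℝ) 1) {x : ℝ} (hx : x ∈ Ico 0 b) :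
    weylRight (1 - α) b (centered g b) x =
      Complex.exp (Complex.I * Real.pi * ((1 - α : ℝ) : ℂ)) * (realWeylRight α b g x : ℂ) :=
  (hg.tendsto_weylRightTrunc hν hC hα hb hx).limUnder_eq

/-- The order `1 - α` uses up part of the exponent `lam`; the remainder `lam + α - 1` is the
exponent in the weight. -/
lemma LogModulus.exists_realWeylRight_bound (hlam : lam < 1) (hν : 0 < ν) (hC : 0 ≤ C)
    (hg : LogModulus lam ν C g) (hα : α ∈ Ioo (1 - lam) 1) (hb : b ∈ Ioc (0 : ℝ) 1) :
    ∃ D, 0 ≤ D ∧ ∀ x ∈ Ico 0 b, |realWeylRight α b g x| ≤ D * logPow (lam + α - 1) ν (b - x) := by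
  have hlam0 : 0 < lam := by linarith [hα.1, hα.2]
  obtain ⟨D, hD0, hD⟩ := (hg.reflect_centered b).exists_weylLeft_bound (β := 1 - α) (T := 1 - b)
    hν hC (by linarith [hα.2]) (by linarith [hα.1]) hlam (by linarith [hb.2])
    (hg.reflect_centered_zero hlam0 hν hC hb)
  refine ⟨D, hD0, fun x hx => ?_⟩
  have h := (hD (1 - x) ⟨by linarith [hx.2], by linarith [hx.1]⟩).2
  rwa [sub_sub_sub_cancel_left, show lam - (1 - α) = lam + α - 1 by ring] at h

lemma LogModulus.aestronglyMeasurable_realWeylRight (hν : 0 < ν) (hC : 0 ≤ C)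
    (hg : LogModulus lam ν C g) (hα : α ∈ Ioo (1 - lam) 1) (hb : b ∈ Ioc (0 : ℝ) 1) :
    AEStronglyMeasurable (realWeylRight α b g) (volume.restrict (Ioo 0 b)) := by
  have h := (hg.reflect_centered b).aestronglyMeasurable_weylLeft (β := 1 - α) (T := 1 - b) hν hC
    (by linarith [hα.2]) (by linarith [hα.1]) (by linarith [hb.2])
  have hp := measurePreserving_one_sub 0 b
  rw [sub_zero] at hp
  exact h.comp_measurePreserving hp

lemma LogModulus.exists_realWeylRight_const (hlam : lam < 1) (hν : 0 < ν) (hC : 0 ≤ C)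
    (hg : LogModulus lam ν C g) (hα : α ∈ Ioo (1 - lam) 1) (hb : b ∈ Ioc (0 : ℝ) 1) :
    ∃ B, 0 ≤ B ∧ ∀ x ∈ Ico 0 b, |realWeylRight α b g x| ≤ B := by
  obtain ⟨D, hD0, hD⟩ := hg.exists_realWeylRight_bound hlam hν hC hα hb
  have hκ : 0 < lam + α - 1 := by linarith [hα.1]
  refine ⟨D * (1 + ν / (lam + α - 1)) ^ ν, by positivity, fun x hx => (hD x hx).trans ?_⟩
  gcongr
  exact logPow_le_const hκ hν (by linarith [hx.2]) (by linarith [hx.1, hb.2])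

lemma LogModulus.memLp_weylRight (hlam : lam < 1) (hν : 0 < ν) (hC : 0 ≤ C)
    (hg : LogModulus lam ν C g) (hα : α ∈ Ioo (1 - lam) 1) (hb : b ∈ Ioc (0 : ℝ) 1) :
    MemLp (weylRight (1 - α) b (centered g b)) ⊤ (volume.restrict (Ioo 0 b)) := by
  obtain ⟨B, -, hB⟩ := hg.exists_realWeylRight_const hlam hν hC hα hb
  have heq : (fun x => Complex.exp (Complex.I * Real.pi * ((1 - α : ℝ) : ℂ)) *
      (realWeylRight α b g x : ℂ)) =ᵐ[volume.restrict (Ioo 0 b)]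
      weylRight (1 - α) b (centered g b) := by
    filter_upwards [ae_restrict_mem measurableSet_Ioo] with x hx
    exact (hg.weylRight_eq hν hC hα hb ⟨hx.1.le, hx.2⟩).symm
  refine MemLp.ae_eq heq (MemLp.const_mul ?_ _)
  refine memLp_top_of_bound (C := B) ?_ ?_
  · exact Complex.continuous_ofReal.comp_aestronglyMeasurable
      (hg.aestronglyMeasurable_realWeylRight hν hC hα hb)
  · filter_upwards [ae_restrict_mem measurableSet_Ioo] with x hx
    rw [Complex.norm_real]
    exact hB x ⟨hx.1.le, hx.2⟩

/-- Integrability of the integrand and reduction of the fractional integral to a real integral. -/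
lemma LogModulus.integrand_integrable (hlam : lam < 1) (hν : 0 < ν) (hC : 0 ≤ C)
    (hg : LogModulus lam ν C g) (hα : α ∈ Ioo (1 - lam) 1) (hb : b ∈ Ioc (0 : ℝ) 1) {a : ℝ}
    (ha : 0 ≤ a) {f : ℝ → ℝ}
    (hm : AEStronglyMeasurable (weylLeft α a f) (volume.restrict (Ioo a b)))
    (hi : IntegrableOn (fun x => logPow (lam + α - 1) ν (b - x) * weylLeft α a f x) (Ioo a b)) :
    IntegrableOn (fun x => weylLeft α a f x * realWeylRight α b g x) (Ioo a b) := by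
  obtain ⟨D, hD0, hD⟩ := hg.exists_realWeylRight_bound hlam hν hC hα hb
  have hR := (hg.aestronglyMeasurable_realWeylRight hν hC hα hb).mono_measure
    (Measure.restrict_mono (Ioo_subset_Ioo_left ha) le_rfl)
  refine (hi.norm.const_mul D).mono' (hm.mul hR) ?_
  filter_upwards [ae_restrict_mem measurableSet_Ioo] with x hx
  have h1 := hD x ⟨by linarith [hx.1], hx.2⟩
  have h2 := logPow_nonneg (κ := lam + α - 1) (ν := ν) (show 0 ≤ b - x by linarith [hx.2])
    (by linarith [hx.1, hb.2])
  rw [norm_mul, norm_mul, Real.norm_of_nonneg h2, mul_comm, ← mul_assoc]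
  gcongr
  exact h1

lemma LogModulus.isWellDefined (hν : 0 < ν) (hC : 0 ≤ C)
    (hg : LogModulus lam ν C g) (hα : α ∈ Ioo (1 - lam) 1) (hb : b ∈ Ioc (0 : ℝ) 1) {a : ℝ}
    (ha : 0 ≤ a) {f : ℝ → ℝ}
    (ht : ∀ᵐ x ∂(volume.restrict (Ioo a b)),
      Tendsto (weylLeftTrunc α a f x) (𝓝[>] 0) (𝓝 (weylLeft α a f x)))
    (hi : IntegrableOn (fun x => weylLeft α a f x * realWeylRight α b g x) (Ioo a b)) :
    IsWellDefined α a b f g := by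
  have hlam0 : 0 < lam := by linarith [hα.1, hα.2]
  refine ⟨⟨_, hg.tendsto_left hlam0 hν hC hb⟩, ht.mono fun x hx => ⟨_, hx⟩, fun x hx =>
    ⟨_, hg.tendsto_weylRightTrunc hν hC hα hb ⟨ha.trans hx.1, hx.2⟩⟩, ?_⟩
  refine (integrableOn_congr_fun (fun x hx => ?_) measurableSet_Ioo).1
    ((Integrable.ofReal (𝕜 := ℂ) hi).const_mul
      (Complex.exp (Complex.I * Real.pi * ((1 - α : ℝ) : ℂ))))
  rw [integrand, hg.weylRight_eq hν hC hα hb ⟨ha.trans hx.1.le, hx.2⟩]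
  push_cast
  simp only [Complex.coe_algebraMap]
  ring

lemma LogModulus.fracIntegral_eq (hν : 0 < ν) (hC : 0 ≤ C)
    (hg : LogModulus lam ν C g) (hα : α ∈ Ioo (1 - lam) 1) (hb : b ∈ Ioc (0 : ℝ) 1) {a : ℝ}
    (ha : 0 ≤ a) (hab : a ≤ b) (f : ℝ → ℝ) :
    fracIntegral α a b f g =
      ((-∫ x in Ioo a b, weylLeft α a f x * realWeylRight α b g x : ℝ) : ℂ) := by
  have h1 : ∫ x in a..b, integrand α a b f g x =
      Complex.exp (Complex.I * Real.pi * ((1 - α : ℝ) : ℂ)) *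
        ((∫ x in Ioo a b, weylLeft α a f x * realWeylRight α b g x : ℝ) : ℂ) := by
    rw [intervalIntegral.integral_of_le hab, integral_Ioc_eq_integral_Ioo, ← integral_complex_ofReal,
      ← integral_const_mul]
    refine setIntegral_congr_fun measurableSet_Ioo fun x hx => ?_
    rw [integrand, hg.weylRight_eq hν hC hα hb ⟨ha.trans hx.1.le, hx.2⟩]
    push_cast
    ring
  have h2 : Complex.exp (Complex.I * Real.pi * α) *
      Complex.exp (Complex.I * Real.pi * ((1 - α : ℝ) : ℂ)) = -1 := by
    rw [← Complex.exp_add, ← Complex.exp_pi_mul_I]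
    congr 1
    push_cast
    ring
  rw [fracIntegral, h1, ← mul_assoc, h2]
  push_cast
  ring

end Integrator

/-! ### Convergence of the extended integral -/

section Main

variable {lam ν C : ℝ} {g : ℝ → ℝ} {α : ℝ} {f : ℝ → ℝ}

lemma one_mem_Ioc : (1 : ℝ) ∈ Ioc (0 : ℝ) 1 := ⟨zero_lt_one, le_rfl⟩

lemma LogModulus.weighted_integrable (hlam : lam < 1) (hν : 0 < ν) (hC : 0 ≤ C)
    (hg : LogModulus lam ν C g) (hα : α ∈ Ioo (1 - lam) 1) {μ : ℝ} (hμ : ν < μ) {a : ℝ}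
    (ha : a ∈ Ico (0 : ℝ) 1) (hf : DerivMemWeightedL1 lam α μ a f) :
    IntegrableOn (fun x => weylLeft α a f x * realWeylRight α 1 g x) (Ioo a 1) :=
  have h0 : 0 < α := by linarith [hα.1]
  hg.integrand_integrable hlam hν hC hα one_mem_Ioc ha.1
    (hf.aestronglyMeasurable h0 hα.2 ha.2)
    (hf.integrableOn_logPow hν hμ h0 hα.2 (by linarith [hα.1]) ha.1 ha.2)

/-- The extended integral over `[a,1]` is well defined. -/
lemma LogModulus.isWellDefined_one (hlam : lam < 1) (hν : 0 < ν) (hC : 0 ≤ C)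
    (hg : LogModulus lam ν C g) (hα : α ∈ Ioo (1 - lam) 1) {μ : ℝ} (hμ : ν < μ) {a : ℝ}
    (ha : a ∈ Ico (0 : ℝ) 1) (hf : DerivMemWeightedL1 lam α μ a f) : IsWellDefined α a 1 f g :=
  hg.isWellDefined hν hC hα one_mem_Ioc ha.1
    (hf.ae_tendsto (by linarith [hα.1]) hα.2 ha.2)
    (hg.weighted_integrable hlam hν hC hα hμ ha hf)

lemma LogModulus.integrable_mul_realWeylRight (hlam : lam < 1) (hν : 0 < ν) (hC : 0 ≤ C)
    (hg : LogModulus lam ν C g) (hα : α ∈ Ioo (1 - lam) 1) {t : ℝ} (ht : t ∈ Ioo (0 : ℝ) 1)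
    {φ : ℝ → ℝ} (hφ : IntegrableOn φ (Ioo 0 t)) :
    IntegrableOn (fun x => φ x * realWeylRight α t g x) (Ioo 0 t) := by
  have hb : t ∈ Ioc (0 : ℝ) 1 := ⟨ht.1, ht.2.le⟩
  obtain ⟨B, -, hB⟩ := hg.exists_realWeylRight_const hlam hν hC hα hb
  refine Integrable.mul_bdd (c := B) hφ
    (hg.aestronglyMeasurable_realWeylRight hν hC hα hb) ?_
  filter_upwards [ae_restrict_mem measurableSet_Ioo] with x hx using hB x ⟨hx.1.le, hx.2⟩

/-! ### Independence of the order of the derivative -/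

/-- The Weyl derivative of smaller order is a fractional integral of that of larger order. -/
lemma weylLeft_ae_eq_rlIntegralLeft {α' : ℝ} (h0 : 0 < α') (hα' : α' < α) (h1 : α < 1)
    (hf : ∀ s ∈ Ioo (0 : ℝ) 1, MemRLLeft α 0 s f) :
    weylLeft α' 0 f =ᵐ[volume.restrict (Ioo 0 1)] rlIntegralLeft (α - α') 0 (weylLeft α 0 f) := by
  refine ae_restrict_Ioo_of_forall zero_lt_one fun s hs => ?_
  have hδ : 0 < α - α' := by linarith
  obtain ⟨-, hi, he⟩ := (hf s hs).weylLeft_spec (h0.trans hα') h1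
  -- Almost everywhere `f = I^{α'} (I^{α-α'} D^α f)`, and the inversion theorem for the order `α'`
  -- applies.
  have h := ae_tendsto_weylLeftTrunc (f := f) h0 (hα'.trans h1)
    (rlIntegralLeft_integrable hδ hi).2 (by
      filter_upwards [he, (rlIntegralLeft_integrable (h0.trans hα') hi).1,
        ae_restrict_mem measurableSet_Ioo] with x hx hxi hx'
      rw [rlIntegralLeft_rlIntegralLeft h0 hδ hx'.1, add_sub_cancel, hx]
      · exact (hi.mono_set (Ioo_subset_Ioo_right hx'.2.le)).aestronglyMeasurable
      · rwa [add_sub_cancel])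
  filter_upwards [h] with x hx using hx.limUnder_eq

/-- Fractional integration by parts: `I^δ`, split off from the derivative of `f`, is moved to that
of `g`. The weighted condition is needed for the larger order only, because the derivative of
smaller order is expressed through it. -/
lemma LogModulus.integral_eq_of_lt (hlam : lam < 1) (hν : 0 < ν) (hC : 0 ≤ C)
    (hg : LogModulus lam ν C g) {α' : ℝ} (hα' : 1 - lam < α') (hlt : α' < α) (h1 : α < 1) {μ : ℝ}
    (hμ : ν < μ) (hf : DerivMemWeightedL1 lam α μ 0 f) :
    ∫ x in Ioo 0 1, weylLeft α' 0 f x * realWeylRight α' 1 g x =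
      ∫ x in Ioo 0 1, weylLeft α 0 f x * realWeylRight α 1 g x := by
  have h0' : 0 < α' := by linarith
  have h0 : 0 < α := by linarith
  have hlam0 : 0 < lam := by linarith
  set δ := α - α' with hδd
  have hδ : 0 < δ := by linarith
  have hGδ := Real.Gamma_pos_of_pos hδ
  set φ := weylLeft α 0 f with hφ
  set R := realWeylRight α' 1 g with hR
  have hm' : α' ∈ Ioo (1 - lam) 1 := ⟨hα', hlt.trans h1⟩
  have hRm : AEStronglyMeasurable R (volume.restrict (Ioo 0 1)) :=
    hg.aestronglyMeasurable_realWeylRight hν hC hm' one_mem_Ioc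
  have hφm : AEStronglyMeasurable φ (volume.restrict (Ioo 0 1)) :=
    hf.aestronglyMeasurable h0 h1 zero_lt_one
  obtain ⟨D, hD0, hD⟩ := hg.exists_realWeylRight_bound hlam hν hC hm' one_mem_Ioc
  set κ := lam + α' - 1 with hκd
  have hκ : 0 < κ := by linarith
  set M := (1 + ν / κ) ^ ν with hM
  have hL := (hf.integrableOn_logPow hν hμ h0 h1 (by linarith) le_rfl zero_lt_one)
  -- Since `1 - u ≤ 1 - y`, quasi-monotonicity of `logPow` replaces the bound for `R` at `u` by the
  -- one at `y`.
  have hkabs : ∀ y ∈ Ioo (0 : ℝ) 1, ∀ u ∈ Ioo y 1, |(u - y) ^ (δ - 1) * R u| ≤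
      (u - y) ^ (δ - 1) * (D * (M * logPow κ ν (1 - y))) := by
    intro y hy u hu
    have huy : 0 < u - y := by linarith [hu.1]
    rw [abs_mul, abs_of_pos (show 0 < (u - y) ^ (δ - 1) by positivity)]
    gcongr
    refine (hD u ⟨(hy.1.trans hu.1).le, hu.2⟩).trans ?_
    gcongr
    exact logPow_le hκ hν (by linarith [hu.2]) (by linarith [hu.1]) (by linarith [hy.1])
  have hkint : ∀ y ∈ Ioo (0 : ℝ) 1, IntegrableOn (fun u => (u - y) ^ (δ - 1) * R u) (Ioo y 1) := by
    intro y hy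
    have hp := (integral_sub_rpow_right hδ hy.2.le).1
    refine (hp.mul_const (D * (M * logPow κ ν (1 - y)))).mono' ?_ ?_
    · exact hp.aestronglyMeasurable.mul
        (hRm.mono_measure (Measure.restrict_mono (Ioo_subset_Ioo_left hy.1.le) le_rfl))
    · filter_upwards [ae_restrict_mem measurableSet_Ioo] with u hu using hkabs y hy u hu
  -- Integrating `(u-y)^(δ-1)` gains `(1-y)^δ/δ`, raising the exponent `κ` to `κ + δ = lam + α - 1`,
  -- which `D^α f` is known to tolerate.
  have hfub := triangle_fubini (a := 0) (b := 1) (k := fun u y => (u - y) ^ (δ - 1) * R u)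
    (φ := φ) (W := fun y => D * M / δ * logPow (lam + α - 1) ν (1 - y)) ?_ hφm hkint ?_ ?_
  rotate_left
  · refine AEStronglyMeasurable.mul (f := fun p : ℝ × ℝ => (p.1 - p.2) ^ (δ - 1))
      (g := fun p => R p.1) ?_ hRm.comp_fst
    apply Measurable.aestronglyMeasurable
    fun_prop
  · intro y hy
    obtain ⟨p1, p2⟩ := integral_sub_rpow_right hδ hy.2.le
    refine (setIntegral_mono_on (hkint y hy).abs (p1.mul_const _) measurableSet_Ioo
      (hkabs y hy)).trans (le_of_eq ?_)
    rw [integral_mul_const, p2, show lam + α - 1 = κ + δ by rw [hκd, hδd]; ring,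
      logPow_add (by linarith [hy.2])]
    ring
  · simp only [mul_assoc]
    exact hL.const_mul _
  have hinner : ∀ y ∈ Ioo (0 : ℝ) 1, ∫ u in Ioo y 1, (u - y) ^ (δ - 1) * R u =
      Real.Gamma δ * rlIntegralLeft δ 0
        (weylLeft (1 - α') 0 (fun z => centered g 1 (1 - z))) (1 - y) := by
    intro y hy
    have hy1 : 0 ≤ 1 - y := by linarith [hy.2]
    have h := integral_Ioo_comp_sub_left (fun u => (u - y) ^ (δ - 1) * R u) 1 hy1
    rw [sub_sub_cancel] at h
    rw [← h, rlIntegralLeft_eq _ _ hy1]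
    field_simp
    refine setIntegral_congr_fun measurableSet_Ioo fun v _ => ?_
    simp only [hR, realWeylRight, sub_sub_cancel, sub_self, sub_right_comm (1 : ℝ) v y]
  have hae : ∀ᵐ y ∂(volume.restrict (Ioo (0 : ℝ) 1)), realWeylRight α 1 g y =
      rlIntegralLeft δ 0 (weylLeft (1 - α') 0 (fun z => centered g 1 (1 - z))) (1 - y) := by
    have h := (hg.reflect_centered 1).weylLeft_ae_eq (β := 1 - α') (β' := 1 - α) hν hC
      (by linarith) (by linarith) (by linarith) hlam (by
        have := hg.reflect_centered_zero hlam0 hν hC one_mem_Ioc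
        rwa [sub_self] at this)
    have hp := measurePreserving_one_sub 0 1
    rw [sub_self, sub_zero] at hp
    filter_upwards [hp.quasiMeasurePreserving.ae h] with y hy
    rw [realWeylRight, sub_self, hy, show 1 - α' - (1 - α) = δ by rw [hδd]; ring]
  calc ∫ x in Ioo 0 1, weylLeft α' 0 f x * R x
      = ∫ x in Ioo 0 1, 1 / Real.Gamma δ * ∫ y in Ioo 0 x, (x - y) ^ (δ - 1) * R x * φ y := by
        refine integral_congr_ae ?_
        filter_upwards [weylLeft_ae_eq_rlIntegralLeft h0' hlt h1 hf.1,
          ae_restrict_mem measurableSet_Ioo] with x hx hx'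
        rw [hx, rlIntegralLeft_eq _ _ hx'.1.le, mul_assoc, ← integral_mul_const]
        congr 2
        ext y
        ring
    _ = 1 / Real.Gamma δ * ∫ y in Ioo 0 1, (∫ u in Ioo y 1, (u - y) ^ (δ - 1) * R u) * φ y := by
        rw [integral_const_mul, hfub.2.2.2]
    _ = ∫ y in Ioo 0 1, φ y * realWeylRight α 1 g y := by
        rw [← integral_const_mul]
        refine integral_congr_ae ?_
        filter_upwards [hae, ae_restrict_mem measurableSet_Ioo] with y hy hy'
        rw [hinner y hy', hy]
        field_simp

/-! ### Additivity -/

/-- Changing the base point of the Weyl derivative. -/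
lemma weylLeftTrunc_sub {a t x ε : ℝ} (hα : 0 < α) (hat : a ≤ t) (hε : 0 < ε) (hεx : ε ≤ x - t)
    (hf : IntegrableOn f (Ioo a (x - ε))) :
    weylLeftTrunc α a f x ε - weylLeftTrunc α t f x ε =
      -(1 / Real.Gamma (1 - α) * (α * ∫ u in Ioo a t, f u / (x - u) ^ (α + 1))) := by
  obtain ⟨i1, e1⟩ := weylLeftTrunc_eq (x := x) hα hε (by linarith) hf
  obtain ⟨-, e2⟩ := weylLeftTrunc_eq hα hε hεx (hf.mono_set (Ioo_subset_Ioo_left hat))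
  have htx : t ≤ x - ε := by linarith
  have h1 := (intervalIntegrable_iff_integrableOn_Ioo_of_le hat).2
    (i1.mono_set (Ioo_subset_Ioo_right htx))
  have h2 := (intervalIntegrable_iff_integrableOn_Ioo_of_le htx).2
    (i1.mono_set (Ioo_subset_Ioo_left hat))
  have h3 := intervalIntegral.integral_add_adjacent_intervals h1 h2
  rw [intervalIntegral.integral_of_le hat, intervalIntegral.integral_of_le htx,
    intervalIntegral.integral_of_le (hat.trans htx)] at h3
  simp only [integral_Ioc_eq_integral_Ioo] at h3
  rw [e1, e2, ← h3]
  ring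

/-- Fubini's theorem on a rectangle, for a kernel times a function of one variable. -/
lemma rectangle_fubini {s t : Set ℝ} (ht : MeasurableSet t)
    {k : ℝ → ℝ → ℝ} {φ : ℝ → ℝ} {W : ℝ}
    (hkm : AEStronglyMeasurable (Function.uncurry k)
      ((volume.restrict s).prod (volume.restrict t)))
    (hφ : IntegrableOn φ t) (hk : ∀ y ∈ t, IntegrableOn (fun x => k x y) s)
    (hW : ∀ y ∈ t, ∫ x in s, |k x y| ≤ W) :
    ∫ x in s, ∫ y in t, k x y * φ y = ∫ y in t, (∫ x in s, k x y) * φ y := by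
  have hm : AEStronglyMeasurable (fun p : ℝ × ℝ => k p.1 p.2 * φ p.2)
      ((volume.restrict s).prod (volume.restrict t)) :=
    hkm.mul hφ.aestronglyMeasurable.comp_snd
  have hi : Integrable (fun p : ℝ × ℝ => k p.1 p.2 * φ p.2)
      ((volume.restrict s).prod (volume.restrict t)) := by
    rw [integrable_prod_iff' hm]
    refine ⟨?_, (hφ.norm.const_mul W).mono' hm.norm.prod_swap.integral_prod_right' ?_⟩
    · filter_upwards [ae_restrict_mem ht] with y hy using (hk y hy).mul_const _
    · filter_upwards [ae_restrict_mem ht] with y hy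
      rw [Real.norm_of_nonneg (integral_nonneg fun _ => norm_nonneg _)]
      simp only [norm_mul]
      rw [integral_mul_const]
      gcongr
      exact hW y hy
  rw [← integral_prod _ hi, integral_prod_symm _ hi]
  simp only [integral_mul_const]

/-- The kernel that describes the effect of splitting an interval at `t`. -/
lemma splitting_kernel_bound {t b y : ℝ} (h0 : 0 < α) (h1 : α < 1) (hy : y < t) :
    IntegrableOn (fun x => ((t - y) / (x - t)) ^ α / (x - y)) (Ioo t b) ∧
    ∫ x in Ioo t b, |((t - y) / (x - t)) ^ α / (x - y)| ≤
      ∫ s in Ioi 0, weylMajorant (1 - α) s := by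
  set ε := t - y with hε
  have hε0 : 0 < ε := by linarith
  have hMi := weylMajorant_integrableOn (α := 1 - α) (by linarith) (by linarith)
  have i1 : IntegrableOn (fun s => ε⁻¹ * weylMajorant (1 - α) (s * ε⁻¹)) (Ioi 0) := by
    refine Integrable.const_mul ?_ _
    exact (integrableOn_Ioi_comp_mul_right_iff (weylMajorant (1 - α)) 0 (inv_pos.2 hε0)).2
      (by rw [zero_mul]; exact hMi)
  have e1 : ∫ s in Ioi 0, ε⁻¹ * weylMajorant (1 - α) (s * ε⁻¹) =
      ∫ s in Ioi 0, weylMajorant (1 - α) s := by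
    have := integral_comp_mul_right_Ioi (weylMajorant (1 - α)) 0 (inv_pos.2 hε0)
    simp only [zero_mul, inv_inv, smul_eq_mul] at this
    rw [integral_const_mul, this]
    field_simp
  have hmp : MeasurePreserving (fun x : ℝ => x - t) (volume.restrict (Ioi t))
      (volume.restrict (Ioi 0)) := by
    have h := (measurePreserving_sub_right (volume : Measure ℝ) t).restrict_preimage
      (measurableSet_Ioi (a := (0 : ℝ)))
    rwa [preimage_sub_const_Ioi, zero_add] at h
  have hemb : MeasurableEmbedding (fun x : ℝ => x - t) := measurableEmbedding_subRight t
  have i2 : IntegrableOn (fun x => ε⁻¹ * weylMajorant (1 - α) ((x - t) * ε⁻¹)) (Ioi t) :=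
    (hmp.integrable_comp_emb hemb).2 i1
  have e2 : ∫ x in Ioi t, ε⁻¹ * weylMajorant (1 - α) ((x - t) * ε⁻¹) =
      ∫ s in Ioi 0, weylMajorant (1 - α) s := by
    rw [← e1]
    exact hmp.integral_comp hemb (fun s => ε⁻¹ * weylMajorant (1 - α) (s * ε⁻¹))
  -- With `s = (x-t)/ε` the kernel is `ε⁻¹ s^(-α)/(1+s)`. It is dominated by the rescaled majorant
  -- of order `1 - α`, whose mass does not depend on `ε`, hence not on `y`.
  have hpt : ∀ x ∈ Ioo t b, |(ε / (x - t)) ^ α / (x - y)| ≤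
      ε⁻¹ * weylMajorant (1 - α) ((x - t) * ε⁻¹) := by
    intro x hx
    have hs : 0 < x - t := by linarith [hx.1]
    have hxy : x - y = (x - t) + ε := by rw [hε]; ring
    have hpos : 0 < (ε / (x - t)) ^ α := Real.rpow_pos_of_pos (by positivity) _
    have hrp : ((x - t) * ε⁻¹) ^ (1 - α - 1) = (ε / (x - t)) ^ α := by
      rw [show 1 - α - 1 = -α by ring, Real.rpow_neg (by positivity),
        ← Real.inv_rpow (by positivity), mul_inv, inv_inv, inv_mul_eq_div]
    have hmin : 1 / (x - t + ε) ≤ ε⁻¹ * min 1 (1 / ((x - t) * ε⁻¹)) := by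
      rw [mul_min_of_nonneg _ _ (by positivity), mul_one]
      refine le_min ?_ ?_
      · rw [← one_div]
        gcongr
        linarith
      · rw [show ε⁻¹ * (1 / ((x - t) * ε⁻¹)) = 1 / (x - t) by field_simp]
        gcongr
        linarith
    rw [hxy, abs_of_pos (by positivity), weylMajorant, hrp, mul_left_comm, div_eq_mul_one_div]
    gcongr
  have hsub : Ioo t b ⊆ Ioi t := fun x hx => hx.1
  have hint : IntegrableOn (fun x => (ε / (x - t)) ^ α / (x - y)) (Ioo t b) := by
    refine (i2.mono_set hsub).mono' ?_ ?_
    · apply Measurable.aestronglyMeasurable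
      fun_prop
    · filter_upwards [ae_restrict_mem measurableSet_Ioo] with x hx using hpt x hx
  refine ⟨hint, (setIntegral_mono_on hint.abs (i2.mono_set hsub) measurableSet_Ioo hpt).trans ?_⟩
  rw [← e2]
  refine setIntegral_mono_set i2 ?_ hsub.eventuallyLE
  filter_upwards [ae_restrict_mem measurableSet_Ioi] with x (hx : t < x)
  have hs : 0 < x - t := by linarith
  have := weylMajorant_nonneg (α := 1 - α) (show 0 < (x - t) * ε⁻¹ by positivity)
  exact mul_nonneg (by positivity) this

/-- Changing the base point of the left-sided Weyl derivative of a fractional integral. -/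
lemma weylLeft_sub_eq (h0 : 0 < α) (h1 : α < 1) {t x : ℝ} (ht : t ∈ Ioo (0 : ℝ) 1)
    (hx : x ∈ Ioo t 1) (hf : ∀ s ∈ Ioo (0 : ℝ) 1, MemRLLeft α 0 s f)
    (hx0 : Tendsto (weylLeftTrunc α 0 f x) (𝓝[>] 0) (𝓝 (weylLeft α 0 f x)))
    (hxt : Tendsto (weylLeftTrunc α t f x) (𝓝[>] 0) (𝓝 (weylLeft α t f x))) :
    weylLeft α t f x - weylLeft α 0 f x = 1 / (Real.Gamma α * Real.Gamma (1 - α)) *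
      ∫ y in Ioo 0 t, ((t - y) / (x - t)) ^ α / (x - y) * weylLeft α 0 f y := by
  obtain ⟨-, hφi, he⟩ := (hf t ht).weylLeft_spec h0 h1
  have hfx := (hf x ⟨ht.1.trans hx.1, hx.2⟩).integrableOn h0
  -- The two truncations have the same singular part, so their difference does not depend on `ε`.
  have hlim := tendsto_nhds_unique ((hx0.sub hxt).congr' (by
    filter_upwards [Ioo_mem_nhdsGT (show 0 < x - t by linarith [hx.1])] with ε hε
    exact weylLeftTrunc_sub h0 ht.1.le hε.1 hε.2.le
      (hfx.mono_set (Ioo_subset_Ioo_right (by linarith [hε.1]))))) tendsto_const_nhds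
  have e1 : ∫ u in Ioo 0 t, f u / (x - u) ^ (α + 1) =
      ∫ u in Ioo 0 t, rlIntegralLeft α 0 (weylLeft α 0 f) u / (x - u) ^ (α + 1) := by
    refine integral_congr_ae ?_
    filter_upwards [he] with u hu
    rw [hu]
  rw [e1, (integral_rlIntegralLeft_div h0 ht.1.le hx.1 hφi).2] at hlim
  rw [← neg_sub, hlim, neg_neg, ← mul_assoc]
  congr 1
  field_simp

/-- Changing the end point of the right-sided Weyl derivative of the integrator. -/
lemma LogModulus.realWeylRight_sub_eq (hlam : lam < 1) (hν : 0 < ν) (hC : 0 ≤ C)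
    (hg : LogModulus lam ν C g) (hα : α ∈ Ioo (1 - lam) 1) {t y : ℝ} (ht : t ∈ Ioo (0 : ℝ) 1)
    (hy : y ∈ Ioo 0 t) :
    realWeylRight α 1 g y - realWeylRight α t g y = 1 / (Real.Gamma α * Real.Gamma (1 - α)) *
      ∫ x in Ioo t 1, ((t - y) / (x - t)) ^ α / (x - y) * realWeylRight α 1 g x := by
  have hlam0 : 0 < lam := by linarith [hα.1, hα.2]
  have h0 : 0 < α := by linarith [hα.1]
  set β := 1 - α with hβd
  have hβ : 0 < β := by linarith [hα.2]
  have hβl : β < lam := by linarith [hα.1]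
  have hGα := Real.Gamma_pos_of_pos h0
  have hGβ := Real.Gamma_pos_of_pos hβ
  set k : ℝ → ℝ := fun z => centered g 1 (1 - z) with hk
  set kt : ℝ → ℝ := fun z => centered g t (1 - z) with hkt
  have hkm : LogModulus lam ν C k := hg.reflect_centered 1
  have hktm : LogModulus lam ν C kt := hg.reflect_centered t
  have hk0 : k 0 = 0 := by
    have := hg.reflect_centered_zero hlam0 hν hC one_mem_Ioc
    rwa [sub_self] at this
  set T := 1 - t with hT
  set Y := 1 - y with hY
  have hTm : T ∈ Ioo (0 : ℝ) 1 := ⟨by linarith [ht.2], by linarith [ht.1]⟩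
  have hTY : T < Y := by linarith [hy.2]
  have hY1 : Y < 1 := by linarith [hy.1]
  have hkkt : ∀ z, kt z = k z - k T := by
    intro z
    simp only [hk, hkt, hT, sub_sub_cancel, hg.centered_eq hlam0 hν hC one_mem_Ioc,
      hg.centered_eq hlam0 hν hC ⟨ht.1, ht.2.le⟩]
    ring
  have l1 := hkm.tendsto_weylLeft hν hC hβ hβl le_rfl (z := Y) ⟨by linarith [hTm.1], hY1.le⟩
  have l2 := hktm.tendsto_weylLeft hν hC hβ hβl hTm.1.le (z := Y) ⟨hTY, hY1.le⟩
  have hcont := hkm.continuousOn hlam0 hν hC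
  -- Two effects are combined: the base point moves from `0` to `T`, and the constant `k T` is
  -- subtracted, which affects only the boundary term.
  have hdiff : weylLeft β 0 k Y - weylLeft β T kt Y = 1 / Real.Gamma (1 - β) *
      (k T / (Y - T) ^ β - β * ∫ u in Ioo 0 T, k u / (Y - u) ^ (β + 1)) := by
    refine tendsto_nhds_unique ((l1.sub l2).congr' ?_) tendsto_const_nhds
    filter_upwards [Ioo_mem_nhdsGT (show 0 < Y - T by linarith)] with ε hε
    have hki : IntegrableOn k (Ioo 0 (Y - ε)) :=
      ((hcont.mono (Icc_subset_Icc_right (by linarith [hε.1]))).integrableOn_Icc).mono_set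
        Ioo_subset_Icc_self
    have s1 := weylLeftTrunc_sub hβ hTm.1.le hε.1 hε.2.le hki
    have s2 : weylLeftTrunc β T kt Y ε = weylLeftTrunc β T k Y ε -
        1 / Real.Gamma (1 - β) * (k T / (Y - T) ^ β) := by
      unfold weylLeftTrunc
      simp only [hkkt, sub_sub_sub_cancel_right]
      ring
    rw [s2]
    linear_combination s1
  set ψ := weylLeft β 0 k with hψ
  obtain ⟨D, hD0, hD⟩ := hkm.exists_weylLeft_bound hν hC hβ hβl hlam le_rfl hk0
  have hψm : AEStronglyMeasurable ψ (volume.restrict (Ioo 0 T)) :=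
    (hkm.aestronglyMeasurable_weylLeft hν hC hβ hβl le_rfl).mono_measure
      (Measure.restrict_mono (Ioo_subset_Ioo_right hTm.2.le) le_rfl)
  have hψB : ∀ v ∈ Ioo (0 : ℝ) T, |ψ v| ≤ D * (1 + ν / (lam - β)) ^ ν := by
    intro v hv
    have hv1 : v ≤ 1 := (hv.2.trans hTm.2).le
    have h1 := (hD v ⟨hv.1, hv1⟩).2
    rw [sub_zero] at h1
    exact h1.trans (by gcongr; exact logPow_le_const (by linarith) hν hv.1 hv1)
  have hψi : IntegrableOn ψ (Ioo 0 T) := by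
    refine (integrableOn_const (C := D * (1 + ν / (lam - β)) ^ ν) (by simp)).mono' hψm ?_
    filter_upwards [ae_restrict_mem measurableSet_Ioo] with u hu using hψB u hu
  have hkT : k T = 1 / Real.Gamma β * ∫ v in Ioo 0 T, (T - v) ^ (β - 1) * ψ v := by
    rw [← rlIntegralLeft_eq _ _ hTm.1.le]
    exact hkm.rlIntegralLeft_weylLeft hν hC hβ hβl hlam hk0 hTm
  have i1 := integrableOn_sub_rpow_mul hβ hTm.1.le hψm hψB
  obtain ⟨i2, e2⟩ := integral_rlIntegralLeft_div (x := Y) hβ hTm.1.le hTY hψi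
  have e3 : ∫ u in Ioo 0 T, k u / (Y - u) ^ (β + 1) =
      ∫ u in Ioo 0 T, rlIntegralLeft β 0 ψ u / (Y - u) ^ (β + 1) := by
    refine setIntegral_congr_fun measurableSet_Ioo fun u hu => ?_
    rw [← hkm.rlIntegralLeft_weylLeft hν hC hβ hβl hlam hk0 ⟨hu.1, hu.2.trans hTm.2⟩]
  -- Pointwise this is `1/(T-v) - 1/(Y-v) = (Y-T)/((T-v)(Y-v))`, multiplied by `((T-v)/(Y-T))^β`.
  have e4 : (∫ v in Ioo 0 T, (T - v) ^ (β - 1) * ψ v) / (Y - T) ^ β -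
      ∫ v in Ioo 0 T, ((T - v) / (Y - T)) ^ β / (Y - v) * ψ v =
      ∫ v in Ioo 0 T, ((Y - T) / (T - v)) ^ α / (Y - v) * ψ v := by
    rw [← integral_div, ← integral_sub (i1.div_const _) i2]
    refine setIntegral_congr_fun measurableSet_Ioo fun v hv => ?_
    have hTv : 0 < T - v := by linarith [hv.2]
    have hYT : 0 < Y - T := by linarith
    have hYv : 0 < Y - v := by linarith
    have a1 : (T - v) ^ (β - 1) = (T - v) ^ β / (T - v) := Real.rpow_sub_one hTv.ne' β
    have a2 : ((Y - T) / (T - v)) ^ α = (Y - T) / (Y - T) ^ β / ((T - v) / (T - v) ^ β) := by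
      have hαβ : α = 1 - β := by rw [hβd]; ring
      rw [Real.div_rpow hYT.le hTv.le, hαβ, Real.rpow_sub hYT, Real.rpow_sub hTv, Real.rpow_one,
        Real.rpow_one]
    rw [a1, a2, Real.div_rpow hTv.le hYT.le]
    have hp := (Real.rpow_pos_of_pos hTv β).ne'
    have hq := (Real.rpow_pos_of_pos hYT β).ne'
    generalize (T - v) ^ β = p at hp ⊢
    generalize (Y - T) ^ β = q at hq ⊢
    field_simp
    ring
  -- Under `v = 1 - x` the differences `Y - T`, `T - v`, `Y - v` become `t - y`, `x - t`, `x - y`,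
  -- which yields the kernel of `weylLeft_sub_eq`.
  have e5 : ∫ v in Ioo 0 T, ((Y - T) / (T - v)) ^ α / (Y - v) * ψ v =
      ∫ x in Ioo t 1, ((t - y) / (x - t)) ^ α / (x - y) * realWeylRight α 1 g x := by
    have h := integral_Ioo_comp_sub_left
      (fun x => ((t - y) / (x - t)) ^ α / (x - y) * realWeylRight α 1 g x) 1 hTm.1.le
    rw [show 1 - T = t by rw [hT]; ring] at h
    rw [← h]
    refine setIntegral_congr_fun measurableSet_Ioo fun v _ => ?_
    simp only [hT, hY, hψ, realWeylRight, sub_self, sub_sub_cancel, sub_sub_sub_cancel_left]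
    rw [sub_right_comm (1 : ℝ) t v, sub_right_comm (1 : ℝ) y v]
  have hL : realWeylRight α 1 g y - realWeylRight α t g y =
      weylLeft β 0 k Y - weylLeft β T kt Y := by
    simp only [realWeylRight, sub_self, hk, hkt, hY, hT, hβd]
  rw [hL, hdiff, hkT, e3, e2, ← e5, ← e4, show 1 - β = α by rw [hβd]; ring]
  field_simp

/-- On `(0,t)` the end point of the `g`-derivative changes, on `(t,1)` the base point of the
`f`-derivative. Both corrections are the same double integral over the rectangle, in opposite orders
of integration. -/
lemma LogModulus.integral_add_adjacent (hlam : lam < 1) (hν : 0 < ν) (hC : 0 ≤ C)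
    (hg : LogModulus lam ν C g) (hα : α ∈ Ioo (1 - lam) 1) {μ : ℝ} (hμ : ν < μ)
    (hf : DerivMemWeightedL1 lam α μ 0 f) {t : ℝ} (ht : t ∈ Ioo (0 : ℝ) 1)
    (hft : DerivMemWeightedL1 lam α μ t f) :
    ∫ x in Ioo 0 1, weylLeft α 0 f x * realWeylRight α 1 g x =
      (∫ x in Ioo 0 t, weylLeft α 0 f x * realWeylRight α t g x) +
        ∫ x in Ioo t 1, weylLeft α t f x * realWeylRight α 1 g x := by
  have h0 : 0 < α := by linarith [hα.1]
  set c := 1 / (Real.Gamma α * Real.Gamma (1 - α)) with hc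
  set φ := weylLeft α 0 f with hφ
  set χ := weylLeft α t f with hχ
  set R := realWeylRight α 1 g with hR
  have hφi : IntegrableOn φ (Ioo 0 t) := ((hf.1 t ht).weylLeft_spec h0 hα.2).2.1
  have i1 : IntegrableOn (fun x => φ x * R x) (Ioo 0 1) :=
    hg.weighted_integrable hlam hν hC hα hμ ⟨le_rfl, zero_lt_one⟩ hf
  have i2 : IntegrableOn (fun x => χ x * R x) (Ioo t 1) :=
    hg.weighted_integrable hlam hν hC hα hμ ⟨ht.1.le, ht.2⟩ hft
  have i3 : IntegrableOn (fun x => φ x * realWeylRight α t g x) (Ioo 0 t) :=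
    hg.integrable_mul_realWeylRight hlam hν hC hα ht hφi
  have i1l := i1.mono_set (Ioo_subset_Ioo_right ht.2.le)
  have i1r := i1.mono_set (Ioo_subset_Ioo_left ht.1.le)
  have hsplit : ∫ x in Ioo 0 1, φ x * R x =
      (∫ x in Ioo 0 t, φ x * R x) + ∫ x in Ioo t 1, φ x * R x := by
    have h3 := intervalIntegral.integral_add_adjacent_intervals
      ((intervalIntegrable_iff_integrableOn_Ioo_of_le ht.1.le).2 i1l)
      ((intervalIntegrable_iff_integrableOn_Ioo_of_le ht.2.le).2 i1r)
    rw [intervalIntegral.integral_of_le ht.1.le, intervalIntegral.integral_of_le ht.2.le,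
      intervalIntegral.integral_of_le zero_le_one] at h3
    simp only [integral_Ioc_eq_integral_Ioo] at h3
    exact h3.symm
  have hleft : (∫ x in Ioo 0 t, φ x * R x) - ∫ x in Ioo 0 t, φ x * realWeylRight α t g x =
      c * ∫ y in Ioo 0 t, (∫ x in Ioo t 1, ((t - y) / (x - t)) ^ α / (x - y) * R x) * φ y := by
    rw [← integral_sub i1l i3, ← integral_const_mul]
    refine setIntegral_congr_fun measurableSet_Ioo fun y hy => ?_
    rw [← mul_sub, hR, hg.realWeylRight_sub_eq hlam hν hC hα ht hy]
    ring
  have hright : (∫ x in Ioo t 1, χ x * R x) - ∫ x in Ioo t 1, φ x * R x =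
      c * ∫ x in Ioo t 1, ∫ y in Ioo 0 t, ((t - y) / (x - t)) ^ α / (x - y) * R x * φ y := by
    rw [← integral_sub i2 i1r, ← integral_const_mul]
    refine integral_congr_ae ?_
    filter_upwards [ae_restrict_mem measurableSet_Ioo, hft.ae_tendsto h0 hα.2 ht.2,
      ae_restrict_of_ae_restrict_of_subset (Ioo_subset_Ioo_left ht.1.le)
        (hf.ae_tendsto h0 hα.2 zero_lt_one)] with x hx hxt hx0
    rw [← sub_mul, hχ, hφ, weylLeft_sub_eq h0 hα.2 ht hx hf.1 hx0 hxt, mul_assoc,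
      ← integral_mul_const]
    congr 2
    ext y
    ring
  obtain ⟨B, hB0, hB⟩ := hg.exists_realWeylRight_const hlam hν hC hα one_mem_Ioc
  have hRm : AEStronglyMeasurable R (volume.restrict (Ioo t 1)) :=
    (hg.aestronglyMeasurable_realWeylRight hν hC hα one_mem_Ioc).mono_measure
      (Measure.restrict_mono (Ioo_subset_Ioo_left ht.1.le) le_rfl)
  have hRB : ∀ᵐ x ∂(volume.restrict (Ioo t 1)), ‖R x‖ ≤ B := by
    filter_upwards [ae_restrict_mem measurableSet_Ioo] with x hx
    exact hB x ⟨(ht.1.trans hx.1).le, hx.2⟩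
  -- Absolute convergence: the mass of the kernel in `x` is bounded uniformly in `y`, `R` is bounded
  -- by `B`, and `φ` is integrable on `(0,t)`.
  have hfub := rectangle_fubini (s := Ioo t 1) (t := Ioo 0 t) measurableSet_Ioo
    (k := fun x y => ((t - y) / (x - t)) ^ α / (x - y) * R x) (φ := φ)
    (W := (∫ s in Ioi 0, weylMajorant (1 - α) s) * B) ?_ hφi ?_ ?_
  · rw [hfub] at hright
    rw [hsplit]
    linarith
  · refine AEStronglyMeasurable.mul
      (f := fun p : ℝ × ℝ => ((t - p.2) / (p.1 - t)) ^ α / (p.1 - p.2))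
      (g := fun p => R p.1) ?_ hRm.comp_fst
    apply Measurable.aestronglyMeasurable
    fun_prop
  · intro y hy
    exact Integrable.mul_bdd (splitting_kernel_bound (b := 1) h0 hα.2 hy.2).1 hRm hRB
  · intro y hy
    obtain ⟨b1, b2⟩ := splitting_kernel_bound (b := 1) h0 hα.2 hy.2
    have b3 : IntegrableOn (fun x => ((t - y) / (x - t)) ^ α / (x - y) * R x) (Ioo t 1) :=
      Integrable.mul_bdd b1 hRm hRB
    calc ∫ x in Ioo t 1, |((t - y) / (x - t)) ^ α / (x - y) * R x|
        ≤ ∫ x in Ioo t 1, |((t - y) / (x - t)) ^ α / (x - y)| * B := by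
          refine integral_mono_ae b3.abs (b1.abs.mul_const B) ?_
          filter_upwards [hRB] with x hx
          rw [abs_mul]
          gcongr
          exact hx
      _ ≤ _ := by
          rw [integral_mul_const]
          gcongr

end Main

end FracInt

/-! ### The theorem -/

theorem theorem3 (lam ν : ℝ) (hlam : lam ∈ Set.Ioo (0 : ℝ) 1) (hν : 0 < ν)
    (g : ℝ → ℝ) (hg : FracInt.LogHolder lam ν g) (f : ℝ → ℝ) :
    -- the extended integral is well defined
    (∀ α ∈ Set.Ioo (1 - lam) 1, ∀ μ > ν, FracInt.DerivMemWeightedL1 lam α μ 0 f →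
      FracInt.IsWellDefined α 0 1 f g) ∧
    -- it does not depend on the order of the derivative
    (∀ α₁ ∈ Set.Ioo (1 - lam) 1, ∀ α₂ ∈ Set.Ioo (1 - lam) 1, ∀ μ₁ > ν, ∀ μ₂ > ν,
      FracInt.DerivMemWeightedL1 lam α₁ μ₁ 0 f → FracInt.DerivMemWeightedL1 lam α₂ μ₂ 0 f →
      FracInt.fracIntegral α₁ 0 1 f g = FracInt.fracIntegral α₂ 0 1 f g) ∧
    -- additivity
    (∀ α ∈ Set.Ioo (1 - lam) 1, ∀ μ > ν, FracInt.DerivMemWeightedL1 lam α μ 0 f →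
      ∀ t ∈ Set.Ioo (0 : ℝ) 1,
        (MeasureTheory.IntegrableOn (FracInt.weylLeft α 0 f) (Set.Ioo 0 t) ∧
          MeasureTheory.MemLp (FracInt.weylRight (1 - α) t (FracInt.centered g t)) ⊤
            (MeasureTheory.volume.restrict (Set.Ioo 0 t)) ∧
          FracInt.IsWellDefined α 0 t f g) ∧
        (FracInt.DerivMemWeightedL1 lam α μ t f →
          FracInt.IsWellDefined α t 1 f g ∧
          FracInt.fracIntegral α 0 1 f g =
            FracInt.fracIntegral α 0 t f g + FracInt.fracIntegral α t 1 f g)) := by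
  obtain ⟨C, hC, hk⟩ := hg.exists_logModulus hlam.1 hν
  refine ⟨fun α hα μ hμ hf => hk.isWellDefined_one hlam.2 hν hC hα hμ ⟨le_rfl, zero_lt_one⟩ hf,
    fun α₁ hα₁ α₂ hα₂ μ₁ hμ₁ μ₂ hμ₂ hf₁ hf₂ => ?_, fun α hα μ hμ hf t ht => ⟨?_, fun hft => ?_⟩⟩
  · rw [hk.fracIntegral_eq hν hC hα₁ FracInt.one_mem_Ioc le_rfl zero_le_one,
      hk.fracIntegral_eq hν hC hα₂ FracInt.one_mem_Ioc le_rfl zero_le_one]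
    -- In each strict case the hypothesis belonging to the larger order is the one used.
    rcases lt_trichotomy α₁ α₂ with h | h | h
    · rw [hk.integral_eq_of_lt hlam.2 hν hC hα₁.1 h hα₂.2 hμ₂ hf₂]
    · rw [h]
    · rw [hk.integral_eq_of_lt hlam.2 hν hC hα₂.1 h hα₁.2 hμ₁ hf₁]
  · have h0 : 0 < α := by linarith [hα.1, hlam.2]
    obtain ⟨h1, h2, -⟩ := (hf.1 t ht).weylLeft_spec h0 hα.2
    have hb : t ∈ Set.Ioc (0 : ℝ) 1 := ⟨ht.1, ht.2.le⟩
    exact ⟨h2, hk.memLp_weylRight hlam.2 hν hC hα hb, hk.isWellDefined hν hC hα hb le_rfl h1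
      (hk.integrable_mul_realWeylRight hlam.2 hν hC hα ht h2)⟩
  · refine ⟨hk.isWellDefined_one hlam.2 hν hC hα hμ ⟨ht.1.le, ht.2⟩ hft, ?_⟩
    rw [hk.fracIntegral_eq hν hC hα FracInt.one_mem_Ioc le_rfl zero_le_one,
      hk.fracIntegral_eq hν hC hα ⟨ht.1, ht.2.le⟩ le_rfl ht.1.le,
      hk.fracIntegral_eq hν hC hα FracInt.one_mem_Ioc ht.1.le ht.2.le,
      hk.integral_add_adjacent hlam.2 hν hC hα hμ hf ht hft]
    push_cast
    ring
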